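/- **Setting.** All random variables live on one probability space. Fix $r$ and a deterministic $r\times r$ matrix $Z$. Let $f_t\in\mathbb R^r$ (factors), $e_{it}\in\mathbb R$ (errors), $\lambda_{1,i},\lambda_{2,i}\in\mathbb R^r$ (pre- and post-break loadings), $i,t\ge 1$, be random variables, and $\pi\in(0,1)$. For sample sizes $N,T$ put $T_1=\lfloor\pi T\rfloor$, $T_2=T-T_1$, $\iota_{1t}=1\{t\le T_1\}$, $\iota_{2t}=1\{t>T_1\}$; the data are $x_{it}=\lambda_{m,i}^\top f_t+e_{it}$ if $\iota_{mt}=1$ ($i\le N$, $t\le T$), and $X_m$ is the $T_m\times N$ data matrix of regime $m\in\{1,2\}$. Let $\Lambda_m$ have rows $\lambda_{m,i}^\top$ $(i\le N)$ and let $W=\Lambda_2-\Lambda_1Z$ have rows $w_i^\top$, $w_i=\lambda_{2,i}-Z^\top\lambda_{1,i}$. $\|\cdot\|$ is the Frobenius norm and $M$ a finite constant. **Statistics.** $\tilde F_m$ is $\sqrt{T_m}$ times a matrix of orthonormal eigenvectors of $X_mX_m^\top$ for its $r$ largest eigenvalues, with rows $\tilde f_{m,t}^\top$ (for $t$ in regime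 $m$); $\tilde\Lambda_m=T_m^{-1}X_m^\top\tilde F_m$, with rows $\tilde\lambda_{m,i}^\top$; $\tilde Z=(\tilde\Lambda_1^\top\tilde\Lambda_1)^{-1}\tilde\Lambda_1^\top\tilde\Lambda_2$; $\tilde W=\tilde\Lambda_2-\tilde\Lambda_1\tilde Z$, with rows $\tilde w_i^\top$; $\tilde e_{(m),it}=x_{it}-\tilde\lambda_{m,i}^\top\tilde f_{m,t}$. $\tilde\Theta_{1,i}$ and $\tilde\Theta_{2,i}$ are the Bartlett-kernel HAC estimators, with bandwidths $b_{T_1},b_{T_2}>0$, of the series $\tilde Z^\top\tilde f_{1,t}\tilde e_{(1),it}$ and $\tilde f_{2,t}\tilde e_{(2),it}$: for a series $g_1,\dots,g_L$ and bandwidth $b$ this is $D_0+\sum_{v=1}^{L-1}k(v/b)(D_v+D_v^\top)$, where $D_v=L^{-1}\sum_{t=v+1}^Lg_tg_{t-v}^\top$ and $k(u)=\max(1-|u|,0)$. With $\tilde\Omega_{W,i}=\pi^{-1}\tilde\Theta_{1,i}+(1-\pi)^{-1}\tilde\Theta_{2,i}$ and $\tilde\Omega_W=N^{-1}\sum_{i\le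 N}\tilde\Omega_{W,i}$, $$\mathscr W_{W,i}=T\,\tilde w_i^\top\tilde\Omega_{W,i}^{-1}\tilde w_i,\qquad \mathscr W_W=TN\Big(\tfrac1N\sum_{i\le N}\tilde w_i\Big)^{\!\top}\tilde\Omega_W^{-1}\Big(\tfrac1N\sum_{i\le N}\tilde w_i\Big).$$ **Assumptions.** (In 2, 6, 7, 8, 15, 16: for $m=1,2$.) 1. $E\|f_t\|^4\le M$ and $E(f_tf_t^\top)=\Sigma_F$ for all $t$; $T^{-1}\sum_{t\le T}f_tf_t^\top\to_p\Sigma_F$; $\Sigma_F>0$. 2. $E\|\lambda_{m,i}\|^4\le M$ for all $i$; $\Lambda_m^\top\Lambda_m/N\to_p\Sigma_{\Lambda_m}$ with $\Sigma_{\Lambda_m}>0$ and $\|\Lambda_m^\top\Lambda_m/N-\Sigma_{\Lambda_m}\|=O_p(N^{-1/2})$; $\Lambda_1^\top W=O_p(1)$. 3. For all $N,T$: (a) $E e_{it}=0$, $E|e_{it}|^8\le M$; (b) with $\gamma_N(s,t)=E(N^{-1}\sum_{i\le N}e_{is}e_{it})$, $|\gamma_N(s,s)|\le M$ and $T^{-1}\sum_{t,s\le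 T}|\gamma_N(s,t)|\le M$; (c) $|E(e_{it}e_{jt})|\le\tau_{ij}$ for all $t$, with $N^{-1}\sum_{i,j\le N}|\tau_{ij}|\le M$; (d) $(NT)^{-1}\sum_{i,j\le N}\sum_{t,s\le T}|E(e_{it}e_{js})|\le M$; (e) $E|N^{-1/2}\sum_{i\le N}[e_{is}e_{it}-E(e_{is}e_{it})]|^4\le M$ for all $s,t$. 4. For each $m$, the groups $\{\lambda_{m,i}\}_i$, $\{f_t\}_t$, $\{e_{it}\}_{i,t}$ are mutually independent. 5. For all $N,T$: $\sum_{s\le T}|\gamma_N(s,t)|\le M$ for $t\le T$, and $\sum_{k\le N}|\tau_{ki}|\le M$ for $i\le N$. 6. For all $N,T$: $E\|\frac1{NT}\sum_{s\le T}\sum_{k\le N}f_s[e_{ks}e_{kt}-E(e_{ks}e_{kt})]\iota_{ms}\|^2\le M$ for $t\le T$; $E\|\frac1{\sqrt{NT}}\sum_{t\le T}\sum_{k\le N}f_t\lambda_{m,k}^\top e_{kt}\iota_{mt}\|^2\le M$; $E\|N^{-1/2}\sum_{i\le N}\lambda_{m,i}e_{it}\|^4\le M$ for all $t$. 7. The eigenvalues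 of $\Sigma_{\Lambda_m}\Sigma_F$ are distinct. 8. $0<\pi<1$; $\|\frac1{\sqrt{NT}}\sum_{t\le T}\sum_{k\le N}f_t\lambda_{m,k}^\top e_{kt}\iota_{mt}\|^2=O_p(1)$; $\|\frac{\sqrt T}{T_m}\sum_{t\le T}(f_tf_t^\top-\Sigma_F)\iota_{mt}\|=O_p(1)$. 9. For some $K>0$, $b_T,b_{T_1},b_{T_2}<KT^{1/3}$ for all $T\ge1$; and $T^{2/3}/N\to0$. 10. $E(N^{-1/2}\sum_{i\le N}e_{it})^2\le M$ for all $N,t$. 11. For all $N,T$: $E\|\frac1{\sqrt{NT_m}}\sum_{t\le T}\sum_{k\le N}\lambda_{m,k}[e_{kt}e_{it}-E(e_{kt}e_{it})]\iota_{mt}\|^2\le M$ for $i\le N$; $E\|N^{-1/2}\sum_{i\le N}\lambda_{m,i}e_{it}\|^2\le M$ for all $t$; $E\|T_m^{-1/2}\sum_{t\le T}f_te_{it}\iota_{mt}\|^4\le M$ for all $i$; $E\|\frac1{\sqrt{NT_m}}\sum_{t\le T}\sum_{i\le N}f_te_{it}\iota_{mt}\|^2\le M$. 12. $N^{-1/2}\sum_{i\le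 N}\lambda_{m,i}=O_p(1)$; for all $N,T$: $E\|N^{-1/2}\sum_{i\le N}\lambda_{m,i}e_{it}^2\|^2\le M$ for all $t$, and $E\|\frac1{N\sqrt{T_m}}\sum_{t\le T}\sum_{i\le N}\sum_{k\le N,k\ne i}\lambda_{m,k}e_{kt}e_{it}\iota_{mt}\|^2\le M$. 13. For each $i$: $T^{-1/2}\sum_{t\le T}f_te_{it}\to_dN(0,\Phi_i)$, $T^{-1}\sum_{t\le T}f_tf_t^\top e_{it}^2\to_p\Phi_i$, $\Phi_i>0$; and $(TN)^{-1/2}\sum_{t\le T}\sum_{i\le N}f_te_{it}\to_dN(0,\Phi_W)$, $(TN)^{-1}\sum_{t\le T}\sum_{i\le N}f_tf_t^\top e_{it}^2\to_p\Phi_W$, $\Phi_W>0$. 14. $0<\alpha\le 1/2$ and, for some $C>0$, $\Pr(\|T^{\alpha/2}N^{-1/2}\sum_{i\le N}w_i\|>C)\to1$. Limits in $N$ alone or $T$ alone are as $N\to\infty$, resp. $T\to\infty$; limits involving both are along a given sequence $(N,T)=(N_n,T_n)$ with $N_n,T_n\to\infty$. **Theorem.** Let $\sqrt T/N\to0$ and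 let the alternative $W\ne0$ hold (i.e. not all $w_i$ vanish almost surely). (i) Under assumptions 1–11 and 13, for every $i$ the statistic $\mathscr W_{W,i}$ tends to infinity in probability where $w_i\neq0$: $\Pr(w_i\ne0,\ \mathscr W_{W,i}\le C)\to0$ for every $C\in\mathbb R$. (So $\Pr(\mathscr W_{W,i}>C)\to1$ for every $C$ if $w_i\ne0$ almost surely.) (ii) Under assumptions 1–14, if also $\sqrt N/T^{1-\alpha/2}\to0$, then $\mathscr W_W$ tends to infinity in probability: $\Pr(\mathscr W_W\le C)\to0$ for every $C\in\mathbb R$. -/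

import Mathlib

open MeasureTheory ProbabilityTheory Filter Topology
open scoped Matrix

-- `‖A‖` for a matrix `A` is the Frobenius norm.
attribute [local instance] Matrix.frobeniusNormedAddCommGroup Matrix.frobeniusNormedSpace

namespace FactorBreak

noncomputable section

/-! ### Probabilistic vocabulary -/

/-- `E |Y|^p ≤ M` (in particular the moment is finite). -/
def MomentLE {Ω : Type*} [MeasurableSpace Ω] (μ : Measure Ω) (Y : Ω → ℝ) (p : ℕ) (M : ℝ) : Prop :=
  ∫⁻ ω, ENNReal.ofReal (|Y ω| ^ p) ∂μ ≤ ENNReal.ofReal M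

/-- `Y n = O_p(1)` as `n → ∞`. -/
def BoundedInProb {Ω : Type*} [MeasurableSpace Ω] (μ : Measure Ω) (Y : ℕ → Ω → ℝ) : Prop :=
  ∀ ε : ℝ, 0 < ε → ∃ C : ℝ, ∀ᶠ n in atTop, μ {ω | C < |Y n ω|} ≤ ENNReal.ofReal ε

/-- `Y n → ∞` in probability on the event `A`: for every `C`,
`Pr(A ∩ {Y n ≤ C}) → 0`. (If `A` has probability one: `Pr(Y n > C) → 1` for every `C`.) -/
def DivergesInProbOn {Ω : Type*} [MeasurableSpace Ω] (μ : Measure Ω) (A : Set Ω)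
    (Y : ℕ → Ω → ℝ) : Prop :=
  ∀ C : ℝ, Tendsto (fun n => μ (A ∩ {ω | Y n ω ≤ C})) atTop (𝓝 0)

/-- The outer product `u vᵀ`. -/
def outer {r : ℕ} (u v : EuclideanSpace ℝ (Fin r)) : Matrix (Fin r) (Fin r) ℝ :=
  Matrix.vecMulVec u.ofLp v.ofLp

/-! ### Sample splitting

Time is indexed from `0`: the period `t = 1, …, T` of the text is `t - 1 ∈ {0, …, T - 1}` here;
likewise for the cross section. The regimes `m = 1, 2` are the elements `0, 1` of `Fin 2`. -/

/-- The number `⌊π T⌋` of pre-break observations. -/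
def breakDate (frac : ℝ) (T : ℕ) : ℕ := ⌊frac * T⌋₊

/-- First time index of regime `m`. -/
def offset (frac : ℝ) (T : ℕ) (m : Fin 2) : ℕ := if m = 0 then 0 else breakDate frac T

/-- Length `T_m` of regime `m`: `T₁ = ⌊π T⌋`, `T₂ = T - ⌊π T⌋`. -/
def len (frac : ℝ) (T : ℕ) (m : Fin 2) : ℕ :=
  if m = 0 then breakDate frac T else T - breakDate frac T

/-- The time indices `t < T` with `ι_{mt} = 1`. -/
def regime (frac : ℝ) (T : ℕ) (m : Fin 2) : Finset ℕ :=
  (Finset.range T).filter (fun t => if m = 0 then t < breakDate frac T else breakDate frac T ≤ t)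

/-! ### The model -/

/-- A factor model with `r` factors and one break at the fraction `frac` (`π`): factors `f t`,
errors `e i t`, loadings `lam m i` of the regimes `m`, and the rotational change `Z`. -/
structure Model (Ω : Type*) [MeasurableSpace Ω] (r : ℕ) where
  frac : ℝ
  Z : Matrix (Fin r) (Fin r) ℝ
  lam : Fin 2 → ℕ → Ω → EuclideanSpace ℝ (Fin r)
  f : ℕ → Ω → EuclideanSpace ℝ (Fin r)
  e : ℕ → ℕ → Ω → ℝ
  measurable_lam : ∀ m i, Measurable (lam m i)
  measurable_f : ∀ t, Measurable (f t)
  measurable_e : ∀ i t, Measurable (e i t)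

namespace Model

variable {Ω : Type*} [MeasurableSpace Ω] {r : ℕ} (S : Model Ω r)

/-- The `i`-th row `w_i = λ_{2,i} - Zᵀ λ_{1,i}` of the shift `W = Λ₂ - Λ₁ Z`. -/
def w (i : ℕ) (ω : Ω) : EuclideanSpace ℝ (Fin r) :=
  S.lam 1 i ω - WithLp.toLp 2 (S.Zᵀ *ᵥ (S.lam 0 i ω).ofLp)

/-- The observation `x_{it}` in a sample of length `T`. -/
def obs (T : ℕ) (ω : Ω) (i t : ℕ) : ℝ :=
  (if t < breakDate S.frac T then inner ℝ (S.lam 0 i ω) (S.f t ω)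
    else inner ℝ (S.lam 1 i ω) (S.f t ω)) + S.e i t ω

/-- `Λ_mᵀ Λ_m / N`. -/
def loadingGram (m : Fin 2) (N : ℕ) (ω : Ω) : Matrix (Fin r) (Fin r) ℝ :=
  (1 / (N : ℝ)) • ∑ i ∈ Finset.range N, outer (S.lam m i ω) (S.lam m i ω)

/-- `e_{is} e_{jt} - E(e_{is} e_{jt})`. -/
def centered (μ : Measure Ω) (i s j t : ℕ) (ω : Ω) : ℝ :=
  S.e i s ω * S.e j t ω - ∫ ω', S.e i s ω' * S.e j t ω' ∂μ

/-- `γ_N(s, t) = E(e_sᵀ e_t / N)`. -/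
def gam (μ : Measure Ω) (N s t : ℕ) : ℝ :=
  ∫ ω, (1 / (N : ℝ)) * ∑ i ∈ Finset.range N, S.e i s ω * S.e i t ω ∂μ

/-! ### Assumptions

`M` is the generic finite constant. Assumptions on the limit in `N` only or `T` only are
stated for `N → ∞`, resp. `T → ∞`; those on a joint limit are stated along the sequence
`(N n, T n)` of sample sizes. -/

/-- Factors. -/
structure Factors (μ : Measure Ω) (M : ℝ) (SigF : Matrix (Fin r) (Fin r) ℝ) : Prop where
  posDef : SigF.PosDef
  moment : ∀ t, MomentLE μ (fun ω => ‖S.f t ω‖) 4 M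
  second : ∀ t j k, ∫ ω, S.f t ω j * S.f t ω k ∂μ = SigF j k
  lln : TendstoInMeasure μ
    (fun (T : ℕ) ω => (1 / (T : ℝ)) • ∑ t ∈ Finset.range T, outer (S.f t ω) (S.f t ω))
    atTop (fun _ => SigF)

/-- Loadings. -/
structure Loadings (μ : Measure Ω) (M : ℝ) (SigL : Fin 2 → Matrix (Fin r) (Fin r) ℝ) : Prop where
  posDef : ∀ m, (SigL m).PosDef
  moment : ∀ m i, MomentLE μ (fun ω => ‖S.lam m i ω‖) 4 M
  lln : ∀ m, TendstoInMeasure μ (S.loadingGram m) atTop (fun _ => SigL m)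
  rate : ∀ m, BoundedInProb μ
    (fun N ω => Real.sqrt N * ‖S.loadingGram m N ω - SigL m‖)
  orthogonal : BoundedInProb μ
    (fun N ω => ‖∑ i ∈ Finset.range N, outer (S.lam 0 i ω) (S.w i ω)‖)

/-- Weakly dependent errors. -/
structure Errors (μ : Measure Ω) (M : ℝ) (tau : ℕ → ℕ → ℝ) : Prop where
  mean : ∀ i t, ∫ ω, S.e i t ω ∂μ = 0
  moment : ∀ i t, MomentLE μ (S.e i t) 8 M
  gam_diag : ∀ N s, |S.gam μ N s s| ≤ M
  gam_sum : ∀ N T : ℕ,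
    (1 / (T : ℝ)) * ∑ t ∈ Finset.range T, ∑ s ∈ Finset.range T, |S.gam μ N s t| ≤ M
  tau_bound : ∀ i j t, |∫ ω, S.e i t ω * S.e j t ω ∂μ| ≤ tau i j
  tau_sum : ∀ N : ℕ,
    (1 / (N : ℝ)) * ∑ i ∈ Finset.range N, ∑ j ∈ Finset.range N, |tau i j| ≤ M
  tau_sum_all : ∀ N T : ℕ, (1 / ((N : ℝ) * T)) *
    ∑ i ∈ Finset.range N, ∑ j ∈ Finset.range N, ∑ t ∈ Finset.range T, ∑ s ∈ Finset.range T,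
      |∫ ω, S.e i t ω * S.e j s ω ∂μ| ≤ M
  fourth : ∀ N t s : ℕ, MomentLE μ
    (fun ω => (1 / Real.sqrt N) * ∑ i ∈ Finset.range N, S.centered μ i s i t ω) 4 M

/-- For `m = 1, 2`, `{λ_{m,i}}`, `{f_t}` and `{e_{it}}` are mutually independent groups. -/
def Independence (μ : Measure Ω) : Prop :=
  ∀ m : Fin 2, iIndep
    ![⨆ i, MeasurableSpace.comap (S.lam m i) inferInstance,
      ⨆ t, MeasurableSpace.comap (S.f t) inferInstance,
      ⨆ i, ⨆ t, MeasurableSpace.comap (S.e i t) inferInstance] μ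

/-- Summability of the error covariances. -/
structure ErrorCorr (μ : Measure Ω) (M : ℝ) (tau : ℕ → ℕ → ℝ) : Prop where
  time : ∀ N T t : ℕ, t < T → ∑ s ∈ Finset.range T, |S.gam μ N s t| ≤ M
  cross : ∀ N i : ℕ, i < N → ∑ k ∈ Finset.range N, |tau k i| ≤ M

/-- Moment conditions. -/
structure Moments (μ : Measure Ω) (M : ℝ) : Prop where
  a : ∀ m, ∀ N T t : ℕ, t < T → MomentLE μ (fun ω =>
    ‖(1 / ((N : ℝ) * T)) • ∑ s ∈ regime S.frac T m, ∑ k ∈ Finset.range N,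
      S.centered μ k s k t ω • S.f s ω‖) 2 M
  b : ∀ m, ∀ N T : ℕ, MomentLE μ (fun ω =>
    ‖(1 / Real.sqrt ((N : ℝ) * T)) • ∑ t ∈ regime S.frac T m, ∑ k ∈ Finset.range N,
      S.e k t ω • outer (S.f t ω) (S.lam m k ω)‖) 2 M
  c : ∀ m, ∀ N t : ℕ, MomentLE μ (fun ω =>
    ‖(1 / Real.sqrt N) • ∑ i ∈ Finset.range N, S.e i t ω • S.lam m i ω‖) 4 M

/-- The eigenvalues of `Σ_{Λ_m} Σ_F` are distinct. (All of them are real, as both matrices are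
positive definite.) -/
def DistinctEigenvalues (SigF : Matrix (Fin r) (Fin r) ℝ)
    (SigL : Fin 2 → Matrix (Fin r) (Fin r) ℝ) : Prop :=
  ∀ m, (SigL m * SigF).charpoly.roots.Nodup

/-- Break fraction. -/
structure BreakFraction (μ : Measure Ω) (SigF : Matrix (Fin r) (Fin r) ℝ) (N T : ℕ → ℕ) :
    Prop where
  pos : 0 < S.frac
  lt_one : S.frac < 1
  score : ∀ m, BoundedInProb μ (fun n ω =>
    ‖(1 / Real.sqrt ((N n : ℝ) * T n)) • ∑ t ∈ regime S.frac (T n) m, ∑ k ∈ Finset.range (N n),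
      S.e k t ω • outer (S.f t ω) (S.lam m k ω)‖ ^ 2)
  second : ∀ m, BoundedInProb μ (fun (T : ℕ) ω =>
    ‖(Real.sqrt T / (len S.frac T m : ℝ)) • ∑ t ∈ regime S.frac T m,
      (outer (S.f t ω) (S.f t ω) - SigF)‖)

/-- Bandwidths `b` (as functions of the sample size) for the Bartlett kernel, and the relative
rate of `N` and `T`. -/
structure Bandwidth (b : ℕ → ℝ) (N T : ℕ → ℕ) : Prop where
  pos : ∀ n, 1 ≤ n → 0 < b n
  upper : ∃ K : ℝ, 0 < K ∧ ∀ t : ℕ, 1 ≤ t →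
    b t < K * (t : ℝ) ^ (1 / 3 : ℝ) ∧
    b (breakDate S.frac t) < K * (t : ℝ) ^ (1 / 3 : ℝ) ∧
    b (t - breakDate S.frac t) < K * (t : ℝ) ^ (1 / 3 : ℝ)
  rate : Tendsto (fun n => (T n : ℝ) ^ (2 / 3 : ℝ) / N n) atTop (𝓝 0)

/-- Cross-sectional sums of the errors. -/
def PooledErrors (μ : Measure Ω) (M : ℝ) : Prop :=
  ∀ N t : ℕ, MomentLE μ
    (fun ω => (1 / Real.sqrt N) * ∑ i ∈ Finset.range N, S.e i t ω) 2 M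

/-- Further moment conditions. -/
structure PooledMoments (μ : Measure Ω) (M : ℝ) : Prop where
  a : ∀ m, ∀ N T i : ℕ, i < N → MomentLE μ (fun ω =>
    ‖(1 / Real.sqrt ((N : ℝ) * len S.frac T m)) •
      ∑ t ∈ regime S.frac T m, ∑ k ∈ Finset.range N,
        S.centered μ k t i t ω • S.lam m k ω‖) 2 M
  b : ∀ m, ∀ N t : ℕ, MomentLE μ (fun ω =>
    ‖(1 / Real.sqrt N) • ∑ i ∈ Finset.range N, S.e i t ω • S.lam m i ω‖) 2 M
  c : ∀ m, ∀ T i : ℕ, MomentLE μ (fun ω =>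
    ‖(1 / Real.sqrt (len S.frac T m)) • ∑ t ∈ regime S.frac T m, S.e i t ω • S.f t ω‖) 4 M
  d : ∀ m, ∀ N T : ℕ, MomentLE μ (fun ω =>
    ‖(1 / Real.sqrt ((N : ℝ) * len S.frac T m)) •
      ∑ t ∈ regime S.frac T m, ∑ i ∈ Finset.range N, S.e i t ω • S.f t ω‖) 2 M

/-- Sums of the loadings. -/
structure LoadingSums (μ : Measure Ω) (M : ℝ) : Prop where
  a : ∀ m, BoundedInProb μ (fun (N : ℕ) ω =>
    ‖(1 / Real.sqrt N) • ∑ i ∈ Finset.range N, S.lam m i ω‖)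
  b : ∀ m, ∀ N t : ℕ, MomentLE μ (fun ω =>
    ‖(1 / Real.sqrt N) • ∑ i ∈ Finset.range N, (S.e i t ω) ^ 2 • S.lam m i ω‖) 2 M
  c : ∀ m, ∀ N T : ℕ, MomentLE μ (fun ω =>
    ‖(1 / ((N : ℝ) * Real.sqrt (len S.frac T m))) •
      ∑ t ∈ regime S.frac T m, ∑ i ∈ Finset.range N, ∑ k ∈ (Finset.range N).erase i,
        (S.e k t ω * S.e i t ω) • S.lam m k ω‖) 2 M

/-- Central limit theorems and laws of large numbers for `f_t e_{it}`. -/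
structure CLT (μ : Measure Ω) [IsProbabilityMeasure μ] (Phi : ℕ → Matrix (Fin r) (Fin r) ℝ)
    (PhiW : Matrix (Fin r) (Fin r) ℝ) (N T : ℕ → ℕ) : Prop where
  posDef : ∀ i, (Phi i).PosDef
  clt : ∀ i, TendstoInDistribution
    (fun (T : ℕ) ω => (1 / Real.sqrt T) • ∑ t ∈ Finset.range T, S.e i t ω • S.f t ω)
    atTop id (fun _ => μ) (multivariateGaussian 0 (Phi i))
  lln : ∀ i, TendstoInMeasure μ
    (fun (T : ℕ) ω => (1 / (T : ℝ)) •
      ∑ t ∈ Finset.range T, (S.e i t ω) ^ 2 • outer (S.f t ω) (S.f t ω))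
    atTop (fun _ => Phi i)
  posDef_pooled : PhiW.PosDef
  clt_pooled : TendstoInDistribution
    (fun n ω => (1 / Real.sqrt ((T n : ℝ) * N n)) •
      ∑ t ∈ Finset.range (T n), ∑ i ∈ Finset.range (N n), S.e i t ω • S.f t ω)
    atTop id (fun _ => μ) (multivariateGaussian 0 PhiW)
  lln_pooled : TendstoInMeasure μ
    (fun n ω => (1 / ((T n : ℝ) * N n)) •
      ∑ t ∈ Finset.range (T n), ∑ i ∈ Finset.range (N n),
        (S.e i t ω) ^ 2 • outer (S.f t ω) (S.f t ω))
    atTop (fun _ => PhiW)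

/-- `‖T^{α/2} N^{-1/2} ∑ w_i‖` is bounded away from zero in probability. -/
def ShiftSums (μ : Measure Ω) (alpha : ℝ) (N T : ℕ → ℕ) : Prop :=
  0 < alpha ∧ alpha ≤ 1 / 2 ∧ ∃ C : ℝ, 0 < C ∧
    Tendsto (fun n => μ {ω | C < ‖(((T n : ℝ) ^ (alpha / 2)) / Real.sqrt (N n)) •
      ∑ i ∈ Finset.range (N n), S.w i ω‖}) atTop (𝓝 1)

end Model

/-! ### Estimators and test statistics

They are functions of the data `x i t`, the break fraction, the sample sizes, and the estimated
factor matrices `F m` (of size `T_m × r`) of the two regimes. -/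

section Estimators

variable {r : ℕ} (x : ℕ → ℕ → ℝ) (frac : ℝ) (N T : ℕ)

/-- The `T_m × N` data matrix `X_m` of regime `m`. -/
def dataMatrix (m : Fin 2) : Matrix (Fin (len frac T m)) (Fin N) ℝ :=
  Matrix.of fun t i => x i (offset frac T m + t)

/-- `F` is `√L` times the matrix of the first `r` eigenvectors of `X Xᵀ`: there is an orthonormal
basis `v` of eigenvectors of `X Xᵀ`, with eigenvalues `d` in decreasing order, such that column `j`
of `F` is `√L • v j`. -/
def IsPrincipalComponents {L n r : ℕ} (X : Matrix (Fin L) (Fin n) ℝ)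
    (F : Matrix (Fin L) (Fin r) ℝ) : Prop :=
  ∃ (hr : r ≤ L) (v : OrthonormalBasis (Fin L) ℝ (EuclideanSpace ℝ (Fin L))) (d : Fin L → ℝ),
    Antitone d ∧ (∀ k, (X * Xᵀ) *ᵥ (v k).ofLp = d k • (v k).ofLp) ∧
    ∀ t j, F t j = Real.sqrt L * v (Fin.castLE hr j) t

variable (F : (m : Fin 2) → Matrix (Fin (len frac T m)) (Fin r) ℝ)

/-- Estimated loadings `λ̃_{m,i} = T_m⁻¹ ∑ f̃_{m,t} x_{it}`. -/
def lamTilde (m : Fin 2) (i : ℕ) : Fin r → ℝ :=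
  (1 / (len frac T m : ℝ)) • ∑ t : Fin (len frac T m), x i (offset frac T m + t) • F m t

/-- `Λ̃_m = T_m⁻¹ X_mᵀ F̃_m`, with rows `λ̃_{m,i}`. -/
def LamTilde (m : Fin 2) : Matrix (Fin N) (Fin r) ℝ :=
  Matrix.of fun i => lamTilde x frac T F m i

/-- `Z̃ = (Λ̃₁ᵀ Λ̃₁)⁻¹ Λ̃₁ᵀ Λ̃₂`. -/
def ZTilde : Matrix (Fin r) (Fin r) ℝ :=
  ((LamTilde x frac N T F 0)ᵀ * LamTilde x frac N T F 0)⁻¹ *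
    ((LamTilde x frac N T F 0)ᵀ * LamTilde x frac N T F 1)

/-- The `i`-th row `w̃_i` of `W̃ = Λ̃₂ - Λ̃₁ Z̃`. -/
def wTilde (i : ℕ) : Fin r → ℝ :=
  lamTilde x frac T F 1 i - (ZTilde x frac N T F)ᵀ *ᵥ lamTilde x frac T F 0 i

/-- Residuals `ẽ_{(m),it} = x_{it} - λ̃_{m,i}ᵀ f̃_{m,t}`. -/
def eTilde (m : Fin 2) (i : ℕ) (t : Fin (len frac T m)) : ℝ :=
  x i (offset frac T m + t) - lamTilde x frac T F m i ⬝ᵥ F m t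

/-- Bartlett kernel. -/
def bartlett (u : ℝ) : ℝ := max (1 - |u|) 0

/-- Sample autocovariance `L⁻¹ ∑_{t > v} g_t g_{t-v}ᵀ`. -/
def autocov {L : ℕ} (g : Fin L → Fin r → ℝ) (v : ℕ) : Matrix (Fin r) (Fin r) ℝ :=
  (1 / (L : ℝ)) • ∑ t : Fin L, ∑ s : Fin L,
    if (t : ℕ) = s + v then Matrix.vecMulVec (g t) (g s) else 0

/-- Bartlett HAC estimator of a series `g` of length `L`, with bandwidth `b`. -/
def hac {L : ℕ} (b : ℝ) (g : Fin L → Fin r → ℝ) : Matrix (Fin r) (Fin r) ℝ :=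
  autocov g 0 + ∑ v ∈ Finset.Ico 1 L, bartlett (v / b) • (autocov g v + (autocov g v)ᵀ)

variable (b : ℕ → ℝ)

/-- `Θ̃_{1,i}`: HAC estimator of the series `Z̃ᵀ f̃_{1,t} ẽ_{(1),it}`. -/
def Theta1 (i : ℕ) : Matrix (Fin r) (Fin r) ℝ :=
  hac (b (len frac T 0)) fun t =>
    eTilde x frac T F 0 i t • ((ZTilde x frac N T F)ᵀ *ᵥ F 0 t)

/-- `Θ̃_{2,i}`: HAC estimator of the series `f̃_{2,t} ẽ_{(2),it}`. -/
def Theta2 (i : ℕ) : Matrix (Fin r) (Fin r) ℝ :=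
  hac (b (len frac T 1)) fun t => eTilde x frac T F 1 i t • F 1 t

/-- `Ω̃_{W,i} = π⁻¹ Θ̃_{1,i} + (1 - π)⁻¹ Θ̃_{2,i}`. -/
def OmegaInd (i : ℕ) : Matrix (Fin r) (Fin r) ℝ :=
  (1 / frac) • Theta1 x frac N T F b i + (1 / (1 - frac)) • Theta2 x frac T F b i

/-- `Ω̃_W = N⁻¹ ∑ Ω̃_{W,i}`. -/
def OmegaJoint : Matrix (Fin r) (Fin r) ℝ :=
  (1 / (N : ℝ)) • ∑ i ∈ Finset.range N, OmegaInd x frac N T F b i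

/-- The individual statistic `𝒲_{W,i} = T w̃_iᵀ Ω̃_{W,i}⁻¹ w̃_i`. -/
def statInd (i : ℕ) : ℝ :=
  T * (wTilde x frac N T F i ⬝ᵥ ((OmegaInd x frac N T F b i)⁻¹ *ᵥ wTilde x frac N T F i))

/-- `N⁻¹ ∑ w̃_i`. -/
def wBar : Fin r → ℝ := (1 / (N : ℝ)) • ∑ i ∈ Finset.range N, wTilde x frac N T F i

/-- The joint statistic `𝒲_W = T N (N⁻¹ ∑ w̃_i)ᵀ Ω̃_W⁻¹ (N⁻¹ ∑ w̃_i)`. -/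
def statJoint : ℝ :=
  T * N * (wBar x frac N T F ⬝ᵥ ((OmegaJoint x frac N T F b)⁻¹ *ᵥ wBar x frac N T F))

end Estimators

end

end FactorBreak

/-!
Both parts say that a Wald statistic diverges as soon as the shift `w` of the loadings, of one unit
or averaged over the cross section, is not too small. Three facts suffice. The estimated shift is a
rotation of the shift up to an error of order `ρ = N ^ (-1/2) + T ^ (-1/2)`; the variance estimate
`Ω̃` is nonsingular; and its trace is `O(T ^ (1/3))`. Since `vᵀ Ω⁻¹ v ≥ vᵀ v / tr Ω` for positive
definite `Ω` (`dotProduct_self_le_trace_mul`), the statistic is then at least a constant multiple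
of `T ^ (2/3)` times the squared norm of the estimated shift.

*Typical samples.* Probabilistic orders of magnitude are turned into deterministic ones. A property
of filters on `ℕ × Ω` is `Typical` if, for every `ε`, it holds along the filters of `n → ∞` on sets
of samples of probability at least `1 - ε`. Stochastic boundedness, convergence in probability, and
bounds on means (by Markov's inequality) all give typical properties, finitely many of which hold
simultaneously, and a statistic that tends to infinity along every such filter diverges in
probability (`Typical.diverges`). Along such a filter everything below is about `O` and limits of
Frobenius norms.

*Principal components.* On typical samples each regime, with factors, loadings and errors scaled by
`T_m ^ (-1/2)`, `N ^ (-1/2)` and `(N T_m) ^ (-1/2)`, is an `IsFactorRegime`: the Gram matrices of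
factors and loadings converge to invertible matrices, and `E Eᵀ`, `E Λ` and `Eᵀ F` are of order `ρ`.
By Courant–Fischer (`eigenvalue_lower_bound`) the `r` largest eigenvalues of `X Xᵀ` are bounded
away from zero, so that the eigenvalue equation can be solved for the estimated factors:
`G = F H + O(ρ)` with a rotation `H` that has a bounded inverse (`pcGram_inv`,
`factor_consistency`, `rotF_inv`). Here `H` depends on the sample, and no convergence of `H` is
claimed.

*The estimated shift.* As `Λ₁ᵀ W = O_p(1)`, regressing the estimated loadings of the two regimes on
each other estimates a rotation of `Z` (`regCoef_sub`). The shift of a group of units, be it a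
single unit or the cross section, is therefore bounded by a multiple of the estimated shift plus
`O(ρ)` (`shift_lower_bound`).

*The variance estimate.* The Bartlett kernel is the normalized overlap of two windows of length
`b`, so its quadratic form is the integral of a square (`bartlett_form_eq_integral`). It is thus
strictly positive definite, and `Ω̃` is nonsingular once the products of estimated factors and
residuals span (`hac_posDef`). They do, because the second moment matrix of `f_t e_it` has the
invertible limit `Φ_i` while its third absolute moments are bounded, so that `|xᵀ f_t e_it|` is
bounded below on average, uniformly in unit vectors `x`, and the estimation error is too small to
cancel it (`residual_span`). For the trace, the kernel has total weight at most `1 + 2 b`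
(`trace_hac_le`), and the fourth moments of the estimated factors are controlled by those of the
data, as the estimated factors are linear functions of the cross section
(`mean_factor_fourth_le`).

*Conclusion.* Combining these facts (`typical_shift_le_groupStat`), the statistic diverges if the
shift is at least of order `1 / s` with `ρ s → 0` and `T ^ (2/3) / s ^ 2 → ∞`
(`tendsto_of_shift_bound`). For a single unit `s = 1`. For the cross section
`s = T ^ (α/2)` with `α ≤ 1/2`, where `ρ s → 0` follows from `T ^ (2/3) / N → 0`.
-/

namespace FactorBreak

open Asymptotics

/-! ### Frobenius norm -/

section Frobenius

variable {m n k : Type*} [Fintype m] [Fintype n] [Fintype k]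

lemma norm_sq_eq_sum (A : Matrix m n ℝ) : ‖A‖ ^ 2 = ∑ i, ∑ j, A i j ^ 2 := by
  rw [Matrix.frobenius_norm_def, ← Real.sqrt_eq_rpow, Real.sq_sqrt (by positivity)]
  simp

lemma abs_entry_le_norm (A : Matrix m n ℝ) (i : m) (j : n) : |A i j| ≤ ‖A‖ := by
  refine abs_le_of_sq_le_sq ?_ (norm_nonneg A)
  rw [norm_sq_eq_sum]
  exact (Finset.single_le_sum (f := fun j => A i j ^ 2) (fun _ _ => sq_nonneg _)
    (Finset.mem_univ j)).trans (Finset.single_le_sum (f := fun i => ∑ j, A i j ^ 2)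
      (fun _ _ => Finset.sum_nonneg fun _ _ => sq_nonneg _) (Finset.mem_univ i))

lemma norm_sq_eq_trace (A : Matrix m n ℝ) : ‖A‖ ^ 2 = (Aᵀ * A).trace := by
  rw [norm_sq_eq_sum, Finset.sum_comm]
  simp [Matrix.trace, Matrix.mul_apply, sq]

/-- Cauchy–Schwarz for `‖A x‖² = ⟨x, Aᵀ A x⟩`. -/
lemma norm_mul_col_sq (A : Matrix m n ℝ) (x : Matrix n Unit ℝ) :
    ‖A * x‖ ^ 2 ≤ ‖x‖ * ‖Aᵀ * A * x‖ := by
  have h : ‖A * x‖ ^ 2 = (xᵀ * (Aᵀ * A * x)) () () := by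
    rw [norm_sq_eq_trace]; simp [Matrix.trace, Matrix.mul_assoc]
  rw [h]
  calc _ ≤ |(xᵀ * (Aᵀ * A * x)) () ()| := le_abs_self _
    _ ≤ ‖xᵀ * (Aᵀ * A * x)‖ := abs_entry_le_norm _ _ _
    _ ≤ ‖xᵀ‖ * ‖Aᵀ * A * x‖ := Matrix.frobenius_norm_mul _ _
    _ = _ := by rw [Matrix.frobenius_norm_transpose]

/-- The trace of a matrix is at most its size times its norm. -/
lemma norm_sq_le_card_mul_gram (A : Matrix m n ℝ) :
    ‖A‖ ^ 2 ≤ Fintype.card n * ‖Aᵀ * A‖ := by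
  rw [norm_sq_eq_trace, Matrix.trace]
  calc _ ≤ ∑ _i : n, ‖Aᵀ * A‖ :=
        Finset.sum_le_sum fun i _ => (le_abs_self _).trans (abs_entry_le_norm (Aᵀ * A) i i)
    _ = _ := by simp

end Frobenius

/-! ### Growth of families of matrices -/

section NormBigO

variable {α : Type*} {l : Filter α} {m n k : α → Type*} [∀ a, Fintype (m a)] [∀ a, Fintype (n a)]
  [∀ a, Fintype (k a)]

/-- `‖A a‖ = O(g a)` along `l`, for matrices whose size may depend on `a`. -/
def NormBigO (l : Filter α) (A : ∀ a, Matrix (m a) (n a) ℝ) (g : α → ℝ) : Prop :=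
  (fun a => ‖A a‖) =O[l] g

variable {A B : ∀ a, Matrix (m a) (n a) ℝ} {C : ∀ a, Matrix (n a) (k a) ℝ} {f g : α → ℝ}

lemma NormBigO.congr (h : NormBigO l A g) (hAB : ∀ᶠ a in l, A a = B a) : NormBigO l B g := by
  refine IsBigO.congr' h ?_ EventuallyEq.rfl
  filter_upwards [hAB] with a ha
  rw [ha]

lemma NormBigO.add (hA : NormBigO l A g) (hB : NormBigO l B g) :
    NormBigO l (fun a => A a + B a) g := by
  refine IsBigO.trans (IsBigO.of_norm_le fun a => ?_) (IsBigO.add hA hB)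
  simpa using norm_add_le (A a) (B a)

lemma NormBigO.neg (hA : NormBigO l A g) : NormBigO l (fun a => -A a) g := by
  simpa only [NormBigO, norm_neg] using hA

lemma NormBigO.sub (hA : NormBigO l A g) (hB : NormBigO l B g) :
    NormBigO l (fun a => A a - B a) g := by
  simpa only [sub_eq_add_neg] using hA.add hB.neg

lemma NormBigO.transpose (hA : NormBigO l A g) : NormBigO l (fun a => (A a)ᵀ) g := by
  simpa only [NormBigO, Matrix.frobenius_norm_transpose] using hA

lemma NormBigO.mul (hA : NormBigO l A f) (hC : NormBigO l C g) :
    NormBigO l (fun a => A a * C a) (fun a => f a * g a) := by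
  refine IsBigO.trans (IsBigO.of_norm_le fun a => ?_) (IsBigO.mul hA hC)
  simpa using Matrix.frobenius_norm_mul (A a) (C a)

lemma NormBigO.bdd_mul (hA : NormBigO l A fun _ => 1) (hC : NormBigO l C g) :
    NormBigO l (fun a => A a * C a) g := by
  simpa only [one_mul] using hA.mul hC

lemma NormBigO.mul_bdd (hA : NormBigO l A f) (hC : NormBigO l C fun _ => 1) :
    NormBigO l (fun a => A a * C a) f := by
  simpa only [mul_one] using hA.mul hC

lemma NormBigO.trans (hA : NormBigO l A f) (h : f =O[l] g) : NormBigO l A g :=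
  IsBigO.trans hA h

lemma NormBigO.bdd (hA : NormBigO l A f) (h : Tendsto f l (𝓝 0)) : NormBigO l A fun _ => 1 :=
  hA.trans (h.isBigO_one ℝ)

lemma NormBigO.tendsto (hA : NormBigO l A f) (h : Tendsto f l (𝓝 0)) :
    Tendsto (fun a => ‖A a‖) l (𝓝 0) :=
  IsBigO.trans_tendsto hA h

lemma NormBigO.exists_bound (hA : NormBigO l A fun _ => 1) :
    ∃ K, 0 < K ∧ ∀ᶠ a in l, ‖A a‖ ≤ K := by
  obtain ⟨K, hK, h⟩ := IsBigO.exists_pos hA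
  refine ⟨K, hK, ?_⟩
  filter_upwards [h.bound] with a ha
  simpa using ha

lemma NormBigO.of_sq_le {h : α → ℝ} (hA : ∀ᶠ a in l, ‖A a‖ ^ 2 ≤ h a)
    (hh : h =O[l] fun a => g a ^ 2) : NormBigO l A g := by
  have : (fun a => ‖A a‖ ^ 2) =O[l] fun a => g a ^ 2 := by
    refine IsBigO.trans (IsBigO.of_bound' ?_) hh
    filter_upwards [hA] with a ha
    simpa using ha.trans (le_abs_self _)
  exact this.of_pow two_ne_zero

lemma normBigO_const {p q : Type*} [Fintype p] [Fintype q] (S : Matrix p q ℝ) :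
    NormBigO l (fun _ => S) fun _ => 1 :=
  isBigO_const_const _ one_ne_zero _

end NormBigO

section GramLimit

variable {α : Type*} {l : Filter α} {r : ℕ} {m : α → Type*} [∀ a, Fintype (m a)]

/-- Matrices whose Gram matrices converge are bounded. -/
lemma NormBigO.of_gram {B : ∀ a, Matrix (m a) (Fin r) ℝ} {S : Matrix (Fin r) (Fin r) ℝ}
    (h : Tendsto (fun a => ‖(B a)ᵀ * B a - S‖) l (𝓝 0)) : NormBigO l B fun _ => 1 := by
  have h1 : NormBigO l (fun a => (B a)ᵀ * B a) fun _ => 1 := by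
    have h0 : NormBigO l (fun a => (B a)ᵀ * B a - S) fun _ => 1 := h.isBigO_one ℝ
    simpa only [sub_add_cancel] using h0.add (normBigO_const S)
  refine NormBigO.of_sq_le (h := fun a => Fintype.card (Fin r) * ‖(B a)ᵀ * B a‖)
    (Eventually.of_forall fun a => norm_sq_le_card_mul_gram _) ?_
  simpa only [one_pow] using IsBigO.const_mul_left h1 _

/-- If the Gram matrices converge to an invertible limit, the matrices are eventually injective,
with a uniform bound. -/
lemma exists_lower_of_gram {B : ∀ a, Matrix (m a) (Fin r) ℝ} {S : Matrix (Fin r) (Fin r) ℝ}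
    (hS : IsUnit S) (h : Tendsto (fun a => ‖(B a)ᵀ * B a - S‖) l (𝓝 0)) :
    ∃ c : ℝ, 0 < c ∧ ∀ᶠ a in l, ∀ x : Matrix (Fin r) Unit ℝ, c * ‖x‖ ≤ ‖B a * x‖ := by
  obtain ⟨K, hK, hB⟩ := (NormBigO.of_gram h).exists_bound
  have hdet := (Matrix.isUnit_iff_isUnit_det _).1 hS
  set s := ‖S⁻¹‖ + 1 with hs
  have hs0 : 0 < s := by positivity
  refine ⟨1 / (2 * s * K), by positivity, ?_⟩
  filter_upwards [hB, h.eventually (gt_mem_nhds (show (0 : ℝ) < 1 / (2 * s) by positivity))]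
    with a ha h2 x
  have e1 : ‖x‖ ≤ s * ‖S * x‖ := by
    calc ‖x‖ = ‖S⁻¹ * (S * x)‖ := by
          rw [← Matrix.mul_assoc, Matrix.nonsing_inv_mul _ hdet, Matrix.one_mul]
      _ ≤ ‖S⁻¹‖ * ‖S * x‖ := Matrix.frobenius_norm_mul _ _
      _ ≤ _ := by gcongr; simp [hs]
  have e2 : ‖S * x‖ ≤ ‖(B a)ᵀ * (B a * x)‖ + 1 / (2 * s) * ‖x‖ := by
    have : S * x = (B a)ᵀ * (B a * x) - ((B a)ᵀ * B a - S) * x := by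
      rw [Matrix.sub_mul, Matrix.mul_assoc]; abel
    rw [this]
    refine (norm_sub_le _ _).trans ?_
    gcongr
    exact (Matrix.frobenius_norm_mul _ _).trans (by gcongr)
  have e3 : ‖(B a)ᵀ * (B a * x)‖ ≤ K * ‖B a * x‖ := by
    refine (Matrix.frobenius_norm_mul _ _).trans ?_
    rw [Matrix.frobenius_norm_transpose]
    gcongr
  have e4 : ‖x‖ ≤ s * (K * ‖B a * x‖) + 1 / 2 * ‖x‖ := by
    calc ‖x‖ ≤ s * ‖S * x‖ := e1
      _ ≤ s * (K * ‖B a * x‖ + 1 / (2 * s) * ‖x‖) := by gcongr; linarith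
      _ = _ := by field_simp
  rw [div_mul_eq_mul_div, div_le_iff₀ (by positivity)]
  linarith

/-- Matrices close to the identity are invertible, with bounded inverses. -/
lemma inv_bdd_of_tendsto_one {A : α → Matrix (Fin r) (Fin r) ℝ}
    (h : Tendsto (fun a => ‖A a - 1‖) l (𝓝 0)) :
    (∀ᶠ a in l, IsUnit (A a).det) ∧ NormBigO l (fun a => (A a)⁻¹) fun _ => 1 := by
  have h2 := h.eventually (gt_mem_nhds (show (0 : ℝ) < 1 / 2 by norm_num))
  have hu : ∀ᶠ a in l, IsUnit (A a).det := by
    filter_upwards [h2] with a ha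
    rw [isUnit_iff_ne_zero]
    intro h0
    obtain ⟨v, hv, hv0⟩ := Matrix.exists_mulVec_eq_zero_iff.2 h0
    have e : A a * Matrix.replicateCol Unit v = 0 := by
      rw [← Matrix.replicateCol_mulVec, hv0]; ext; simp
    have e1 : ‖Matrix.replicateCol Unit v‖ ≤ 1 / 2 * ‖Matrix.replicateCol Unit v‖ := by
      calc ‖Matrix.replicateCol Unit v‖ = ‖(A a - 1) * Matrix.replicateCol Unit v‖ := by
            rw [Matrix.sub_mul, e, Matrix.one_mul, zero_sub, norm_neg]
        _ ≤ ‖A a - 1‖ * ‖Matrix.replicateCol Unit v‖ := Matrix.frobenius_norm_mul _ _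
        _ ≤ _ := by gcongr
    have e2 : Matrix.replicateCol Unit v = 0 := by
      rw [← norm_le_zero_iff]; linarith
    exact hv (funext fun i => by simpa using congrFun (congrFun e2 i) ())
  refine ⟨hu, ?_⟩
  refine IsBigO.of_bound (2 * ‖(1 : Matrix (Fin r) (Fin r) ℝ)‖) ?_
  filter_upwards [h2, hu] with a ha hua
  have e : (A a)⁻¹ = 1 - (A a - 1) * (A a)⁻¹ := by
    rw [Matrix.sub_mul, Matrix.mul_nonsing_inv _ hua]; simp
  have e1 : ‖(A a)⁻¹‖ ≤ ‖(1 : Matrix (Fin r) (Fin r) ℝ)‖ + 1 / 2 * ‖(A a)⁻¹‖ := by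
    calc ‖(A a)⁻¹‖ = ‖1 - (A a - 1) * (A a)⁻¹‖ := by rw [← e]
      _ ≤ ‖(1 : Matrix (Fin r) (Fin r) ℝ)‖ + ‖(A a - 1) * (A a)⁻¹‖ := norm_sub_le _ _
      _ ≤ _ := by
        gcongr
        exact (Matrix.frobenius_norm_mul _ _).trans (by gcongr)
  simp only [norm_norm, norm_one, mul_one]
  linarith

end GramLimit

/-! ### Principal components in one sample -/

section UnitPC

variable {r : ℕ}

/-- The matrix `Gᵀ X Xᵀ G`. -/
def pcGram {ι κ : Type*} [Fintype ι] [Fintype κ] (X : Matrix ι κ ℝ) (G : Matrix ι (Fin r) ℝ) :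
    Matrix (Fin r) (Fin r) ℝ :=
  Gᵀ * (X * Xᵀ * G)

/-- The columns of `G` are orthonormal and span an invariant subspace of `X Xᵀ` on which `X Xᵀ` is
at least as large as on any other subspace of dimension `r` (given as the image of `B`). -/
structure IsUnitPC {ι κ : Type*} [Fintype ι] [Fintype κ] (X : Matrix ι κ ℝ)
    (G : Matrix ι (Fin r) ℝ) : Prop where
  orth : Gᵀ * G = 1
  eig : X * Xᵀ * G = G * pcGram X G
  lower : ∀ (c : ℝ) (B : Matrix ι (Fin r) ℝ), 0 < c →
    (∀ x : Matrix (Fin r) Unit ℝ, x ≠ 0 → B * x ≠ 0 ∧ c * ‖B * x‖ ^ 2 ≤ ‖Xᵀ * (B * x)‖ ^ 2) →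
    IsUnit (pcGram X G).det ∧ ‖(pcGram X G)⁻¹‖ ≤ r / c

lemma norm_diagonal_le (d : Fin r → ℝ) (c : ℝ) (hc : 0 ≤ c) (h : ∀ j, |d j| ≤ c) :
    ‖Matrix.diagonal d‖ ≤ r * c := by
  have h1 : ‖Matrix.diagonal d‖ ^ 2 ≤ r * c ^ 2 := by
    rw [norm_sq_eq_sum]
    calc ∑ i, ∑ j, Matrix.diagonal d i j ^ 2 = ∑ i, d i ^ 2 := by
          refine Finset.sum_congr rfl fun i _ => ?_
          rw [Finset.sum_eq_single i] <;> simp +contextual [eq_comm]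
      _ ≤ ∑ _i : Fin r, c ^ 2 := Finset.sum_le_sum fun i _ => by
          rw [← sq_abs]; gcongr; exact h i
      _ = _ := by simp
  refine abs_le_of_sq_le_sq' ?_ (by positivity) |>.2
  refine h1.trans ?_
  rw [mul_pow]
  gcongr
  rcases Nat.eq_zero_or_pos r with rfl | hr
  · simp
  · have : (1 : ℝ) ≤ r := by exact_mod_cast hr
    nlinarith

/-- Courant–Fischer: the `j`-th largest eigenvalue dominates the Rayleigh quotient on a subspace
of dimension larger than `j`. -/
lemma eigenvalue_lower_bound {L n : ℕ} (X : Matrix (Fin L) (Fin n) ℝ)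
    (v : OrthonormalBasis (Fin L) ℝ (EuclideanSpace ℝ (Fin L))) (d : Fin L → ℝ) (hd : Antitone d)
    (hv : ∀ k, (X * Xᵀ) *ᵥ (v k).ofLp = d k • (v k).ofLp) (hr : r ≤ L) (c : ℝ)
    (B : Matrix (Fin L) (Fin r) ℝ)
    (hB : ∀ x : Fin r → ℝ, x ≠ 0 → B *ᵥ x ≠ 0 ∧
      c * (B *ᵥ x ⬝ᵥ B *ᵥ x) ≤ (Xᵀ *ᵥ (B *ᵥ x)) ⬝ᵥ (Xᵀ *ᵥ (B *ᵥ x))) (j : Fin r) :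
    c ≤ d (Fin.castLE hr j) := by
  let φ : (Fin r → ℝ) →ₗ[ℝ] (Fin j → ℝ) :=
    { toFun := fun x k => (v (Fin.castLE (j.2.le.trans hr) k)).ofLp ⬝ᵥ (B *ᵥ x)
      map_add' := fun x y => by ext k; simp [Matrix.mulVec_add, dotProduct_add]
      map_smul' := fun s x => by ext k; simp [Matrix.mulVec_smul, dotProduct_smul] }
  have hker : φ.ker ≠ ⊥ := LinearMap.ker_ne_bot_of_finrank_lt (by simp)
  obtain ⟨x, hx, hx0⟩ := (Submodule.ne_bot_iff _).1 hker
  obtain ⟨hw0, hw⟩ := hB x hx0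
  set w := B *ᵥ x with hwdef
  let W : EuclideanSpace ℝ (Fin L) := WithLp.toLp 2 w
  have hin : ∀ u : EuclideanSpace ℝ (Fin L), ∀ y : Fin L → ℝ,
      inner ℝ u (WithLp.toLp 2 y) = u.ofLp ⬝ᵥ y := fun u y => by
    rw [EuclideanSpace.inner_eq_star_dotProduct, dotProduct_comm]; simp
  have hzero : ∀ k : Fin L, (k : ℕ) < j → inner ℝ (v k) W = 0 := by
    intro k hk
    have := congrFun (LinearMap.mem_ker.1 hx) ⟨k, hk⟩
    rw [hin]
    exact this
  have hquad : (Xᵀ *ᵥ w) ⬝ᵥ (Xᵀ *ᵥ w) = ∑ k, d k * inner ℝ (v k) W ^ 2 := by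
    have h1 : (Xᵀ *ᵥ w) ⬝ᵥ (Xᵀ *ᵥ w) = w ⬝ᵥ ((X * Xᵀ) *ᵥ w) := by
      rw [← Matrix.mulVec_mulVec, Matrix.dotProduct_mulVec w X, Matrix.mulVec_transpose]
    have h2 : w ⬝ᵥ ((X * Xᵀ) *ᵥ w) = inner ℝ W (WithLp.toLp 2 ((X * Xᵀ) *ᵥ w)) := by
      rw [hin]
    rw [h1, h2, ← v.sum_inner_mul_inner]
    refine Finset.sum_congr rfl fun k _ => ?_
    have h3 : inner ℝ (v k) (WithLp.toLp 2 ((X * Xᵀ) *ᵥ w)) = d k * inner ℝ (v k) W := by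
      rw [hin, hin, Matrix.dotProduct_mulVec, ← Matrix.mulVec_transpose]
      have : (X * Xᵀ)ᵀ = X * Xᵀ := by simp
      rw [this, hv k, smul_dotProduct, smul_eq_mul]
    rw [h3, real_inner_comm]
    ring
  have hnorm : w ⬝ᵥ w = ∑ k, inner ℝ (v k) W ^ 2 := by
    have : w ⬝ᵥ w = inner ℝ W W := by rw [hin]
    rw [this, ← v.sum_inner_mul_inner]
    refine Finset.sum_congr rfl fun k _ => ?_
    rw [real_inner_comm, sq]
  have hpos : 0 < w ⬝ᵥ w := by
    rw [lt_iff_le_and_ne]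
    exact ⟨Finset.sum_nonneg fun i _ => mul_self_nonneg _,
      fun h => hw0 (dotProduct_self_eq_zero.1 h.symm)⟩
  have hle : (Xᵀ *ᵥ w) ⬝ᵥ (Xᵀ *ᵥ w) ≤ d (Fin.castLE hr j) * (w ⬝ᵥ w) := by
    rw [hquad, hnorm, Finset.mul_sum]
    refine Finset.sum_le_sum fun k _ => ?_
    rcases lt_or_ge (k : ℕ) j with hk | hk
    · rw [hzero k hk]; simp
    · gcongr
      exact hd hk
  exact le_of_mul_le_mul_right (hw.trans hle) hpos

lemma mul_replicateCol {m n : Type*} [Fintype n] (A : Matrix m n ℝ) (x : n → ℝ) :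
    A * Matrix.replicateCol Unit x = Matrix.replicateCol Unit (A *ᵥ x) :=
  (Matrix.replicateCol_mulVec A x).symm

lemma norm_replicateCol_sq {n : Type*} [Fintype n] (x : n → ℝ) :
    ‖Matrix.replicateCol Unit x‖ ^ 2 = x ⬝ᵥ x := by
  rw [norm_sq_eq_sum]; simp [dotProduct, sq]

/-- The principal components estimates of the factors, scaled to orthonormal columns. -/
lemma IsPrincipalComponents.isUnitPC {L n : ℕ} (hL : 0 < L) (hn : 0 < n)
    {X : Matrix (Fin L) (Fin n) ℝ} {F : Matrix (Fin L) (Fin r) ℝ}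
    (h : IsPrincipalComponents X F) :
    IsUnitPC ((1 / Real.sqrt (n * L)) • X) ((1 / Real.sqrt L) • F) := by
  obtain ⟨hr, v, d, hd, hv, hF⟩ := h
  have hL' : (0 : ℝ) < L := by exact_mod_cast hL
  have hn' : (0 : ℝ) < n := by exact_mod_cast hn
  set G : Matrix (Fin L) (Fin r) ℝ := (1 / Real.sqrt L) • F with hGdef
  set c : ℝ := 1 / Real.sqrt (n * L) with hc
  have hc2 : c * c = 1 / (n * L) := by
    rw [hc, div_mul_div_comm, Real.mul_self_sqrt (by positivity), one_mul]
  have hcpos : 0 < c := by positivity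
  have hG : ∀ t j, G t j = v (Fin.castLE hr j) t := by
    intro t j
    have : Real.sqrt L ≠ 0 := by positivity
    simp only [hGdef, Matrix.smul_apply, hF, smul_eq_mul]
    field_simp
  have horth : Gᵀ * G = 1 := by
    ext i j
    have h1 : (Gᵀ * G) i j = inner ℝ (v (Fin.castLE hr i)) (v (Fin.castLE hr j)) := by
      simp only [Matrix.mul_apply, Matrix.transpose_apply, hG, PiLp.inner_apply]
      simp [mul_comm]
    rw [h1, orthonormal_iff_ite.1 v.orthonormal]
    simp [Matrix.one_apply]
  set D : Fin r → ℝ := fun j => c * c * d (Fin.castLE hr j) with hD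
  have heig : (c • X) * (c • X)ᵀ * G = G * Matrix.diagonal D := by
    have h0 : (c • X) * (c • X)ᵀ * G = (c * c) • (X * Xᵀ * G) := by
      simp [Matrix.transpose_smul, smul_smul]
    rw [h0]
    ext t j
    have h1 : (X * Xᵀ * G) t j = ((X * Xᵀ) *ᵥ (v (Fin.castLE hr j)).ofLp) t := by
      simp only [Matrix.mul_apply (M := X * Xᵀ), hG, Matrix.mulVec, dotProduct]
    rw [Matrix.smul_apply, h1, hv, Matrix.mul_diagonal, hG]
    simp only [Pi.smul_apply, smul_eq_mul, hD]
    ring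
  have hgram : pcGram (c • X) G = Matrix.diagonal D := by
    rw [pcGram, heig, ← Matrix.mul_assoc, horth, Matrix.one_mul]
  refine ⟨horth, by rw [hgram, heig], fun κ B hκ hB => ?_⟩
  have hlow : ∀ j, κ ≤ D j := by
    intro j
    have := eigenvalue_lower_bound X v d hd hv hr (κ * (n * L)) B (fun x hx => ?_) j
    · rw [hD]
      simp only [hc2]
      rw [one_div, inv_mul_eq_div, le_div_iff₀ (by positivity)]
      exact this
    · have hx' : Matrix.replicateCol Unit x ≠ 0 := fun h0 =>
        hx (funext fun i => by simpa using congrFun (congrFun h0 i) ())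
      obtain ⟨h1, h2⟩ := hB _ hx'
      rw [mul_replicateCol] at h1 h2
      rw [mul_replicateCol, norm_replicateCol_sq, norm_replicateCol_sq] at h2
      refine ⟨fun h0 => h1 (by rw [h0]; ext; simp), ?_⟩
      have e : ((c • X)ᵀ *ᵥ B *ᵥ x) ⬝ᵥ ((c • X)ᵀ *ᵥ B *ᵥ x)
          = 1 / (n * L) * ((Xᵀ *ᵥ B *ᵥ x) ⬝ᵥ (Xᵀ *ᵥ B *ᵥ x)) := by
        rw [← hc2, Matrix.transpose_smul, Matrix.smul_mulVec, smul_dotProduct, dotProduct_smul]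
        simp [mul_assoc]
      rw [e, one_div, inv_mul_eq_div, le_div_iff₀ (by positivity)] at h2
      linarith
  have hDpos : ∀ j, 0 < D j := fun j => hκ.trans_le (hlow j)
  have hmul : Matrix.diagonal D * Matrix.diagonal (fun j => (D j)⁻¹) = 1 := by
    rw [Matrix.diagonal_mul_diagonal, ← Matrix.diagonal_one]
    congr 1
    funext j
    exact mul_inv_cancel₀ (hDpos j).ne'
  rw [hgram]
  refine ⟨?_, ?_⟩
  · rw [Matrix.det_diagonal, isUnit_iff_ne_zero]
    exact Finset.prod_ne_zero_iff.2 fun j _ => (hDpos j).ne'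
  · rw [Matrix.inv_eq_right_inv hmul, div_eq_mul_inv]
    refine norm_diagonal_le _ _ (by positivity) fun j => ?_
    rw [abs_of_pos (inv_pos.2 (hDpos j))]
    exact inv_anti₀ hκ (hlow j)

end UnitPC

/-! ### Asymptotics of principal components -/

section Regime

variable {α : Type*} {l : Filter α} {r : ℕ} {L N : α → ℕ} {ρ : α → ℝ}
  {F G : ∀ a, Matrix (Fin (L a)) (Fin r) ℝ} {Λ : ∀ a, Matrix (Fin (N a)) (Fin r) ℝ}
  {E : ∀ a, Matrix (Fin (L a)) (Fin (N a)) ℝ} {SF SL : Matrix (Fin r) (Fin r) ℝ}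

/-- A factor model `X = F Λᵀ + E` along a filter, with factors, loadings and errors scaled by
`L ^ (-1/2)`, `N ^ (-1/2)` and `(N L) ^ (-1/2)`, and with scaled principal components `G`. The
rate is `ρ = N ^ (-1/2) + T ^ (-1/2)`. -/
structure IsFactorRegime (l : Filter α) (ρ : α → ℝ) (F : ∀ a, Matrix (Fin (L a)) (Fin r) ℝ)
    (Λ : ∀ a, Matrix (Fin (N a)) (Fin r) ℝ) (E : ∀ a, Matrix (Fin (L a)) (Fin (N a)) ℝ)
    (G : ∀ a, Matrix (Fin (L a)) (Fin r) ℝ) (SF SL : Matrix (Fin r) (Fin r) ℝ) : Prop where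
  rate : Tendsto ρ l (𝓝 0)
  unitF : IsUnit SF
  unitL : IsUnit SL
  factor : Tendsto (fun a => ‖(F a)ᵀ * F a - SF‖) l (𝓝 0)
  loading : Tendsto (fun a => ‖(Λ a)ᵀ * Λ a - SL‖) l (𝓝 0)
  noise : NormBigO l E fun _ => 1
  noiseGram : NormBigO l (fun a => E a * (E a)ᵀ) ρ
  noiseLoading : NormBigO l (fun a => E a * Λ a) ρ
  factorNoise : NormBigO l (fun a => (E a)ᵀ * F a) ρ
  pc : ∀ᶠ a in l, IsUnitPC (F a * (Λ a)ᵀ + E a) (G a)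

/-- The scaled data `F Λᵀ + E`. -/
def regData (F : ∀ a, Matrix (Fin (L a)) (Fin r) ℝ) (Λ : ∀ a, Matrix (Fin (N a)) (Fin r) ℝ)
    (E : ∀ a, Matrix (Fin (L a)) (Fin (N a)) ℝ) (a : α) : Matrix (Fin (L a)) (Fin (N a)) ℝ :=
  F a * (Λ a)ᵀ + E a

/-- The rotation `Fᵀ G` by which the estimated loadings differ from the loadings. -/
def rot (F G : ∀ a, Matrix (Fin (L a)) (Fin r) ℝ) (a : α) : Matrix (Fin r) (Fin r) ℝ :=
  (F a)ᵀ * G a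

/-- The rotation `Λᵀ Λ Fᵀ G (Gᵀ X Xᵀ G)⁻¹` by which the estimated factors differ from the
factors. -/
noncomputable def rotF (F G : ∀ a, Matrix (Fin (L a)) (Fin r) ℝ)
    (Λ : ∀ a, Matrix (Fin (N a)) (Fin r) ℝ)
    (E : ∀ a, Matrix (Fin (L a)) (Fin (N a)) ℝ) (a : α) : Matrix (Fin r) (Fin r) ℝ :=
  (Λ a)ᵀ * Λ a * rot F G a * (pcGram (regData F Λ E a) (G a))⁻¹

/-- Estimated loadings: `Xᵀ G = Λ (Fᵀ G) + Eᵀ G`. -/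
lemma regData_transpose_mul (a : α) :
    (regData F Λ E a)ᵀ * G a = Λ a * rot F G a + (E a)ᵀ * G a := by
  rw [regData, rot, Matrix.transpose_add, Matrix.transpose_mul, Matrix.transpose_transpose,
    Matrix.add_mul, Matrix.mul_assoc]

namespace IsFactorRegime

variable (h : IsFactorRegime l ρ F Λ E G SF SL)
include h

lemma bddF : NormBigO l F fun _ => 1 := .of_gram h.factor

lemma bddL : NormBigO l Λ fun _ => 1 := .of_gram h.loading

lemma bddG : NormBigO l G fun _ => 1 := by
  refine NormBigO.of_gram (S := 1) ?_
  refine Tendsto.congr' ?_ tendsto_const_nhds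
  filter_upwards [h.pc] with a ha
  rw [ha.orth, sub_self, norm_zero]

lemma bddX : NormBigO l (regData F Λ E) fun _ => 1 :=
  (h.bddF.bdd_mul h.bddL.transpose).add h.noise

/-- On the column space of `F` the signal dominates the noise, so the `r` largest eigenvalues are
bounded away from zero. -/
lemma pcGram_inv : (∀ᶠ a in l, IsUnit (pcGram (regData F Λ E a) (G a)).det) ∧
    NormBigO l (fun a => (pcGram (regData F Λ E a) (G a))⁻¹) fun _ => 1 := by
  obtain ⟨cF, hcF, hF⟩ := exists_lower_of_gram h.unitF h.factor
  obtain ⟨cL, hcL, hΛ⟩ := exists_lower_of_gram h.unitL h.loading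
  obtain ⟨K, hK, hFK⟩ := h.bddF.exists_bound
  -- `‖Λ Fᵀ F x‖ ≥ c0 ‖x‖`, which is to dominate `‖Eᵀ F x‖`
  set c0 := cL * cF ^ 2 with hc0
  have hc0p : 0 < c0 := by positivity
  -- makes `‖Eᵀ F x‖ ≤ c0 / 2 * ‖x‖`, by `‖F x‖ ≤ K ‖x‖`
  have hsmall : ∀ᶠ a in l, ‖E a * (E a)ᵀ‖ < (c0 / (2 * K)) ^ 2 :=
    (h.noiseGram.tendsto h.rate).eventually (gt_mem_nhds (by positivity))
  set c := (c0 / (2 * K)) ^ 2 with hc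
  have hcp : 0 < c := by positivity
  have key : ∀ᶠ a in l, IsUnit (pcGram (regData F Λ E a) (G a)).det ∧
      ‖(pcGram (regData F Λ E a) (G a))⁻¹‖ ≤ r / c := by
    filter_upwards [hF, hΛ, hFK, hsmall, h.pc] with a h1 h2 h3 h4 h5
    refine h5.lower c (F a) hcp fun x hx => ?_
    have hx0 : 0 < ‖x‖ := norm_pos_iff.2 hx
    refine ⟨fun h0 => ?_, ?_⟩
    · have := h1 x
      rw [h0, norm_zero] at this
      nlinarith
    have hFx : ‖F a * x‖ ≤ K * ‖x‖ := (Matrix.frobenius_norm_mul _ _).trans (by gcongr)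
    have hFF : cF ^ 2 * ‖x‖ ≤ ‖(F a)ᵀ * (F a * x)‖ := by
      have e1 : (cF * ‖x‖) ^ 2 ≤ ‖x‖ * ‖(F a)ᵀ * (F a * x)‖ := by
        rw [← Matrix.mul_assoc]
        exact le_trans (by gcongr; exact h1 x) (norm_mul_col_sq _ _)
      have e2 : ‖x‖ * (cF ^ 2 * ‖x‖) ≤ ‖x‖ * ‖(F a)ᵀ * (F a * x)‖ := by linarith
      exact le_of_mul_le_mul_left e2 hx0
    have hS : c0 * ‖x‖ ≤ ‖Λ a * ((F a)ᵀ * (F a * x))‖ := by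
      calc c0 * ‖x‖ = cL * (cF ^ 2 * ‖x‖) := by rw [hc0]; ring
        _ ≤ cL * ‖(F a)ᵀ * (F a * x)‖ := by gcongr
        _ ≤ _ := h2 _
    have hE : ‖(E a)ᵀ * (F a * x)‖ ≤ c0 / 2 * ‖x‖ := by
      have e1 : ‖(E a)ᵀ * (F a * x)‖ ^ 2 ≤ ‖F a * x‖ * (‖E a * (E a)ᵀ‖ * ‖F a * x‖) := by
        refine (norm_mul_col_sq _ _).trans ?_
        rw [Matrix.transpose_transpose]
        gcongr
        exact Matrix.frobenius_norm_mul _ _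
      have e2 : ‖(E a)ᵀ * (F a * x)‖ ^ 2 ≤ (c0 / 2 * ‖x‖) ^ 2 := by
        calc _ ≤ ‖F a * x‖ * (‖E a * (E a)ᵀ‖ * ‖F a * x‖) := e1
          _ ≤ (K * ‖x‖) * ((c0 / (2 * K)) ^ 2 * (K * ‖x‖)) := by gcongr
          _ = _ := by field_simp
      exact abs_le_of_sq_le_sq' e2 (by positivity) |>.2
    have hX : (F a * (Λ a)ᵀ + E a)ᵀ * (F a * x)
        = Λ a * ((F a)ᵀ * (F a * x)) + (E a)ᵀ * (F a * x) := by
      rw [Matrix.transpose_add, Matrix.transpose_mul, Matrix.transpose_transpose, Matrix.add_mul,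
        Matrix.mul_assoc (Λ a)]
    have hlow : c0 / 2 * ‖x‖ ≤ ‖(F a * (Λ a)ᵀ + E a)ᵀ * (F a * x)‖ := by
      rw [hX]
      have := norm_sub_le (Λ a * ((F a)ᵀ * (F a * x)) + (E a)ᵀ * (F a * x)) ((E a)ᵀ * (F a * x))
      rw [add_sub_cancel_right] at this
      linarith
    calc c * ‖F a * x‖ ^ 2 ≤ c * (K * ‖x‖) ^ 2 := by gcongr
      _ = (c0 / 2 * ‖x‖) ^ 2 := by rw [hc]; field_simp
      _ ≤ _ := by gcongr
  refine ⟨key.mono fun a ha => ha.1, IsBigO.of_bound (r / c) (key.mono fun a ha => ?_)⟩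
  simpa using ha.2

lemma bddRot : NormBigO l (rot F G) fun _ => 1 := h.bddF.transpose.bdd_mul h.bddG

lemma bddRotF : NormBigO l (rotF F G Λ E) fun _ => 1 :=
  ((h.bddL.transpose.bdd_mul h.bddL).bdd_mul h.bddRot).bdd_mul h.pcGram_inv.2

/-- The estimated factors are consistent up to the rotation `rotF`: expand `X Xᵀ` in
`G = X Xᵀ G (Gᵀ X Xᵀ G)⁻¹`. -/
lemma factor_consistency : NormBigO l (fun a => G a - F a * rotF F G Λ E a) ρ := by
  have hN := ((h.bddF.bdd_mul h.noiseLoading.transpose).add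
    (h.noiseLoading.mul_bdd h.bddF.transpose)).add h.noiseGram
  refine ((hN.mul_bdd h.bddG).mul_bdd h.pcGram_inv.2).congr ?_
  filter_upwards [h.pc, h.pcGram_inv.1] with a ha hu
  have e : G a = regData F Λ E a * (regData F Λ E a)ᵀ * G a *
      (pcGram (regData F Λ E a) (G a))⁻¹ := by
    rw [show regData F Λ E a = F a * (Λ a)ᵀ + E a from rfl] at hu ⊢
    rw [ha.eig, Matrix.mul_assoc, Matrix.mul_nonsing_inv _ hu, Matrix.mul_one]
  conv_rhs => rw [e]
  simp only [rotF, rot, regData, Matrix.transpose_add, Matrix.transpose_mul,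
    Matrix.transpose_transpose, Matrix.add_mul, Matrix.mul_add, Matrix.mul_assoc]
  abel

/-- Inserting `G ≈ F H` into `Gᵀ G = 1` shows that the rotations of estimated factors and loadings
are asymptotically inverse to each other, up to transposition. -/
lemma rotF_transpose_mul_rot :
    Tendsto (fun a => ‖(rotF F G Λ E a)ᵀ * rot F G a - 1‖) l (𝓝 0) := by
  refine NormBigO.tendsto (f := ρ) ?_ h.rate
  refine ((h.factor_consistency.transpose.mul_bdd h.bddG).neg).congr ?_
  filter_upwards [h.pc] with a ha
  rw [Matrix.transpose_sub, Matrix.sub_mul, ha.orth, Matrix.transpose_mul, rot, Matrix.mul_assoc]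
  abel

/-- The rotation of the estimated loadings has a bounded inverse. -/
lemma rot_inv : (∀ᶠ a in l, IsUnit (rot F G a).det) ∧
    NormBigO l (fun a => (rot F G a)⁻¹) fun _ => 1 := by
  obtain ⟨hu, hb⟩ := inv_bdd_of_tendsto_one h.rotF_transpose_mul_rot
  have hu' : ∀ᶠ a in l, IsUnit (rot F G a).det := by
    filter_upwards [hu] with a ha
    rw [Matrix.det_mul] at ha
    exact isUnit_of_mul_isUnit_right ha
  refine ⟨hu', (hb.bdd_mul h.bddRotF.transpose).congr ?_⟩
  filter_upwards [hu, hu'] with a ha ha'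
  refine (Matrix.inv_eq_left_inv ?_).symm
  rw [Matrix.mul_assoc, Matrix.nonsing_inv_mul _ ha]

/-- The rotation of the estimated factors has a bounded inverse. -/
lemma rotF_inv : (∀ᶠ a in l, IsUnit (rotF F G Λ E a).det) ∧
    NormBigO l (fun a => (rotF F G Λ E a)⁻¹) fun _ => 1 := by
  obtain ⟨hu, hb⟩ := inv_bdd_of_tendsto_one h.rotF_transpose_mul_rot
  have hu' : ∀ᶠ a in l, IsUnit (rotF F G Λ E a).det := by
    filter_upwards [hu] with a ha
    rw [Matrix.det_mul, Matrix.det_transpose] at ha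
    exact isUnit_of_mul_isUnit_left ha
  refine ⟨hu', (h.bddRot.bdd_mul hb).transpose.congr ?_⟩
  filter_upwards [hu, hu'] with a ha ha'
  refine (Matrix.inv_eq_left_inv ?_).symm
  rw [← Matrix.transpose_transpose (rotF F G Λ E a), ← Matrix.transpose_mul, ← Matrix.mul_assoc,
    Matrix.transpose_transpose, Matrix.mul_nonsing_inv _ ha, Matrix.transpose_one]

/-- The error `Eᵀ G` of the estimated loadings is of the order `ρ`. -/
lemma noise_mul_pc : NormBigO l (fun a => (E a)ᵀ * G a) ρ := by
  refine ((h.factorNoise.mul_bdd h.bddRotF).add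
    (h.noise.transpose.bdd_mul h.factor_consistency)).congr (Eventually.of_forall fun a => ?_)
  rw [Matrix.mul_sub, Matrix.mul_assoc]
  abel

/-- The same for the errors of a single unit, or of a weighted sum of units. -/
lemma pc_mul_noise {ε : ∀ a, Matrix (Fin (L a)) Unit ℝ} (hε : NormBigO l ε fun _ => 1)
    (hFε : NormBigO l (fun a => (F a)ᵀ * ε a) ρ) : NormBigO l (fun a => (G a)ᵀ * ε a) ρ := by
  refine ((h.bddRotF.transpose.bdd_mul hFε).add
    (h.factor_consistency.transpose.mul_bdd hε)).congr (Eventually.of_forall fun a => ?_)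
  rw [Matrix.transpose_sub, Matrix.sub_mul, Matrix.transpose_mul, Matrix.mul_assoc]
  abel

/-- The factors are almost in the span of the estimated factors. -/
lemma factor_residual : NormBigO l (fun a => F a - G a * ((G a)ᵀ * F a)) ρ := by
  have h1 := h.factor_consistency.neg.mul_bdd h.rotF_inv.2
  have h2 := h.bddG.bdd_mul (h.bddG.transpose.bdd_mul h1)
  refine (h1.sub h2).congr ?_
  filter_upwards [h.pc, h.rotF_inv.1] with a ha hu
  have e : -(G a - F a * rotF F G Λ E a) * (rotF F G Λ E a)⁻¹
      = F a - G a * (rotF F G Λ E a)⁻¹ := by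
    rw [neg_sub, Matrix.sub_mul, Matrix.mul_assoc, Matrix.mul_nonsing_inv _ hu, Matrix.mul_one]
  rw [e, Matrix.mul_sub, ← Matrix.mul_assoc (G a)ᵀ, ha.orth, Matrix.one_mul, Matrix.mul_sub]
  abel

end IsFactorRegime

end Regime

/-! ### The estimated shift -/

section Shift

/-- `(A₁ᵀ A₁)⁻¹ A₁ᵀ A₂`: the coefficients of the regression of the estimated loadings `A₂` on
`A₁`. -/
noncomputable def regCoef {r : ℕ} {n : Type*} [Fintype n] (A₁ A₂ : Matrix n (Fin r) ℝ) :
    Matrix (Fin r) (Fin r) ℝ :=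
  (A₁ᵀ * A₁)⁻¹ * (A₁ᵀ * A₂)

variable {α : Type*} {l : Filter α} {r : ℕ} {L₁ L₂ N : α → ℕ} {ρ : α → ℝ}
  {F₁ G₁ : ∀ a, Matrix (Fin (L₁ a)) (Fin r) ℝ} {Λ₁ Λ₂ : ∀ a, Matrix (Fin (N a)) (Fin r) ℝ}
  {E₁ : ∀ a, Matrix (Fin (L₁ a)) (Fin (N a)) ℝ}
  {F₂ G₂ : ∀ a, Matrix (Fin (L₂ a)) (Fin r) ℝ}
  {E₂ : ∀ a, Matrix (Fin (L₂ a)) (Fin (N a)) ℝ} {SF₁ SL₁ SF₂ SL₂ : Matrix (Fin r) (Fin r) ℝ}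

/-- The regression of the estimated loadings on each other estimates `Z`, rotated. The hypothesis
states that the first loadings are asymptotically orthogonal to the shift. -/
lemma regCoef_sub (h₁ : IsFactorRegime l ρ F₁ Λ₁ E₁ G₁ SF₁ SL₁)
    (h₂ : IsFactorRegime l ρ F₂ Λ₂ E₂ G₂ SF₂ SL₂) (Z : Matrix (Fin r) (Fin r) ℝ)
    (hW : NormBigO l (fun a => (Λ₁ a)ᵀ * (Λ₂ a - Λ₁ a * Z)) ρ) :
    NormBigO l (fun a => regCoef ((regData F₁ Λ₁ E₁ a)ᵀ * G₁ a) ((regData F₂ Λ₂ E₂ a)ᵀ * G₂ a) -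
      (rot F₁ G₁ a)⁻¹ * (Z * rot F₂ G₂ a)) ρ := by
  have hWb : NormBigO l (fun a => Λ₂ a - Λ₁ a * Z) fun _ => 1 :=
    h₂.bddL.sub (h₁.bddL.bdd_mul (normBigO_const Z))
  have hA : NormBigO l (fun a => (regData F₁ Λ₁ E₁ a)ᵀ * G₁ a) fun _ => 1 :=
    h₁.bddX.transpose.bdd_mul h₁.bddG
  have hQ := h₁.rot_inv.2.bdd_mul ((normBigO_const Z).bdd_mul h₂.bddRot)
  -- the estimated loadings of the first regime are nearly orthogonal to the shift
  have hAW : NormBigO l (fun a => ((regData F₁ Λ₁ E₁ a)ᵀ * G₁ a)ᵀ *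
      ((Λ₂ a - Λ₁ a * Z) * rot F₂ G₂ a)) ρ := by
    have e1 := (h₁.bddRot.transpose.bdd_mul hW).mul_bdd h₂.bddRot
    have e2 := h₁.noise_mul_pc.transpose.mul_bdd (hWb.bdd_mul h₂.bddRot)
    refine (e1.add e2).congr (Eventually.of_forall fun a => ?_)
    rw [regData_transpose_mul, Matrix.transpose_add, Matrix.transpose_mul (Λ₁ a), Matrix.add_mul]
    simp only [Matrix.mul_assoc]
  -- the estimation errors of the loadings contribute `O(ρ)`
  have hAU : NormBigO l (fun a => ((regData F₁ Λ₁ E₁ a)ᵀ * G₁ a)ᵀ *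
      ((E₂ a)ᵀ * G₂ a - ((E₁ a)ᵀ * G₁ a) * ((rot F₁ G₁ a)⁻¹ * (Z * rot F₂ G₂ a)))) ρ :=
    hA.transpose.bdd_mul (h₂.noise_mul_pc.sub (h₁.noise_mul_pc.mul_bdd hQ))
  refine (h₁.pcGram_inv.2.bdd_mul (hAW.add hAU)).congr ?_
  filter_upwards [h₁.pcGram_inv.1, h₁.rot_inv.1] with a hu hr
  set A₁ := (regData F₁ Λ₁ E₁ a)ᵀ * G₁ a with hA₁
  set Q := (rot F₁ G₁ a)⁻¹ * (Z * rot F₂ G₂ a) with hQdef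
  have hV : pcGram (regData F₁ Λ₁ E₁ a) (G₁ a) = A₁ᵀ * A₁ := by
    rw [pcGram, hA₁, Matrix.transpose_mul, Matrix.transpose_transpose]
    simp only [Matrix.mul_assoc]
  have hΛQ : Λ₁ a * (rot F₁ G₁ a * Q) = Λ₁ a * Z * rot F₂ G₂ a := by
    rw [hQdef, ← Matrix.mul_assoc (rot F₁ G₁ a), Matrix.mul_nonsing_inv _ hr, Matrix.one_mul,
      Matrix.mul_assoc]
  have hA₂ : (Λ₂ a - Λ₁ a * Z) * rot F₂ G₂ a + ((E₂ a)ᵀ * G₂ a - (E₁ a)ᵀ * G₁ a * Q)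
      = (regData F₂ Λ₂ E₂ a)ᵀ * G₂ a - A₁ * Q := by
    rw [regData_transpose_mul, hA₁, regData_transpose_mul, Matrix.add_mul, Matrix.sub_mul,
      Matrix.mul_assoc (Λ₁ a) (rot F₁ G₁ a), hΛQ]
    abel
  rw [hV] at hu ⊢
  rw [← Matrix.mul_add, hA₂, Matrix.mul_sub, Matrix.mul_sub, regCoef, ← Matrix.mul_assoc A₁ᵀ A₁,
    ← Matrix.mul_assoc (A₁ᵀ * A₁)⁻¹ (A₁ᵀ * A₁), Matrix.nonsing_inv_mul _ hu, Matrix.one_mul]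

lemma bdd_regCoef (h₁ : IsFactorRegime l ρ F₁ Λ₁ E₁ G₁ SF₁ SL₁)
    (h₂ : IsFactorRegime l ρ F₂ Λ₂ E₂ G₂ SF₂ SL₂) (Z : Matrix (Fin r) (Fin r) ℝ)
    (hW : NormBigO l (fun a => (Λ₁ a)ᵀ * (Λ₂ a - Λ₁ a * Z)) ρ) :
    NormBigO l (fun a => regCoef ((regData F₁ Λ₁ E₁ a)ᵀ * G₁ a) ((regData F₂ Λ₂ E₂ a)ᵀ * G₂ a))
      fun _ => 1 := by
  have := ((regCoef_sub h₁ h₂ Z hW).bdd h₁.rate).add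
    (h₁.rot_inv.2.bdd_mul ((normBigO_const Z).bdd_mul h₂.bddRot))
  simpa only [sub_add_cancel] using this

/-- For a weighted sum of units, with loadings `β₁`, `β₂` and errors `ε₁`, `ε₂`, the estimated
shift is the rotated shift `β₂ - Zᵀ β₁` up to an error of the order `ρ`. -/
lemma shift_consistency (h₁ : IsFactorRegime l ρ F₁ Λ₁ E₁ G₁ SF₁ SL₁)
    (h₂ : IsFactorRegime l ρ F₂ Λ₂ E₂ G₂ SF₂ SL₂) (Z : Matrix (Fin r) (Fin r) ℝ)
    (hW : NormBigO l (fun a => (Λ₁ a)ᵀ * (Λ₂ a - Λ₁ a * Z)) ρ)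
    {β₁ β₂ : α → Matrix (Fin r) Unit ℝ} {ε₁ : ∀ a, Matrix (Fin (L₁ a)) Unit ℝ}
    {ε₂ : ∀ a, Matrix (Fin (L₂ a)) Unit ℝ} (hβ : NormBigO l β₁ fun _ => 1)
    (hε₁ : NormBigO l ε₁ fun _ => 1) (hε₂ : NormBigO l ε₂ fun _ => 1)
    (hF₁ : NormBigO l (fun a => (F₁ a)ᵀ * ε₁ a) ρ)
    (hF₂ : NormBigO l (fun a => (F₂ a)ᵀ * ε₂ a) ρ) :
    NormBigO l (fun a => (G₂ a)ᵀ * (F₂ a * β₂ a + ε₂ a) -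
      (regCoef ((regData F₁ Λ₁ E₁ a)ᵀ * G₁ a) ((regData F₂ Λ₂ E₂ a)ᵀ * G₂ a))ᵀ *
        ((G₁ a)ᵀ * (F₁ a * β₁ a + ε₁ a)) - (rot F₂ G₂ a)ᵀ * (β₂ a - Zᵀ * β₁ a)) ρ := by
  have e1 := (h₁.bddRot.bdd_mul (regCoef_sub h₁ h₂ Z hW)).transpose.mul_bdd hβ
  have e2 := h₂.pc_mul_noise hε₂ hF₂
  have e3 := (bdd_regCoef h₁ h₂ Z hW).transpose.bdd_mul (h₁.pc_mul_noise hε₁ hF₁)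
  refine ((e2.sub e3).sub e1).congr ?_
  filter_upwards [h₁.rot_inv.1] with a hr
  have e4 : rot F₁ G₁ a * (regCoef ((regData F₁ Λ₁ E₁ a)ᵀ * G₁ a)
      ((regData F₂ Λ₂ E₂ a)ᵀ * G₂ a) - (rot F₁ G₁ a)⁻¹ * (Z * rot F₂ G₂ a))
      = rot F₁ G₁ a * regCoef ((regData F₁ Λ₁ E₁ a)ᵀ * G₁ a)
      ((regData F₂ Λ₂ E₂ a)ᵀ * G₂ a) - Z * rot F₂ G₂ a := by
    rw [Matrix.mul_sub, ← Matrix.mul_assoc (rot F₁ G₁ a) (rot F₁ G₁ a)⁻¹,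
      Matrix.mul_nonsing_inv _ hr, Matrix.one_mul]
  rw [e4]
  simp only [rot, Matrix.transpose_sub, Matrix.transpose_mul, Matrix.transpose_transpose,
    Matrix.mul_add, Matrix.mul_sub, Matrix.sub_mul, Matrix.mul_assoc]
  abel

/-- The shift is bounded by a multiple of the estimated shift, up to an error of the order `ρ`. -/
lemma shift_lower_bound (h₁ : IsFactorRegime l ρ F₁ Λ₁ E₁ G₁ SF₁ SL₁)
    (h₂ : IsFactorRegime l ρ F₂ Λ₂ E₂ G₂ SF₂ SL₂) (Z : Matrix (Fin r) (Fin r) ℝ)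
    (hW : NormBigO l (fun a => (Λ₁ a)ᵀ * (Λ₂ a - Λ₁ a * Z)) ρ)
    {β₁ β₂ : α → Matrix (Fin r) Unit ℝ} {ε₁ : ∀ a, Matrix (Fin (L₁ a)) Unit ℝ}
    {ε₂ : ∀ a, Matrix (Fin (L₂ a)) Unit ℝ} (hβ : NormBigO l β₁ fun _ => 1)
    (hε₁ : NormBigO l ε₁ fun _ => 1) (hε₂ : NormBigO l ε₂ fun _ => 1)
    (hF₁ : NormBigO l (fun a => (F₁ a)ᵀ * ε₁ a) ρ)
    (hF₂ : NormBigO l (fun a => (F₂ a)ᵀ * ε₂ a) ρ) :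
    ∃ K : ℝ, 0 < K ∧ ∀ᶠ a in l, ‖β₂ a - Zᵀ * β₁ a‖ ≤ K * (‖(G₂ a)ᵀ * (F₂ a * β₂ a + ε₂ a) -
      (regCoef ((regData F₁ Λ₁ E₁ a)ᵀ * G₁ a) ((regData F₂ Λ₂ E₂ a)ᵀ * G₂ a))ᵀ *
        ((G₁ a)ᵀ * (F₁ a * β₁ a + ε₁ a))‖ + K * |ρ a|) := by
  obtain ⟨K₁, hK₁, hb₁⟩ := h₂.rot_inv.2.exists_bound
  obtain ⟨K₂, hK₂, hb₂⟩ := IsBigO.exists_pos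
    (shift_consistency h₁ h₂ Z hW (β₂ := β₂) hβ hε₁ hε₂ hF₁ hF₂)
  refine ⟨K₁ + K₂, by positivity, ?_⟩
  filter_upwards [hb₁, hb₂.bound, h₂.rot_inv.1] with a e1 e2 hu
  rw [norm_norm, Real.norm_eq_abs] at e2
  set w := β₂ a - Zᵀ * β₁ a with hw
  set D := (G₂ a)ᵀ * (F₂ a * β₂ a + ε₂ a) -
      (regCoef ((regData F₁ Λ₁ E₁ a)ᵀ * G₁ a) ((regData F₂ Λ₂ E₂ a)ᵀ * G₂ a))ᵀ *
        ((G₁ a)ᵀ * (F₁ a * β₁ a + ε₁ a)) with hD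
  have hinv : ((rot F₂ G₂ a)⁻¹)ᵀ * ((rot F₂ G₂ a)ᵀ * w) = w := by
    rw [← Matrix.mul_assoc, ← Matrix.transpose_mul, Matrix.mul_nonsing_inv _ hu,
      Matrix.transpose_one, Matrix.one_mul]
  have h3 : ‖(rot F₂ G₂ a)ᵀ * w‖ ≤ ‖D‖ + K₂ * |ρ a| := by
    have := norm_sub_le D (D - (rot F₂ G₂ a)ᵀ * w)
    rw [sub_sub_cancel] at this
    linarith
  calc ‖w‖ = ‖((rot F₂ G₂ a)⁻¹)ᵀ * ((rot F₂ G₂ a)ᵀ * w)‖ := by rw [hinv]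
    _ ≤ ‖((rot F₂ G₂ a)⁻¹)ᵀ‖ * ‖(rot F₂ G₂ a)ᵀ * w‖ := Matrix.frobenius_norm_mul _ _
    _ ≤ K₁ * (‖D‖ + K₂ * |ρ a|) := by
        rw [Matrix.frobenius_norm_transpose]; gcongr
    _ ≤ _ := by
        have := abs_nonneg (ρ a)
        gcongr <;> linarith

end Shift

/-! ### The Bartlett HAC estimator -/

section HAC

variable {r L : ℕ}

lemma autocov_quadratic (g : Fin L → Fin r → ℝ) (v : ℕ) (x : Fin r → ℝ) :
    x ⬝ᵥ (autocov g v *ᵥ x) = (1 / (L : ℝ)) * ∑ t : Fin L, ∑ s : Fin L,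
      if (t : ℕ) = s + v then (x ⬝ᵥ g t) * (x ⬝ᵥ g s) else 0 := by
  rw [autocov, Matrix.smul_mulVec, dotProduct_smul, smul_eq_mul, Matrix.sum_mulVec,
    dotProduct_sum]
  congr 1
  refine Finset.sum_congr rfl fun t _ => ?_
  rw [Matrix.sum_mulVec, dotProduct_sum]
  refine Finset.sum_congr rfl fun s _ => ?_
  split_ifs
  · rw [Matrix.vecMulVec_mulVec, dotProduct_smul, dotProduct_comm (g s) x]
    simp
  · simp

/-- A pair of times `t`, `s` occurs in the HAC estimator at the single lag `|t - s|`. -/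
lemma sum_bartlett_lag (b : ℝ) (t s : Fin L) (c : ℝ) :
    (if (t : ℕ) = s + 0 then c else 0) + ∑ v ∈ Finset.Ico 1 L, bartlett (v / b) *
      ((if (t : ℕ) = s + v then c else 0) + (if (s : ℕ) = t + v then c else 0))
      = bartlett (((t : ℝ) - s) / b) * c := by
  have hs := s.2
  have ht := t.2
  rcases lt_trichotomy (t : ℕ) s with h | h | h
  · rw [if_neg (by omega), Finset.sum_eq_single ((s : ℕ) - t)]
    · rw [if_neg (by omega), if_pos (by omega), Nat.cast_sub h.le, bartlett, bartlett,
        ← abs_neg, ← neg_div, neg_sub]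
      ring
    · intro v _ hv
      rw [if_neg (by omega), if_neg (by omega)]; simp
    · intro hv
      simp only [Finset.mem_Ico] at hv
      omega
  · rw [if_pos (by omega), Finset.sum_eq_zero]
    · simp [h, bartlett]
    · intro v hv
      simp only [Finset.mem_Ico] at hv
      rw [if_neg (by omega), if_neg (by omega)]; simp
  · rw [if_neg (by omega), Finset.sum_eq_single ((t : ℕ) - s)]
    · rw [if_pos (by omega), if_neg (by omega), Nat.cast_sub h.le]
      ring
    · intro v _ hv
      rw [if_neg (by omega), if_neg (by omega)]; simp
    · intro hv
      simp only [Finset.mem_Ico] at hv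
      omega

/-- The HAC estimator as a quadratic form of the whole series, with weights `k((t - s) / b)`. -/
lemma hac_quadratic (b : ℝ) (g : Fin L → Fin r → ℝ) (x : Fin r → ℝ) :
    x ⬝ᵥ (hac b g *ᵥ x) = (1 / (L : ℝ)) * ∑ t : Fin L, ∑ s : Fin L,
      bartlett (((t : ℝ) - s) / b) * ((x ⬝ᵥ g t) * (x ⬝ᵥ g s)) := by
  have htr : ∀ v, x ⬝ᵥ ((autocov g v)ᵀ *ᵥ x) = x ⬝ᵥ (autocov g v *ᵥ x) := fun v => by
    rw [Matrix.mulVec_transpose, dotProduct_comm, ← Matrix.dotProduct_mulVec]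
  have hsw : ∀ v, x ⬝ᵥ (autocov g v *ᵥ x) = (1 / (L : ℝ)) * ∑ t : Fin L, ∑ s : Fin L,
      if (s : ℕ) = t + v then (x ⬝ᵥ g t) * (x ⬝ᵥ g s) else 0 := fun v => by
    rw [autocov_quadratic, Finset.sum_comm]
    simp only [mul_comm]
  rw [hac, Matrix.add_mulVec, dotProduct_add, Matrix.sum_mulVec, dotProduct_sum]
  simp only [Matrix.smul_mulVec, dotProduct_smul, Matrix.add_mulVec, dotProduct_add, htr,
    smul_eq_mul]
  have h1 : ∀ v : ℕ, bartlett (v / b) * (x ⬝ᵥ (autocov g v *ᵥ x) + x ⬝ᵥ (autocov g v *ᵥ x))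
      = (1 / (L : ℝ)) * ∑ t : Fin L, ∑ s : Fin L, bartlett (v / b) *
        ((if (t : ℕ) = s + v then (x ⬝ᵥ g t) * (x ⬝ᵥ g s) else 0)
          + (if (s : ℕ) = t + v then (x ⬝ᵥ g t) * (x ⬝ᵥ g s) else 0)) := fun v => by
    conv_lhs => rw [hsw v]
    nth_rewrite 1 [← hsw v]
    rw [autocov_quadratic]
    simp only [← Finset.mul_sum, Finset.sum_add_distrib]
    ring
  simp only [h1]
  rw [← Finset.mul_sum, autocov_quadratic, ← mul_add]
  congr 1
  rw [Finset.sum_comm (s := Finset.Ico 1 L), ← Finset.sum_add_distrib]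
  refine Finset.sum_congr rfl fun t _ => ?_
  rw [Finset.sum_comm (s := Finset.Ico 1 L), ← Finset.sum_add_distrib]
  exact Finset.sum_congr rfl fun s _ => sum_bartlett_lag b t s _

/-- The indicator function of `[t, t + b)`. -/
noncomputable def window (b t u : ℝ) : ℝ := (Set.Ico t (t + b)).indicator 1 u

/-- The Bartlett kernel is the normalized overlap of two windows of length `b`. -/
lemma bartlett_eq_integral {b : ℝ} (hb : 0 < b) (t s : ℝ) :
    bartlett ((t - s) / b) = b⁻¹ * ∫ u, window b t u * window b s u := by
  have h1 : ∀ u, window b t u * window b s u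
      = (Set.Ico (max t s) (min (t + b) (s + b))).indicator 1 u := fun u => by
    rw [← Set.Ico_inter_Ico, Set.inter_indicator_one]; rfl
  simp only [h1]
  rw [integral_indicator_one measurableSet_Ico, measureReal_def, Real.volume_Ico, bartlett,
    min_add_add_right, ENNReal.toReal_ofReal']
  have h2 : min t s + b - max t s = b - |t - s| := by
    rw [← max_sub_min_eq_abs' t s]; ring
  rw [h2, mul_max_of_nonneg _ _ (inv_nonneg.2 hb.le), mul_zero, mul_sub,
    inv_mul_cancel₀ hb.ne', abs_div, abs_of_pos hb]
  ring_nf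

lemma integrable_window_mul (b t s : ℝ) : Integrable fun u => window b t u * window b s u := by
  have h1 : (fun u => window b t u * window b s u)
      = (Set.Ico (max t s) (min (t + b) (s + b))).indicator 1 := funext fun u => by
    rw [← Set.Ico_inter_Ico, Set.inter_indicator_one]; rfl
  rw [h1]
  exact (integrable_indicator_iff measurableSet_Ico).2 (by simp [Pi.one_def])

/-- The quadratic form of the Bartlett kernel is the integral of a square. -/
lemma bartlett_form_eq_integral {b : ℝ} (hb : 0 < b) (h : Fin L → ℝ) :
    ∑ t : Fin L, ∑ s : Fin L, bartlett (((t : ℝ) - s) / b) * (h t * h s)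
      = b⁻¹ * ∫ u, (∑ t : Fin L, h t * window b t u) ^ 2 := by
  have h1 : ∀ u, (∑ t : Fin L, h t * window b t u) ^ 2
      = ∑ t : Fin L, ∑ s : Fin L, (h t * h s) * (window b t u * window b s u) := fun u => by
    rw [sq, Finset.sum_mul_sum]
    refine Finset.sum_congr rfl fun t _ => Finset.sum_congr rfl fun s _ => by ring
  simp only [h1]
  rw [integral_finsetSum Finset.univ (f := fun (t : Fin L) u => ∑ s : Fin L,
    (h t * h s) * (window b t u * window b s u)) fun t _ => integrable_finsetSum _ fun s _ =>
    (integrable_window_mul b t s).const_mul _, Finset.mul_sum]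
  refine Finset.sum_congr rfl fun t _ => ?_
  rw [integral_finsetSum Finset.univ (f := fun (s : Fin L) u =>
    (h t * h s) * (window b t u * window b s u)) fun s _ =>
      (integrable_window_mul b t s).const_mul _, Finset.mul_sum]
  refine Finset.sum_congr rfl fun s _ => ?_
  rw [integral_const_mul, bartlett_eq_integral hb]
  ring

lemma bartlett_form_nonneg {b : ℝ} (hb : 0 < b) (h : Fin L → ℝ) :
    0 ≤ ∑ t : Fin L, ∑ s : Fin L, bartlett (((t : ℝ) - s) / b) * (h t * h s) := by
  rw [bartlett_form_eq_integral hb]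
  have : 0 ≤ ∫ u, (∑ t : Fin L, h t * window b t u) ^ 2 := integral_nonneg fun u => sq_nonneg _
  positivity

lemma bartlett_form_pos {b : ℝ} (hb : 0 < b) {h : Fin L → ℝ} (hh : h ≠ 0) :
    0 < ∑ t : Fin L, ∑ s : Fin L, bartlett (((t : ℝ) - s) / b) * (h t * h s) := by
  rw [bartlett_form_eq_integral hb]
  have hint : Integrable fun u => (∑ t : Fin L, h t * window b t u) ^ 2 := by
    have h1 : ∀ u, (∑ t : Fin L, h t * window b t u) ^ 2
        = ∑ t : Fin L, ∑ s : Fin L, (h t * h s) * (window b t u * window b s u) := fun u => by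
      rw [sq, Finset.sum_mul_sum]
      refine Finset.sum_congr rfl fun t _ => Finset.sum_congr rfl fun s _ => by ring
    simp only [h1]
    exact integrable_finsetSum _ fun t _ => integrable_finsetSum _ fun s _ =>
      (integrable_window_mul b t s).const_mul _
  -- before the second point with `h ≠ 0`, only the window of the first one contributes
  have hne : (Finset.univ.filter fun t => h t ≠ 0).Nonempty := by
    obtain ⟨t, ht⟩ := Function.ne_iff.1 hh
    exact ⟨t, by simpa using ht⟩
  set t₀ := (Finset.univ.filter fun t => h t ≠ 0).min' hne with ht₀
  have hmem := Finset.min'_mem _ hne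
  rw [← ht₀] at hmem
  have h0 : h t₀ ≠ 0 := by simpa using hmem
  have hmin : ∀ t, h t ≠ 0 → t₀ ≤ t := fun t ht => Finset.min'_le _ _ (by simpa using ht)
  have hval : ∀ u ∈ Set.Ico (t₀ : ℝ) (t₀ + min 1 b),
      (∑ t : Fin L, h t * window b t u) ^ 2 = h t₀ ^ 2 := by
    intro u hu
    rw [Finset.sum_eq_single t₀]
    · have : u ∈ Set.Ico (t₀ : ℝ) (t₀ + b) :=
        ⟨hu.1, hu.2.trans_le (by linarith [min_le_right 1 b])⟩
      simp [window, this.1, this.2]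
    · intro t _ htne
      by_cases hz : h t = 0
      · rw [hz, zero_mul]
      · have hlt : (t₀ : ℕ) < t := lt_of_le_of_ne (hmin t hz) fun e => htne (Fin.ext e.symm)
        have : (t₀ : ℝ) + 1 ≤ t := by exact_mod_cast hlt
        have hu' : u < t := hu.2.trans_le (by linarith [min_le_left 1 b])
        simp [window, not_le.2 hu']
    · simp
  have hlow : h t₀ ^ 2 * min 1 b ≤ ∫ u, (∑ t : Fin L, h t * window b t u) ^ 2 := by
    calc h t₀ ^ 2 * min 1 b
        = ∫ u in Set.Ico (t₀ : ℝ) (t₀ + min 1 b), (∑ t : Fin L, h t * window b t u) ^ 2 := by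
          rw [setIntegral_congr_fun measurableSet_Ico hval]
          have hm : 0 ≤ min 1 b := by positivity
          simp [measureReal_def, -ENNReal.ofReal_min, ENNReal.toReal_ofReal hm, mul_comm]
      _ ≤ _ := setIntegral_le_integral hint (Eventually.of_forall fun u => sq_nonneg _)
  have : 0 < h t₀ ^ 2 * min 1 b := by positivity
  have := this.trans_le hlow
  positivity

lemma hac_isHermitian (b : ℝ) (g : Fin L → Fin r → ℝ) : (hac b g).IsHermitian := by
  have h0 : (autocov g 0)ᵀ = autocov g 0 := by
    rw [autocov, Matrix.transpose_smul, Matrix.transpose_sum]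
    congr 1
    refine Finset.sum_congr rfl fun t _ => ?_
    rw [Matrix.transpose_sum]
    refine Finset.sum_congr rfl fun s _ => ?_
    split_ifs with h
    · rw [show t = s from Fin.ext (by simpa using h), Matrix.transpose_vecMulVec]
    · simp
  rw [Matrix.IsHermitian, Matrix.conjTranspose_eq_transpose_of_trivial, hac,
    Matrix.transpose_add, h0, Matrix.transpose_sum]
  congr 1
  refine Finset.sum_congr rfl fun v _ => ?_
  rw [Matrix.transpose_smul, Matrix.transpose_add, Matrix.transpose_transpose, add_comm]

lemma hac_posSemidef {b : ℝ} (hb : 0 < b) (g : Fin L → Fin r → ℝ) : (hac b g).PosSemidef := by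
  refine Matrix.posSemidef_iff_dotProduct_mulVec.2 ⟨hac_isHermitian b g, fun x => ?_⟩
  rw [star_trivial, hac_quadratic]
  exact mul_nonneg (by positivity) (bartlett_form_nonneg hb _)

/-- The Bartlett HAC estimator of a series is nonsingular as soon as the series spans. -/
lemma hac_posDef {b : ℝ} (hb : 0 < b) (g : Fin L → Fin r → ℝ)
    (hg : ∀ x : Fin r → ℝ, (∀ t, x ⬝ᵥ g t = 0) → x = 0) : (hac b g).PosDef := by
  refine Matrix.posDef_iff_dotProduct_mulVec.2 ⟨hac_isHermitian b g, fun x hx => ?_⟩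
  rw [star_trivial, hac_quadratic]
  have hne : (fun t => x ⬝ᵥ g t) ≠ 0 := fun h => hx (hg x fun t => congrFun h t)
  obtain ⟨t, -⟩ := Function.ne_iff.1 hne
  have hL : (0 : ℝ) < L := by exact_mod_cast (Nat.zero_le _).trans_lt t.2
  exact mul_pos (by positivity) (bartlett_form_pos hb hne)

/-- By `2 |gₜᵀ gₛ| ≤ |gₜ|² + |gₛ|²`, no autocovariance has a larger trace than the second moment. -/
lemma trace_autocov_le (g : Fin L → Fin r → ℝ) (v : ℕ) :
    (autocov g v).trace ≤ (1 / (L : ℝ)) * ∑ t, g t ⬝ᵥ g t := by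
  rw [autocov, Matrix.trace_smul, smul_eq_mul]
  refine mul_le_mul_of_nonneg_left ?_ (by positivity)
  rw [Matrix.trace_sum]
  have h1 : ∀ t s : Fin L,
      Matrix.trace (if (t : ℕ) = s + v then Matrix.vecMulVec (g t) (g s) else 0)
      ≤ (if (t : ℕ) = s + v then (g t ⬝ᵥ g t) / 2 else 0)
        + (if (t : ℕ) = s + v then (g s ⬝ᵥ g s) / 2 else 0) := fun t s => by
    split_ifs
    · rw [Matrix.trace_vecMulVec]
      simp only [dotProduct, Finset.sum_div, ← Finset.sum_add_distrib]
      exact Finset.sum_le_sum fun j _ => by nlinarith [sq_nonneg (g t j - g s j)]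
    · simp
  have hnn : ∀ t, 0 ≤ (g t ⬝ᵥ g t) / 2 := fun t =>
    div_nonneg (Finset.sum_nonneg fun j _ => mul_self_nonneg _) (by norm_num)
  calc ∑ t : Fin L,
        (∑ s : Fin L, if (t : ℕ) = s + v then Matrix.vecMulVec (g t) (g s) else 0).trace
      ≤ ∑ t : Fin L, ∑ s : Fin L, ((if (t : ℕ) = s + v then (g t ⬝ᵥ g t) / 2 else 0)
        + (if (t : ℕ) = s + v then (g s ⬝ᵥ g s) / 2 else 0)) := by
        refine Finset.sum_le_sum fun t _ => ?_
        rw [Matrix.trace_sum]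
        exact Finset.sum_le_sum fun s _ => h1 t s
    _ ≤ ∑ t, (g t ⬝ᵥ g t) / 2 + ∑ t, (g t ⬝ᵥ g t) / 2 := by
        simp only [Finset.sum_add_distrib]
        gcongr ?_ + ?_
        · refine Finset.sum_le_sum fun t _ => ?_
          rw [← Finset.sum_filter, Finset.sum_const]
          have hc : (Finset.univ.filter fun s : Fin L => (t : ℕ) = s + v).card ≤ 1 :=
            Finset.card_le_one.2 fun a ha b hb => by
              simp only [Finset.mem_filter] at ha hb
              exact Fin.ext (by omega)
          calc _ ≤ 1 • ((g t ⬝ᵥ g t) / 2) := nsmul_le_nsmul_left (hnn t) hc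
            _ = _ := one_smul _ _
        · rw [Finset.sum_comm]
          refine Finset.sum_le_sum fun t _ => ?_
          rw [← Finset.sum_filter, Finset.sum_const]
          have hc : (Finset.univ.filter fun s : Fin L => (s : ℕ) = t + v).card ≤ 1 :=
            Finset.card_le_one.2 fun a ha b hb => by
              simp only [Finset.mem_filter] at ha hb
              exact Fin.ext (by omega)
          calc _ ≤ 1 • ((g t ⬝ᵥ g t) / 2) := nsmul_le_nsmul_left (hnn t) hc
            _ = _ := one_smul _ _
    _ = _ := by rw [← Finset.sum_add_distrib]; simp only [add_halves]

lemma sum_bartlett_le {b : ℝ} (hb : 0 < b) : ∑ v ∈ Finset.Ico 1 L, bartlett (v / b) ≤ b := by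
  have h1 : ∀ v ∈ Finset.Ico 1 L, bartlett ((v : ℕ) / b)
      ≤ if v ∈ Finset.Icc 1 ⌊b⌋₊ then 1 else 0 := fun v hv => by
    have h0 : 0 ≤ |(v : ℝ) / b| := abs_nonneg _
    rw [Finset.mem_Ico] at hv
    split_ifs with h
    · exact max_le (by linarith) zero_le_one
    · have : b < v := by
        by_contra hc
        exact h (Finset.mem_Icc.2 ⟨hv.1, Nat.le_floor (not_lt.1 hc)⟩)
      have h2 : 1 ≤ |(v : ℝ) / b| := by
        rw [abs_of_nonneg (by positivity), le_div_iff₀ hb]; linarith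
      exact max_le (by linarith) le_rfl
  calc ∑ v ∈ Finset.Ico 1 L, bartlett (v / b)
      ≤ ∑ v ∈ Finset.Ico 1 L, (if v ∈ Finset.Icc 1 ⌊b⌋₊ then (1 : ℝ) else 0) :=
        Finset.sum_le_sum h1
    _ = ((Finset.Ico 1 L).filter (· ∈ Finset.Icc 1 ⌊b⌋₊)).card := by
        rw [← Finset.sum_filter]; simp
    _ ≤ ((Finset.Icc 1 ⌊b⌋₊).card : ℝ) := by
        gcongr
        exact fun v hv => (Finset.mem_filter.1 hv).2
    _ = ⌊b⌋₊ := by simp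
    _ ≤ b := Nat.floor_le hb.le

/-- The weights of the HAC estimator sum up to at most `1 + 2 b`. -/
lemma trace_hac_le {b : ℝ} (hb : 0 < b) (g : Fin L → Fin r → ℝ) :
    (hac b g).trace ≤ (1 + 2 * b) * ((1 / (L : ℝ)) * ∑ t, g t ⬝ᵥ g t) := by
  set D := (1 / (L : ℝ)) * ∑ t, g t ⬝ᵥ g t with hD
  have hD0 : 0 ≤ D := mul_nonneg (by positivity)
    (Finset.sum_nonneg fun t _ => Finset.sum_nonneg fun j _ => mul_self_nonneg _)
  rw [hac, Matrix.trace_add, Matrix.trace_sum]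
  have h1 : ∑ v ∈ Finset.Ico 1 L, (bartlett (v / b) • (autocov g v + (autocov g v)ᵀ)).trace
      ≤ ∑ v ∈ Finset.Ico 1 L, bartlett (v / b) * (2 * D) := by
    refine Finset.sum_le_sum fun v _ => ?_
    rw [Matrix.trace_smul, Matrix.trace_add, Matrix.trace_transpose, smul_eq_mul]
    refine mul_le_mul_of_nonneg_left ?_ (le_max_right _ _)
    linarith [trace_autocov_le g v]
  rw [← Finset.sum_mul] at h1
  have h2 := mul_le_mul_of_nonneg_right (sum_bartlett_le (L := L) hb)
    (show (0 : ℝ) ≤ 2 * D by linarith)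
  linarith [trace_autocov_le g 0]

end HAC

/-! ### The Wald form -/

/-- A square root, up to orthogonal matrices. -/
lemma exists_eq_transpose_mul_self {r : ℕ}
    {A : Matrix (Fin r) (Fin r) ℝ} (h : A.PosSemidef) :
    ∃ B : Matrix (Fin r) (Fin r) ℝ, A = Bᵀ * B := by
  open scoped MatrixOrder Matrix.Norms.L2Operator in
  obtain ⟨B, hB⟩ := CStarAlgebra.nonneg_iff_eq_star_mul_self.mp h.nonneg
  exact ⟨B, by rw [hB]; rfl⟩

/-- `vᵀ Ω⁻¹ v ≥ vᵀ v / tr Ω`: the eigenvalues of `Ω` are at most its trace. -/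
lemma dotProduct_self_le_trace_mul {r : ℕ} {Om : Matrix (Fin r) (Fin r) ℝ} (h : Om.PosDef)
    (v : Fin r → ℝ) : v ⬝ᵥ v ≤ Om.trace * (v ⬝ᵥ (Om⁻¹ *ᵥ v)) := by
  obtain ⟨B, hB⟩ := exists_eq_transpose_mul_self h.posSemidef
  have hdet := (Matrix.isUnit_iff_isUnit_det _).1 h.isUnit
  set y := Om⁻¹ *ᵥ v with hy
  have hv : v = Bᵀ *ᵥ (B *ᵥ y) := by
    rw [Matrix.mulVec_mulVec, ← hB, hy, Matrix.mulVec_mulVec, Matrix.mul_nonsing_inv _ hdet,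
      Matrix.one_mulVec]
  have h1 : ‖Matrix.replicateCol Unit v‖ ≤ ‖B‖ * ‖Matrix.replicateCol Unit (B *ᵥ y)‖ := by
    conv_lhs => rw [hv, ← mul_replicateCol]
    refine (Matrix.frobenius_norm_mul _ _).trans ?_
    rw [Matrix.frobenius_norm_transpose]
  have h2 : v ⬝ᵥ y = (B *ᵥ y) ⬝ᵥ (B *ᵥ y) := by
    conv_lhs => rw [hv]
    rw [Matrix.dotProduct_mulVec (B *ᵥ y), ← Matrix.mulVec_transpose]
  rw [h2, ← norm_replicateCol_sq, ← norm_replicateCol_sq, hB, ← norm_sq_eq_trace, ← mul_pow]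
  gcongr

/-! ### Residuals span -/

lemma sq_dotProduct_le {n : Type*} [Fintype n] (x y : n → ℝ) :
    (x ⬝ᵥ y) ^ 2 ≤ (x ⬝ᵥ x) * (y ⬝ᵥ y) := by
  have := Finset.sum_mul_sq_le_sq_mul_sq Finset.univ x y
  simpa only [dotProduct, sq] using this

lemma dotProduct_self_nonneg' {n : Type*} [Fintype n] (x : n → ℝ) : 0 ≤ x ⬝ᵥ x :=
  Finset.sum_nonneg fun _ _ => mul_self_nonneg _

lemma sum_abs_mul_le_norm {n : Type*} [Fintype n] (x y : Matrix n Unit ℝ) :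
    ∑ t, |x t ()| * |y t ()| ≤ ‖x‖ * ‖y‖ := by
  have h := Finset.sum_mul_sq_le_sq_mul_sq Finset.univ (fun t => |x t ()|) (fun t => |y t ()|)
  refine abs_le_of_sq_le_sq' (h.trans_eq ?_) (by positivity) |>.2
  rw [mul_pow, norm_sq_eq_sum, norm_sq_eq_sum]
  simp

/-- The `L¹` norm is bounded below by the `L²` and `L³` norms, by Cauchy–Schwarz applied to
`z² = |z| ^ (1/2) |z| ^ (3/2)`. -/
lemma sum_sq_sq_le {n : Type*} [Fintype n] (z : n → ℝ) :
    (∑ t, z t ^ 2) ^ 2 ≤ (∑ t, |z t|) * ∑ t, |z t| ^ 3 := by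
  have h := Finset.sum_mul_sq_le_sq_mul_sq Finset.univ (fun t => Real.sqrt |z t|)
    (fun t => Real.sqrt |z t| * |z t|)
  have e1 : ∀ t, Real.sqrt |z t| * (Real.sqrt |z t| * |z t|) = z t ^ 2 := fun t => by
    rw [← mul_assoc, Real.mul_self_sqrt (abs_nonneg _), ← sq, sq_abs]
  have e2 : ∀ t, Real.sqrt |z t| ^ 2 = |z t| := fun t => Real.sq_sqrt (abs_nonneg _)
  have e3 : ∀ t, (Real.sqrt |z t| * |z t|) ^ 2 = |z t| ^ 3 := fun t => by
    rw [mul_pow, Real.sq_sqrt (abs_nonneg _)]; ring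
  simpa only [e1, e2, e3] using h

section Span

variable {α : Type*} {l : Filter α} {r : ℕ} {L N : α → ℕ} {ρ : α → ℝ}
  {F G : ∀ a, Matrix (Fin (L a)) (Fin r) ℝ} {Λ : ∀ a, Matrix (Fin (N a)) (Fin r) ℝ}
  {E : ∀ a, Matrix (Fin (L a)) (Fin (N a)) ℝ} {SF SL Φ : Matrix (Fin r) (Fin r) ℝ}

/-- The least squares residuals of a single unit are close to its errors. -/
lemma IsFactorRegime.residual (h : IsFactorRegime l ρ F Λ E G SF SL)
    {β : α → Matrix (Fin r) Unit ℝ} {ε : ∀ a, Matrix (Fin (L a)) Unit ℝ}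
    (hβ : NormBigO l β fun _ => 1) (hε : NormBigO l ε fun _ => 1)
    (hFε : NormBigO l (fun a => (F a)ᵀ * ε a) ρ) :
    NormBigO l (fun a => (F a * β a + ε a) - G a * ((G a)ᵀ * (F a * β a + ε a)) - ε a) ρ := by
  refine ((h.factor_residual.mul_bdd hβ).sub
    (h.bddG.bdd_mul (h.pc_mul_noise hε hFε))).congr (Eventually.of_forall fun a => ?_)
  simp only [Matrix.mul_add, Matrix.sub_mul, Matrix.mul_assoc]
  abel

/-- The products of the estimated factors and the residuals of a unit span, since the products of
factors and errors do so on average: with `z t = (F H x)ₜ εₜ`, the limit `Φ` bounds `∑ z²` below,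
third moments then bound `∑ |z|` below (`sum_sq_sq_le`), but `∑ |z|` is small compared to `‖x‖` if
all the products of estimated factors and residuals are orthogonal to `x`. -/
lemma IsFactorRegime.residual_span (h : IsFactorRegime l ρ F Λ E G SF SL)
    {β : α → Matrix (Fin r) Unit ℝ} {ε : ∀ a, Matrix (Fin (L a)) Unit ℝ}
    (hβ : NormBigO l β fun _ => 1) (hε : NormBigO l ε fun _ => 1)
    (hFε : NormBigO l (fun a => (F a)ᵀ * ε a) ρ) (hL : ∀ᶠ a in l, 0 < L a) (hΦ : IsUnit Φ)
    (hcov : Tendsto (fun a => ‖(Matrix.of fun t j => Real.sqrt (L a) * (F a t j * ε a t ()))ᵀ *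
      (Matrix.of fun t j => Real.sqrt (L a) * (F a t j * ε a t ())) - Φ‖) l (𝓝 0))
    {K : ℝ} (hK : ∀ᶠ a in l,
      (L a : ℝ) ^ 2 * ∑ t, Real.sqrt (∑ j, F a t j ^ 2) ^ 3 * |ε a t ()| ^ 3 ≤ K) :
    ∀ᶠ a in l, ∀ x : Matrix (Fin r) Unit ℝ, (∀ t, (G a * x) t () *
      ((F a * β a + ε a) - G a * ((G a)ᵀ * (F a * β a + ε a))) t () = 0) → x = 0 := by
  obtain ⟨c, hc, hlow⟩ := exists_lower_of_gram hΦ hcov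
  obtain ⟨k₁, hk₁, hb₁⟩ := h.rotF_inv.2.exists_bound
  -- the coefficient of `‖x‖` in the upper bound of the `L¹` norm
  have hup : Tendsto (fun a => ‖G a - F a * rotF F G Λ E a‖ * ‖ε a‖ +
      ‖(F a * β a + ε a) - G a * ((G a)ᵀ * (F a * β a + ε a)) - ε a‖ * ‖G a‖) l (𝓝 0) := by
    have e1 := (IsBigO.mul h.factor_consistency hε).trans_tendsto (by simpa using h.rate)
    have e2 := (IsBigO.mul (h.residual hβ hε hFε) h.bddG).trans_tendsto (by simpa using h.rate)
    simpa using e1.add e2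
  -- a positive bound of the third moments
  set K' := |K| + 1 with hK'
  have hK'0 : 0 < K' := by positivity
  filter_upwards [hlow, hb₁, h.rotF_inv.1, hL, hK,
    hup.eventually (gt_mem_nhds (show (0 : ℝ) < c ^ 4 / K' / k₁ by positivity))]
    with a h1 h2 hu hLa h3 h4 x hx
  by_contra hx0
  have hxn : 0 < ‖x‖ := norm_pos_iff.2 hx0
  have hLr : (0 : ℝ) < L a := by exact_mod_cast hLa
  set R := rotF F G Λ E a with hR
  set q := R * x with hq
  have hxq : ‖x‖ ≤ k₁ * ‖q‖ := by
    calc ‖x‖ = ‖R⁻¹ * q‖ := by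
          rw [hq, ← Matrix.mul_assoc, Matrix.nonsing_inv_mul _ hu, Matrix.one_mul]
      _ ≤ ‖R⁻¹‖ * ‖q‖ := Matrix.frobenius_norm_mul _ _
      _ ≤ _ := by gcongr
  have hqn : 0 < ‖q‖ := by
    by_contra hc0
    nlinarith [norm_nonneg q]
  set z : Fin (L a) → ℝ := fun t => (F a * q) t () * ε a t () with hz
  -- second moments from below, third moments from above, hence first moments from below
  have hz2 : (c * ‖q‖) ^ 2 ≤ L a * ∑ t, z t ^ 2 := by
    calc (c * ‖q‖) ^ 2
        ≤ ‖(Matrix.of fun t j => Real.sqrt (L a) * (F a t j * ε a t ())) * q‖ ^ 2 := by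
          gcongr; exact h1 q
      _ = L a * ∑ t, z t ^ 2 := by
          rw [norm_sq_eq_sum, Finset.mul_sum]
          refine Finset.sum_congr rfl fun t _ => ?_
          have : ((Matrix.of fun t j => Real.sqrt (L a) * (F a t j * ε a t ())) * q) t ()
              = Real.sqrt (L a) * z t := by
            simp only [hz, Matrix.mul_apply, Matrix.of_apply, Finset.sum_mul, Finset.mul_sum]
            exact Finset.sum_congr rfl fun j _ => by ring
          simp only [Finset.univ_unique, Finset.sum_singleton, PUnit.default_eq_unit, this,
            mul_pow, Real.sq_sqrt hLr.le]
  have hz3 : (L a : ℝ) ^ 2 * ∑ t, |z t| ^ 3 ≤ ‖q‖ ^ 3 * K' := by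
    have e : ∀ t, |z t| ^ 3 ≤
        ‖q‖ ^ 3 * (Real.sqrt (∑ j, F a t j ^ 2) ^ 3 * |ε a t ()| ^ 3) := fun t => by
      have e1 : |(F a * q) t ()| ≤ Real.sqrt (∑ j, F a t j ^ 2) * ‖q‖ := by
        refine abs_le_of_sq_le_sq ?_ (by positivity)
        rw [mul_pow, Real.sq_sqrt (by positivity), norm_sq_eq_sum, Matrix.mul_apply]
        simpa using Finset.sum_mul_sq_le_sq_mul_sq Finset.univ (F a t) (fun j => q j ())
      calc |z t| ^ 3 = |(F a * q) t ()| ^ 3 * |ε a t ()| ^ 3 := by rw [hz, abs_mul, mul_pow]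
        _ ≤ (Real.sqrt (∑ j, F a t j ^ 2) * ‖q‖) ^ 3 * |ε a t ()| ^ 3 := by gcongr
        _ = _ := by ring
    calc (L a : ℝ) ^ 2 * ∑ t, |z t| ^ 3
        ≤ (L a : ℝ) ^ 2 * ∑ t, ‖q‖ ^ 3 *
          (Real.sqrt (∑ j, F a t j ^ 2) ^ 3 * |ε a t ()| ^ 3) := by
          gcongr with t; exact e t
      _ = ‖q‖ ^ 3 * ((L a : ℝ) ^ 2 *
          ∑ t, Real.sqrt (∑ j, F a t j ^ 2) ^ 3 * |ε a t ()| ^ 3) := by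
          rw [← Finset.mul_sum]; ring
      _ ≤ ‖q‖ ^ 3 * K' := by
          gcongr
          linarith [le_abs_self K]
  have hz1 : c ^ 4 / K' * ‖q‖ ≤ ∑ t, |z t| := by
    have e0 : 0 ≤ ∑ t, |z t| := Finset.sum_nonneg fun t _ => abs_nonneg _
    have e1 : (c * ‖q‖) ^ 4 ≤ (∑ t, |z t|) * (‖q‖ ^ 3 * K') := by
      calc (c * ‖q‖) ^ 4 = ((c * ‖q‖) ^ 2) ^ 2 := by ring
        _ ≤ (L a * ∑ t, z t ^ 2) ^ 2 := by gcongr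
        _ = (L a : ℝ) ^ 2 * (∑ t, z t ^ 2) ^ 2 := by ring
        _ ≤ (L a : ℝ) ^ 2 * ((∑ t, |z t|) * ∑ t, |z t| ^ 3) := by
            gcongr; exact sum_sq_sq_le z
        _ = (∑ t, |z t|) * ((L a : ℝ) ^ 2 * ∑ t, |z t| ^ 3) := by ring
        _ ≤ _ := by gcongr
    rw [div_mul_eq_mul_div, div_le_iff₀ hK'0]
    have e2 : ‖q‖ ^ 3 * (c ^ 4 * ‖q‖) ≤ ‖q‖ ^ 3 * ((∑ t, |z t|) * K') := by nlinarith
    exact le_of_mul_le_mul_left e2 (by positivity)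
  set y := F a * β a + ε a with hy
  set ê := y - G a * ((G a)ᵀ * y) with hê
  -- the first moments from above: `z` differs from the vanishing products by estimation errors
  have hz1' : ∑ t, |z t| ≤ (‖G a - F a * R‖ * ‖ε a‖ + ‖ê - ε a‖ * ‖G a‖) * ‖x‖ := by
    have e : ∀ t, |z t| ≤ |((G a - F a * R) * x) t ()| * |ε a t ()|
        + |(ê - ε a) t ()| * |(G a * x) t ()| := fun t => by
      have e1 : z t = -(((G a - F a * R) * x) t () * ε a t ())
          - (ê - ε a) t () * (G a * x) t () := by
        have := hx t
        simp only [hz, hq, Matrix.sub_mul, Matrix.sub_apply, Matrix.mul_assoc] at this ⊢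
        linear_combination this
      rw [e1]
      refine (abs_sub _ _).trans ?_
      rw [abs_neg, abs_mul, abs_mul]
    calc ∑ t, |z t| ≤ ∑ t, |((G a - F a * R) * x) t ()| * |ε a t ()|
          + ∑ t, |(ê - ε a) t ()| * |(G a * x) t ()| := by
          rw [← Finset.sum_add_distrib]; exact Finset.sum_le_sum fun t _ => e t
      _ ≤ ‖(G a - F a * R) * x‖ * ‖ε a‖ + ‖ê - ε a‖ * ‖G a * x‖ :=
          add_le_add (sum_abs_mul_le_norm _ _) (sum_abs_mul_le_norm _ _)
      _ ≤ (‖G a - F a * R‖ * ‖x‖) * ‖ε a‖ + ‖ê - ε a‖ * (‖G a‖ * ‖x‖) := by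
          gcongr <;> exact Matrix.frobenius_norm_mul _ _
      _ = _ := by ring
  have hfin : c ^ 4 / K' * ‖q‖ < c ^ 4 / K' / k₁ * ‖x‖ :=
    (hz1.trans hz1').trans_lt (by gcongr)
  have : c ^ 4 / K' / k₁ * ‖x‖ ≤ c ^ 4 / K' * ‖q‖ := by
    calc c ^ 4 / K' / k₁ * ‖x‖ ≤ c ^ 4 / K' / k₁ * (k₁ * ‖q‖) := by gcongr
      _ = _ := by field_simp
  linarith

end Span

/-! ### Fourth moments of estimated factors and residuals -/

section FourthMoments

variable {r L N : ℕ}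

lemma sq_mean_le (x : Fin N → ℝ) :
    ((1 / (N : ℝ)) * ∑ i, x i) ^ 2 ≤ (1 / (N : ℝ)) * ∑ i, x i ^ 2 := by
  rcases Nat.eq_zero_or_pos N with rfl | hN
  · simp
  have hN' : (0 : ℝ) < N := by exact_mod_cast hN
  have h := Finset.sum_mul_sq_le_sq_mul_sq Finset.univ (fun _ : Fin N => (1 : ℝ)) x
  simp only [one_mul, one_pow, Finset.sum_const, Finset.card_univ, Fintype.card_fin, nsmul_eq_mul,
    mul_one] at h
  calc ((1 / (N : ℝ)) * ∑ i, x i) ^ 2 = (1 / (N : ℝ)) ^ 2 * (∑ i, x i) ^ 2 := mul_pow _ _ _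
    _ ≤ (1 / (N : ℝ)) ^ 2 * (N * ∑ i, x i ^ 2) := by gcongr
    _ = _ := by field_simp

/-- The estimated factors are linear functions of the cross section, so that their fourth moments
are bounded by those of the data. -/
lemma mean_factor_fourth_le {X : Matrix (Fin L) (Fin N) ℝ} {Ft : Matrix (Fin L) (Fin r) ℝ}
    (hL : 0 < L) (hN : 0 < N)
    (hpc : IsUnitPC ((1 / Real.sqrt (N * L)) • X) ((1 / Real.sqrt L) • Ft))
    (hu : IsUnit (pcGram ((1 / Real.sqrt (N * L)) • X) ((1 / Real.sqrt L) • Ft)).det) :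
    (1 / (L : ℝ)) * ∑ t, (Ft t ⬝ᵥ Ft t) ^ 2 ≤
      (‖((1 / Real.sqrt (N * L)) • X)ᵀ * ((1 / Real.sqrt L) • Ft)‖ *
        ‖(pcGram ((1 / Real.sqrt (N * L)) • X) ((1 / Real.sqrt L) • Ft))⁻¹‖) ^ 4 *
      ((1 / (L : ℝ)) * ∑ t, (1 / (N : ℝ)) * ∑ i, X t i ^ 4) := by
  have hL' : (0 : ℝ) < L := by exact_mod_cast hL
  have hN' : (0 : ℝ) < N := by exact_mod_cast hN
  set Y := (1 / Real.sqrt (N * L)) • X with hY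
  set G := (1 / Real.sqrt L) • Ft with hG
  set C := Yᵀ * G * (pcGram Y G)⁻¹ with hC
  -- the eigenvalue equation, solved for the estimated factors
  have hGC : G = Y * C := by
    rw [hC, ← Matrix.mul_assoc, ← Matrix.mul_assoc, hpc.eig, Matrix.mul_assoc,
      Matrix.mul_nonsing_inv _ hu, Matrix.mul_one]
  have hCn : ‖C‖ ≤ ‖Yᵀ * G‖ * ‖(pcGram Y G)⁻¹‖ := Matrix.frobenius_norm_mul _ _
  have hrow : ∀ t, Ft t ⬝ᵥ Ft t ≤ ‖C‖ ^ 2 * ((1 / (N : ℝ)) * ∑ i, X t i ^ 2) := fun t => by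
    have e1 : Ft t ⬝ᵥ Ft t = L * ∑ j, G t j ^ 2 := by
      simp only [hG, Matrix.smul_apply, smul_eq_mul, mul_pow, div_pow, one_pow,
        Real.sq_sqrt hL'.le, ← Finset.mul_sum, dotProduct, ← sq]
      field_simp
    have e2 : ∑ j, G t j ^ 2 ≤ (∑ i, Y t i ^ 2) * ‖C‖ ^ 2 := by
      rw [norm_sq_eq_sum, Finset.sum_comm, Finset.mul_sum]
      refine Finset.sum_le_sum fun j _ => ?_
      rw [hGC, Matrix.mul_apply]
      exact Finset.sum_mul_sq_le_sq_mul_sq Finset.univ _ _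
    have e3 : ∑ i, Y t i ^ 2 = 1 / (N * L) * ∑ i, X t i ^ 2 := by
      simp only [hY, Matrix.smul_apply, smul_eq_mul, mul_pow, div_pow, one_pow,
        Real.sq_sqrt (show (0 : ℝ) ≤ N * L by positivity), ← Finset.mul_sum]
    calc Ft t ⬝ᵥ Ft t ≤ L * ((∑ i, Y t i ^ 2) * ‖C‖ ^ 2) := by rw [e1]; gcongr
      _ = _ := by rw [e3]; field_simp
  have hrow2 : ∀ t, (Ft t ⬝ᵥ Ft t) ^ 2 ≤
      (‖Yᵀ * G‖ * ‖(pcGram Y G)⁻¹‖) ^ 4 * ((1 / (N : ℝ)) * ∑ i, X t i ^ 4) := fun t => by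
    have e0 := dotProduct_self_nonneg' (Ft t)
    calc (Ft t ⬝ᵥ Ft t) ^ 2 ≤ (‖C‖ ^ 2 * ((1 / (N : ℝ)) * ∑ i, X t i ^ 2)) ^ 2 := by
          gcongr; exact hrow t
      _ = ‖C‖ ^ 4 * ((1 / (N : ℝ)) * ∑ i, X t i ^ 2) ^ 2 := by ring
      _ ≤ ‖C‖ ^ 4 * ((1 / (N : ℝ)) * ∑ i, (X t i ^ 2) ^ 2) := by
          gcongr; exact sq_mean_le _
      _ = ‖C‖ ^ 4 * ((1 / (N : ℝ)) * ∑ i, X t i ^ 4) := by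
          simp only [← pow_mul, Nat.reduceMul]
      _ ≤ _ := by gcongr
  calc (1 / (L : ℝ)) * ∑ t, (Ft t ⬝ᵥ Ft t) ^ 2
      ≤ (1 / (L : ℝ)) * ∑ t, (‖Yᵀ * G‖ * ‖(pcGram Y G)⁻¹‖) ^ 4 *
        ((1 / (N : ℝ)) * ∑ i, X t i ^ 4) := by gcongr with t; exact hrow2 t
    _ = _ := by rw [← Finset.mul_sum]; ring

/-- Second moments of the products of estimated factors and residuals of a single unit, in terms
of the fourth moments of the estimated factors and of the data. -/
lemma mean_residual_factor_sq_le (y : Fin L → ℝ) (Ft : Matrix (Fin L) (Fin r) ℝ)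
    (hF : (1 / (L : ℝ)) * ∑ t, Ft t ⬝ᵥ Ft t = r) (lam : Fin r → ℝ)
    (hlam : lam = (1 / (L : ℝ)) • ∑ t, y t • Ft t) :
    (1 / (L : ℝ)) * ∑ t, (y t - lam ⬝ᵥ Ft t) ^ 2 * (Ft t ⬝ᵥ Ft t) ≤
      (1 / (L : ℝ)) * (∑ t, (Ft t ⬝ᵥ Ft t) ^ 2) + 4 * ((1 / (L : ℝ)) * ∑ t, y t ^ 4) *
        (1 + r ^ 2 * ((1 / (L : ℝ)) * ∑ t, (Ft t ⬝ᵥ Ft t) ^ 2)) := by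
  set φ := (1 / (L : ℝ)) * ∑ t, (Ft t ⬝ᵥ Ft t) ^ 2 with hφ
  set q := (1 / (L : ℝ)) * ∑ t, y t ^ 4 with hq
  set S := lam ⬝ᵥ lam with hS
  have hS0 : 0 ≤ S := dotProduct_self_nonneg' lam
  have hlam2 : S ≤ r * ((1 / (L : ℝ)) * ∑ t, y t ^ 2) := by
    have e1 : ∀ j, lam j ^ 2 ≤
        (1 / (L : ℝ)) * (∑ t, y t ^ 2) * ((1 / (L : ℝ)) * ∑ t, Ft t j ^ 2) := fun j => by
      have : lam j = (1 / (L : ℝ)) * ∑ t, y t * Ft t j := by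
        rw [hlam]; simp [Finset.sum_apply]
      rw [this, mul_pow]
      calc _ ≤ (1 / (L : ℝ)) ^ 2 * ((∑ t, y t ^ 2) * ∑ t, Ft t j ^ 2) := by
            gcongr; exact Finset.sum_mul_sq_le_sq_mul_sq Finset.univ _ _
        _ = _ := by ring
    calc S = ∑ j, lam j ^ 2 := by simp only [hS, dotProduct, sq]
      _ ≤ ∑ j, (1 / (L : ℝ)) * (∑ t, y t ^ 2) * ((1 / (L : ℝ)) * ∑ t, Ft t j ^ 2) :=
          Finset.sum_le_sum fun j _ => e1 j
      _ = ((1 / (L : ℝ)) * ∑ t, y t ^ 2) * ((1 / (L : ℝ)) * ∑ t, Ft t ⬝ᵥ Ft t) := by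
          rw [← Finset.mul_sum, ← Finset.mul_sum, Finset.sum_comm]
          simp only [dotProduct, sq]
      _ = _ := by rw [hF]; ring
  have hS2 : S ^ 2 ≤ r ^ 2 * q := by
    calc S ^ 2 ≤ (r * ((1 / (L : ℝ)) * ∑ t, y t ^ 2)) ^ 2 := by gcongr
      _ = r ^ 2 * ((1 / (L : ℝ)) * ∑ t, y t ^ 2) ^ 2 := by ring
      _ ≤ r ^ 2 * ((1 / (L : ℝ)) * ∑ t, (y t ^ 2) ^ 2) := by gcongr; exact sq_mean_le _
      _ = _ := by simp only [← pow_mul]; norm_num [hq]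
  have hpt : ∀ t, (y t - lam ⬝ᵥ Ft t) ^ 2 * (Ft t ⬝ᵥ Ft t) ≤
      (Ft t ⬝ᵥ Ft t) ^ 2 + 4 * y t ^ 4 + 4 * (S ^ 2 * (Ft t ⬝ᵥ Ft t) ^ 2) := fun t => by
    set s := Ft t ⬝ᵥ Ft t with hs
    set p := lam ⬝ᵥ Ft t with hp
    have hs0 : 0 ≤ s := dotProduct_self_nonneg' (Ft t)
    have h1 : p ^ 2 ≤ S * s := sq_dotProduct_le _ _
    have h2 : (y t - p) ^ 2 ≤ 2 * y t ^ 2 + 2 * (S * s) := by nlinarith [sq_nonneg (y t + p)]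
    have h3 : (y t - p) ^ 2 * s ≤ (2 * y t ^ 2 + 2 * (S * s)) * s := by gcongr
    nlinarith [sq_nonneg (s - 2 * y t ^ 2), sq_nonneg (s - 2 * (S * s)),
      sq_nonneg (y t ^ 2), sq_nonneg (S * s)]
  calc (1 / (L : ℝ)) * ∑ t, (y t - lam ⬝ᵥ Ft t) ^ 2 * (Ft t ⬝ᵥ Ft t)
      ≤ (1 / (L : ℝ)) * ∑ t, ((Ft t ⬝ᵥ Ft t) ^ 2 + 4 * y t ^ 4 +
        4 * (S ^ 2 * (Ft t ⬝ᵥ Ft t) ^ 2)) := by gcongr with t; exact hpt t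
    _ = φ + 4 * q + 4 * (S ^ 2 * φ) := by
        simp only [Finset.sum_add_distrib, ← Finset.mul_sum, hφ, hq]; ring
    _ ≤ φ + 4 * q + 4 * (r ^ 2 * q * φ) := by gcongr
    _ = _ := by ring

end FourthMoments

/-! ### Properties of typical samples -/

section Typical

variable {Ω : Type*}

/-- The filter on `ℕ × Ω` of `n → ∞`, uniformly over the samples `ω ∈ A n`. -/
def alongSets (A : ℕ → Set Ω) : Filter (ℕ × Ω) :=
  comap Prod.fst atTop ⊓ 𝓟 {p | p.2 ∈ A p.1}

lemma alongSets_le (A : ℕ → Set Ω) : alongSets A ≤ comap Prod.fst atTop := inf_le_left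

lemma eventually_alongSets {A : ℕ → Set Ω} {R : ℕ × Ω → Prop}
    (h : ∀ᶠ n in atTop, ∀ ω ∈ A n, R (n, ω)) {l : Filter (ℕ × Ω)} (hl : l ≤ alongSets A) :
    ∀ᶠ p in l, R p := by
  refine hl ?_
  rw [alongSets]
  change ∀ᶠ p in _, R p
  rw [eventually_inf_principal]
  filter_upwards [h.comap Prod.fst] with p hp hpA
  exact hp p.2 hpA

variable [MeasurableSpace Ω] {μ : Measure Ω}

/-- `P` holds on sets of samples of probability arbitrarily close to one. Along the corresponding
filters, `O_p` and convergence in probability are the deterministic notions. All filters below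
`alongSets A` are admitted, so that properties stay typical under restriction to an event. -/
def Typical (μ : Measure Ω) (P : Filter (ℕ × Ω) → Prop) : Prop :=
  ∀ ε : ℝ, 0 < ε → ∃ A : ℕ → Set Ω, (∀ᶠ n in atTop, μ (A n)ᶜ ≤ ENNReal.ofReal ε) ∧
    ∀ l ≤ alongSets A, P l

variable {P Q : Filter (ℕ × Ω) → Prop}

lemma Typical.and (hP : Typical μ P) (hQ : Typical μ Q) : Typical μ fun l => P l ∧ Q l := by
  intro ε hε
  obtain ⟨A, hA, hPA⟩ := hP (ε / 2) (by linarith)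
  obtain ⟨B, hB, hQB⟩ := hQ (ε / 2) (by linarith)
  refine ⟨fun n => A n ∩ B n, ?_, fun l hl => ⟨hPA l (hl.trans ?_), hQB l (hl.trans ?_)⟩⟩
  · filter_upwards [hA, hB] with n h1 h2
    rw [Set.compl_inter, ← add_halves ε, ENNReal.ofReal_add (by linarith) (by linarith)]
    exact (measure_union_le _ _).trans (add_le_add h1 h2)
  · exact inf_le_inf_left _ (principal_mono.2 fun p hp => hp.1)
  · exact inf_le_inf_left _ (principal_mono.2 fun p hp => hp.2)

lemma Typical.mono (hP : Typical μ P) (h : ∀ l ≤ comap Prod.fst atTop, P l → Q l) :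
    Typical μ Q := by
  intro ε hε
  obtain ⟨A, hA, hPA⟩ := hP ε hε
  exact ⟨A, hA, fun l hl => h l (hl.trans (alongSets_le A)) (hPA l hl)⟩

lemma typical_of_bound {Y : ℕ → Ω → ℝ}
    (h : ∀ ε : ℝ, 0 < ε → ∃ C : ℝ, ∀ᶠ n in atTop, μ {ω | C < Y n ω} ≤ ENNReal.ofReal ε) :
    Typical μ fun l => ∃ C : ℝ, ∀ᶠ p in l, Y p.1 p.2 ≤ C := by
  intro ε hε
  obtain ⟨C, hC⟩ := h ε hε
  refine ⟨fun n => {ω | Y n ω ≤ C}, ?_, fun l hl => ⟨C, eventually_alongSets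
    (R := fun p => Y p.1 p.2 ≤ C) (Eventually.of_forall fun n ω hω => hω) hl⟩⟩
  filter_upwards [hC] with n hn
  simpa only [Set.compl_ofPred, not_le] using hn

lemma BoundedInProb.typical {Y : ℕ → Ω → ℝ} (h : BoundedInProb μ Y) :
    Typical μ fun l => (fun p => Y p.1 p.2) =O[l] fun _ => (1 : ℝ) := by
  refine (typical_of_bound (Y := fun n ω => |Y n ω|) h).mono fun l _ hl => ?_
  obtain ⟨C, hC⟩ := hl
  exact IsBigO.of_bound C (by simpa using hC)

lemma BoundedInProb.comp {Y : ℕ → Ω → ℝ} (h : BoundedInProb μ Y) {N : ℕ → ℕ}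
    (hN : Tendsto N atTop atTop) : BoundedInProb μ fun n => Y (N n) := by
  intro ε hε
  obtain ⟨C, hC⟩ := h ε hε
  exact ⟨C, hN.eventually hC⟩

lemma typical_eventually {R : ℕ → Ω → Prop} (h : Tendsto (fun n => μ {ω | ¬R n ω}) atTop (𝓝 0)) :
    Typical μ fun l => ∀ᶠ p in l, R p.1 p.2 := by
  intro ε hε
  refine ⟨fun n => {ω | R n ω}, ?_, fun l hl => eventually_alongSets
    (R := fun p => R p.1 p.2) (Eventually.of_forall fun n ω hω => hω) hl⟩
  exact h.eventually (ge_mem_nhds (by simpa using hε))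

/-- Convergence in probability becomes convergence, by a diagonal choice of the typical sets. -/
lemma typical_tendsto_zero {Y : ℕ → Ω → ℝ}
    (h : ∀ δ : ℝ, 0 < δ → Tendsto (fun n => μ {ω | δ ≤ |Y n ω|}) atTop (𝓝 0)) :
    Typical μ fun l => Tendsto (fun p => Y p.1 p.2) l (𝓝 0) := by
  intro ε hε
  obtain ⟨e, he, hsum⟩ := ENNReal.exists_pos_sum_of_countable'
    (show ENNReal.ofReal ε ≠ 0 by simpa using hε) ℕ
  have h1 : ∀ k : ℕ, ∃ n₀, ∀ n, n₀ ≤ n → μ {ω | 1 / ((k : ℝ) + 1) ≤ |Y n ω|} ≤ e k := fun k =>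
    eventually_atTop.1 ((h (1 / ((k : ℝ) + 1)) (by positivity)).eventually (ge_mem_nhds (he k)))
  choose n₀ hn₀ using h1
  refine ⟨fun n => {ω | ∀ k, n₀ k ≤ n → |Y n ω| < 1 / ((k : ℝ) + 1)}, ?_, fun l hl => ?_⟩
  · refine Eventually.of_forall fun n => ?_
    calc μ {ω | ∀ k, n₀ k ≤ n → |Y n ω| < 1 / ((k : ℝ) + 1)}ᶜ
        ≤ μ (⋃ k, {ω | n₀ k ≤ n ∧ 1 / ((k : ℝ) + 1) ≤ |Y n ω|}) := by
          refine measure_mono fun ω hω => ?_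
          simp only [Set.mem_compl_iff, Set.mem_ofPred_eq, not_forall, not_lt] at hω
          obtain ⟨k, hk, hk'⟩ := hω
          exact Set.mem_iUnion.2 ⟨k, hk, hk'⟩
      _ ≤ ∑' k, μ {ω | n₀ k ≤ n ∧ 1 / ((k : ℝ) + 1) ≤ |Y n ω|} := measure_iUnion_le _
      _ ≤ ∑' k, e k := by
          refine ENNReal.tsum_le_tsum fun k => ?_
          by_cases hk : n₀ k ≤ n
          · exact (measure_mono fun ω hω => hω.2).trans (hn₀ k n hk)
          · simp [hk]
      _ ≤ _ := hsum.le
  · refine Metric.tendsto_nhds.2 fun δ hδ => ?_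
    obtain ⟨k, hk⟩ := exists_nat_one_div_lt hδ
    refine eventually_alongSets (R := fun p => dist (Y p.1 p.2) 0 < δ) ?_ hl
    filter_upwards [eventually_ge_atTop (n₀ k)] with n hn ω hω
    simpa using (hω k hn).trans hk

/-- If `Y → ∞` on the typical samples in `B`, then `Y → ∞` in probability on `B`. -/
lemma Typical.diverges (hP : Typical μ P) {B : Set Ω} {Y : ℕ → Ω → ℝ}
    (h : ∀ l ≤ comap Prod.fst atTop ⊓ 𝓟 {p : ℕ × Ω | p.2 ∈ B}, P l →
      Tendsto (fun p => Y p.1 p.2) l atTop) : DivergesInProbOn μ B Y := by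
  intro C
  rw [ENNReal.tendsto_nhds_zero]
  intro ε hε
  obtain ⟨ε', hε', hle⟩ : ∃ ε' : ℝ, 0 < ε' ∧ ENNReal.ofReal ε' ≤ ε := by
    by_cases htop : ε = ⊤
    · exact ⟨1, one_pos, htop ▸ le_top⟩
    · exact ⟨ε.toReal, ENNReal.toReal_pos hε.ne' htop, by rw [ENNReal.ofReal_toReal htop]⟩
  obtain ⟨A, hA, hPA⟩ := hP ε' hε'
  have h1 := (h (alongSets A ⊓ 𝓟 {p : ℕ × Ω | p.2 ∈ B}) (inf_le_inf_right _ (alongSets_le A))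
    (hPA _ inf_le_left)).eventually (eventually_gt_atTop C)
  rw [eventually_inf_principal, alongSets, eventually_inf_principal, eventually_comap] at h1
  filter_upwards [h1, hA] with n hn hAn
  refine (measure_mono fun ω hω => ?_).trans (hAn.trans hle)
  intro hωA
  exact absurd (hn (n, ω) rfl hωA hω.1) (not_lt.2 hω.2)

end Typical

/-! ### Bounds on means -/

section MeanLE

variable {Ω : Type*} [MeasurableSpace Ω] {μ : Measure Ω}

/-- `E Y ≤ c`, for `Y ≥ 0`. The lower integral makes integrability part of the statement. -/
def MeanLE (μ : Measure Ω) (Y : Ω → ℝ) (c : ℝ) : Prop :=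
  ∫⁻ ω, ENNReal.ofReal (Y ω) ∂μ ≤ ENNReal.ofReal c

variable {Y Y' : Ω → ℝ} {c c' : ℝ}

lemma MeanLE.mono (h : MeanLE μ Y c) (hY : ∀ ω, Y' ω ≤ Y ω) (hc : c ≤ c') : MeanLE μ Y' c' :=
  (lintegral_mono fun ω => ENNReal.ofReal_le_ofReal (hY ω)).trans
    (h.trans (ENNReal.ofReal_le_ofReal hc))

lemma MeanLE.add (h : MeanLE μ Y c) (h' : MeanLE μ Y' c') (hY : Measurable Y)
    (hc : 0 ≤ c) (hc' : 0 ≤ c') : MeanLE μ (fun ω => Y ω + Y' ω) (c + c') := by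
  rw [MeanLE, ENNReal.ofReal_add hc hc']
  calc ∫⁻ ω, ENNReal.ofReal (Y ω + Y' ω) ∂μ
      ≤ ∫⁻ ω, (ENNReal.ofReal (Y ω) + ENNReal.ofReal (Y' ω)) ∂μ :=
        lintegral_mono fun ω => ENNReal.ofReal_add_le
    _ = ∫⁻ ω, ENNReal.ofReal (Y ω) ∂μ + ∫⁻ ω, ENNReal.ofReal (Y' ω) ∂μ :=
        lintegral_add_left hY.ennreal_ofReal _
    _ ≤ _ := add_le_add h h'

lemma MeanLE.const_mul (h : MeanLE μ Y c) {a : ℝ} (ha : 0 ≤ a) :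
    MeanLE μ (fun ω => a * Y ω) (a * c) := by
  rw [MeanLE, ENNReal.ofReal_mul ha]
  simp only [ENNReal.ofReal_mul ha]
  rw [lintegral_const_mul' _ _ ENNReal.ofReal_ne_top]
  gcongr
  exact h

lemma meanLE_const [IsProbabilityMeasure μ] (c : ℝ) : MeanLE μ (fun _ => c) c := by
  simp [MeanLE]

lemma MeanLE.sum {ι : Type*} (s : Finset ι) {Y : ι → Ω → ℝ} {c : ι → ℝ}
    (hY : ∀ i ∈ s, Measurable (Y i)) (hc : ∀ i ∈ s, 0 ≤ c i)
    (h : ∀ i ∈ s, MeanLE μ (Y i) (c i)) :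
    MeanLE μ (fun ω => ∑ i ∈ s, Y i ω) (∑ i ∈ s, c i) := by
  classical
  induction s using Finset.induction_on with
  | empty => simp [MeanLE]
  | insert i s hi ih =>
    simp only [Finset.sum_insert hi]
    exact (h i (Finset.mem_insert_self i s)).add
      (ih (fun j hj => hY j (Finset.mem_insert_of_mem hj))
        (fun j hj => hc j (Finset.mem_insert_of_mem hj))
        fun j hj => h j (Finset.mem_insert_of_mem hj))
      (hY i (Finset.mem_insert_self i s)) (hc i (Finset.mem_insert_self i s))
      (Finset.sum_nonneg fun j hj => hc j (Finset.mem_insert_of_mem hj))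

/-- The mean of `1 / k` times a sum of `k` terms of mean at most `c`. -/
lemma MeanLE.average {ι : Type*} (s : Finset ι) {Y : ι → Ω → ℝ} {c : ℝ}
    (hY : ∀ i ∈ s, Measurable (Y i)) (hc : 0 ≤ c) (h : ∀ i ∈ s, MeanLE μ (Y i) c) :
    MeanLE μ (fun ω => (1 / (s.card : ℝ)) * ∑ i ∈ s, Y i ω) c := by
  refine ((MeanLE.sum s hY (fun _ _ => hc) h).const_mul
    (show (0 : ℝ) ≤ 1 / s.card by positivity)).mono (fun ω => le_rfl) ?_
  rw [Finset.sum_const, nsmul_eq_mul, ← mul_assoc, one_div_mul_eq_div]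
  exact mul_le_of_le_one_left hc (div_self_le_one _)

/-- Markov's inequality: a bound on the means is a stochastic order of magnitude. -/
lemma typical_of_meanLE {Y : ℕ → Ω → ℝ} {g : ℕ → ℝ} {c : ℝ} (hc : 0 ≤ c)
    (hY : ∀ n, Measurable (Y n)) (hg : ∀ᶠ n in atTop, 0 < g n)
    (h : ∀ᶠ n in atTop, MeanLE μ (Y n) (c * g n)) :
    Typical μ fun l => ∃ K : ℝ, ∀ᶠ p in l, Y p.1 p.2 ≤ K * g p.1 := by
  have key : Typical μ fun l => ∃ K : ℝ, ∀ᶠ p in l, Y p.1 p.2 / g p.1 ≤ K := by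
    refine typical_of_bound (Y := fun n ω => Y n ω / g n) fun ε hε => ⟨(c + 1) / ε, ?_⟩
    filter_upwards [hg, h] with n hgn hn
    have hK : 0 < (c + 1) / ε * g n := by positivity
    have h1 : μ {ω | (c + 1) / ε < Y n ω / g n}
        ≤ μ {ω | ENNReal.ofReal ((c + 1) / ε * g n) ≤ ENNReal.ofReal (Y n ω)} := by
      refine measure_mono fun ω hω => ENNReal.ofReal_le_ofReal ?_
      exact ((lt_div_iff₀ hgn).1 hω).le
    refine h1.trans ((meas_ge_le_lintegral_div (hY n).ennreal_ofReal.aemeasurable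
      (by simpa using hK)
      ENNReal.ofReal_ne_top).trans ?_)
    calc _ ≤ ENNReal.ofReal (c * g n) / ENNReal.ofReal ((c + 1) / ε * g n) := by gcongr; exact hn
      _ = ENNReal.ofReal (c * g n / ((c + 1) / ε * g n)) := (ENNReal.ofReal_div_of_pos hK).symm
      _ ≤ ENNReal.ofReal ε := by
        refine ENNReal.ofReal_le_ofReal ?_
        rw [div_le_iff₀ hK]
        have : ε * ((c + 1) / ε * g n) = (c + 1) * g n := by field_simp
        rw [this]
        nlinarith
  refine key.mono fun l hl ⟨K, hK⟩ => ⟨K, ?_⟩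
  filter_upwards [hK, hl (hg.comap Prod.fst)] with p h1 h2
  exact (div_le_iff₀ h2).1 h1

/-- A family of random matrices whose mean squares are of the order `g ^ 2`. -/
lemma typical_normBigO {m n : ℕ → Type*} [∀ k, Fintype (m k)] [∀ k, Fintype (n k)]
    {A : ∀ k, Ω → Matrix (m k) (n k) ℝ} {g : ℕ → ℝ} {c : ℝ} (hc : 0 ≤ c)
    (hA : ∀ k, Measurable fun ω => ‖A k ω‖ ^ 2) (hg : ∀ᶠ k in atTop, 0 < g k)
    (h : ∀ᶠ k in atTop, MeanLE μ (fun ω => ‖A k ω‖ ^ 2) (c * g k ^ 2)) :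
    Typical μ fun l => NormBigO l (fun p : ℕ × Ω => A p.1 p.2) fun p => g p.1 := by
  refine (typical_of_meanLE (g := fun k => g k ^ 2) hc hA
    (hg.mono fun k hk => by positivity) h).mono fun l _ ⟨K, hK⟩ => ?_
  exact NormBigO.of_sq_le hK ((isBigO_refl _ l).const_mul_left K)

end MeanLE

/-! ### Regimes and scaled data -/

section Sample

lemma breakDate_le {frac : ℝ} (h1 : frac < 1) (T : ℕ) : breakDate frac T ≤ T := by
  refine Nat.floor_le_of_le ?_
  have : (0 : ℝ) ≤ T := Nat.cast_nonneg T
  nlinarith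

/-- Sums over the periods of a regime, in terms of the positions within the regime. -/
lemma sum_regime {E : Type*} [AddCommMonoid E] {frac : ℝ} (h1 : frac < 1) (T : ℕ) (m : Fin 2)
    (φ : ℕ → E) :
    ∑ t ∈ regime frac T m, φ t = ∑ t : Fin (len frac T m), φ (offset frac T m + t) := by
  have hle := breakDate_le h1 T
  rw [Fin.sum_univ_eq_sum_range fun t => φ (offset frac T m + t)]
  fin_cases m
  · simp only [regime, len, offset]
    simp only [Fin.zero_eta, if_true, zero_add]
    refine Finset.sum_congr ?_ fun _ _ => rfl
    ext t
    simp only [Finset.mem_filter, Finset.mem_range]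
    omega
  · simp only [regime, len, offset]
    simp only [Fin.mk_one, one_ne_zero, if_false]
    rw [← Finset.sum_Ico_eq_sum_range]
    refine Finset.sum_congr ?_ fun _ _ => rfl
    ext t
    simp only [Finset.mem_filter, Finset.mem_range, Finset.mem_Ico]
    omega

lemma offset_add_lt {frac : ℝ} (h1 : frac < 1) {T : ℕ} {m : Fin 2} (t : Fin (len frac T m)) :
    offset frac T m + t < T := by
  have hle := breakDate_le h1 T
  have ht := t.2
  fin_cases m
  · simp only [len, offset, Fin.zero_eta, if_true, zero_add] at ht ⊢
    omega
  · simp only [len, offset, Fin.mk_one, one_ne_zero, if_false] at ht ⊢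
    omega

/-- Both regimes contain a positive fraction of the sample. -/
lemma exists_len_lower {frac : ℝ} (h0 : 0 < frac) (h1 : frac < 1) :
    ∃ c : ℝ, 0 < c ∧ ∀ᶠ T : ℕ in atTop, ∀ m, c * T ≤ len frac T m := by
  refine ⟨min (frac / 2) (1 - frac), lt_min (by linarith) (by linarith), ?_⟩
  filter_upwards [tendsto_natCast_atTop_atTop.eventually_ge_atTop (2 / frac)] with T hT m
  have hT0 : (0 : ℝ) ≤ T := Nat.cast_nonneg T
  rw [len]
  split_ifs
  · have e1 := Nat.lt_floor_add_one (frac * T)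
    rw [div_le_iff₀ h0] at hT
    have e2 : min (frac / 2) (1 - frac) * T ≤ frac / 2 * T := by gcongr; exact min_le_left _ _
    rw [breakDate]
    linarith
  · have e1 := Nat.floor_le (show 0 ≤ frac * T by positivity)
    have e2 : min (frac / 2) (1 - frac) * T ≤ (1 - frac) * T := by gcongr; exact min_le_right _ _
    rw [Nat.cast_sub (breakDate_le h1 T), breakDate]
    linarith

/-- The rate `N ^ (-1/2) + T ^ (-1/2)`. -/
noncomputable def sampleRate (N T : ℕ → ℕ) (n : ℕ) : ℝ := 1 / Real.sqrt (N n) + 1 / Real.sqrt (T n)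

variable {N T : ℕ → ℕ}

lemma tendsto_one_div_sqrt {N : ℕ → ℕ} (hN : Tendsto N atTop atTop) :
    Tendsto (fun n => 1 / Real.sqrt (N n)) atTop (𝓝 0) := by
  simp only [one_div]
  exact tendsto_inv_atTop_zero.comp
    (Real.tendsto_sqrt_atTop.comp (tendsto_natCast_atTop_atTop.comp hN))

lemma tendsto_sampleRate (hN : Tendsto N atTop atTop) (hT : Tendsto T atTop atTop) :
    Tendsto (sampleRate N T) atTop (𝓝 0) := by
  have h := (tendsto_one_div_sqrt hN).add (tendsto_one_div_sqrt hT)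
  rwa [add_zero] at h

lemma sampleRate_nonneg (n : ℕ) : 0 ≤ sampleRate N T n := by
  rw [sampleRate]; positivity

lemma one_div_N_le (n : ℕ) : 1 / (N n : ℝ) ≤ sampleRate N T n ^ 2 := by
  have h : (1 / Real.sqrt (N n)) ^ 2 = 1 / (N n : ℝ) := by
    rw [div_pow, one_pow, Real.sq_sqrt (Nat.cast_nonneg _)]
  rw [← h]
  gcongr
  rw [sampleRate]
  linarith [show (0 : ℝ) ≤ 1 / Real.sqrt (T n) by positivity]

lemma one_div_T_le (n : ℕ) : 1 / (T n : ℝ) ≤ sampleRate N T n ^ 2 := by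
  have h : (1 / Real.sqrt (T n)) ^ 2 = 1 / (T n : ℝ) := by
    rw [div_pow, one_pow, Real.sq_sqrt (Nat.cast_nonneg _)]
  rw [← h]
  gcongr
  rw [sampleRate]
  linarith [show (0 : ℝ) ≤ 1 / Real.sqrt (N n) by positivity]

lemma sampleRate_pos (hN : Tendsto N atTop atTop) : ∀ᶠ n in atTop, 0 < sampleRate N T n := by
  filter_upwards [hN.eventually_gt_atTop 0] with n hn
  have : (0 : ℝ) < N n := by exact_mod_cast hn
  rw [sampleRate]
  positivity

/-- Sample sizes along which the asymptotics are taken, with the share `c` of the shorter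
regime. -/
structure SampleSizes (frac : ℝ) (N T : ℕ → ℕ) (c : ℝ) : Prop where
  hN : Tendsto N atTop atTop
  hT : Tendsto T atTop atTop
  pos : 0 < frac
  lt_one : frac < 1
  c_pos : 0 < c
  len_lower : ∀ᶠ n in atTop, ∀ m, c * T n ≤ len frac (T n) m

lemma SampleSizes.len_pos {frac c : ℝ} (h : SampleSizes frac N T c) (m : Fin 2) :
    ∀ᶠ n in atTop, 0 < len frac (T n) m := by
  filter_upwards [h.len_lower, h.hT.eventually_gt_atTop 0] with n h1 h2
  have h3 : (0 : ℝ) < T n := by exact_mod_cast h2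
  have h4 : (0 : ℝ) < len frac (T n) m := (mul_pos h.c_pos h3).trans_le (h1 m)
  exact_mod_cast h4

lemma SampleSizes.one_div_len_le {frac c : ℝ} (h : SampleSizes frac N T c) (m : Fin 2) :
    ∀ᶠ n in atTop, 1 / (len frac (T n) m : ℝ) ≤ 1 / c * sampleRate N T n ^ 2 := by
  filter_upwards [h.len_lower, h.hT.eventually_gt_atTop 0] with n h1 h2
  have hc := h.c_pos
  have h3 : (0 : ℝ) < T n := by exact_mod_cast h2
  calc 1 / (len frac (T n) m : ℝ) ≤ 1 / (c * T n) := by gcongr; exact h1 m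
    _ = 1 / c * (1 / T n) := by field_simp
    _ ≤ _ := by gcongr; exact one_div_T_le n

end Sample

section Scaled

variable {Ω : Type*} [MeasurableSpace Ω] {r : ℕ} (S : Model Ω r)

namespace Model

/-- The factors of regime `m`, divided by `√T_m`. -/
noncomputable def scF (T : ℕ) (m : Fin 2) (ω : Ω) : Matrix (Fin (len S.frac T m)) (Fin r) ℝ :=
  Matrix.of fun t j => (1 / Real.sqrt (len S.frac T m)) * S.f (offset S.frac T m + t) ω j

/-- The loadings of regime `m`, divided by `√N`. -/
noncomputable def scL (N : ℕ) (m : Fin 2) (ω : Ω) : Matrix (Fin N) (Fin r) ℝ :=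
  Matrix.of fun i j => (1 / Real.sqrt N) * S.lam m i ω j

/-- The errors of regime `m`, divided by `√(N T_m)`. -/
noncomputable def scE (N T : ℕ) (m : Fin 2) (ω : Ω) : Matrix (Fin (len S.frac T m)) (Fin N) ℝ :=
  Matrix.of fun t i => (1 / Real.sqrt (N * len S.frac T m)) * S.e i (offset S.frac T m + t) ω

/-- The sum of the loadings of the units in `I`, divided by `√|I|`. -/
noncomputable def grpL (I : Finset ℕ) (m : Fin 2) (ω : Ω) : Matrix (Fin r) Unit ℝ :=
  Matrix.of fun j _ => (1 / Real.sqrt I.card) * ∑ i ∈ I, S.lam m i ω j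

/-- The sums of the errors of the units in `I`, divided by `√(|I| T_m)`. -/
noncomputable def grpE (I : Finset ℕ) (T : ℕ) (m : Fin 2) (ω : Ω) :
    Matrix (Fin (len S.frac T m)) Unit ℝ :=
  Matrix.of fun t _ => (1 / Real.sqrt (I.card * len S.frac T m)) *
    ∑ i ∈ I, S.e i (offset S.frac T m + t) ω

@[fun_prop]
lemma measurable_f_apply (t : ℕ) (j : Fin r) : Measurable fun ω => S.f t ω j :=
  (EuclideanSpace.proj (𝕜 := ℝ) j).measurable.comp (S.measurable_f t)

@[fun_prop]
lemma measurable_lam_apply (m : Fin 2) (i : ℕ) (j : Fin r) :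
    Measurable fun ω => S.lam m i ω j :=
  (EuclideanSpace.proj (𝕜 := ℝ) j).measurable.comp (S.measurable_lam m i)

@[fun_prop]
lemma measurable_e_apply (i t : ℕ) : Measurable fun ω => S.e i t ω := S.measurable_e i t

/-- The data of a regime follow the factor model of that regime. -/
lemma obs_regime {T : ℕ} (m : Fin 2) (ω : Ω) (i : ℕ) (t : Fin (len S.frac T m)) :
    S.obs T ω i (offset S.frac T m + t) = ∑ j, S.lam m i ω j * S.f (offset S.frac T m + t) ω j +
      S.e i (offset S.frac T m + t) ω := by
  have ht := t.2
  have hin : ∀ x y : EuclideanSpace ℝ (Fin r), inner ℝ x y = ∑ j, x j * y j := fun x y => by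
    simp [PiLp.inner_apply, mul_comm]
  rw [obs]
  fin_cases m
  · simp only [len, offset, Fin.zero_eta, if_true, zero_add] at ht ⊢
    rw [if_pos ht, hin]
  · simp only [len, offset, Fin.mk_one, one_ne_zero, if_false] at ht ⊢
    rw [if_neg (by omega), hin]

lemma smul_dataMatrix {N T : ℕ} (m : Fin 2) (ω : Ω) :
    (1 / Real.sqrt (N * len S.frac T m)) • dataMatrix (S.obs T ω) S.frac N T m =
      S.scF T m ω * (S.scL N m ω)ᵀ + S.scE N T m ω := by
  ext t i
  simp only [Matrix.smul_apply, dataMatrix, Matrix.of_apply, obs_regime, smul_eq_mul,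
    Matrix.add_apply, Matrix.mul_apply, scF, scL, scE, Matrix.transpose_apply, mul_add,
    Finset.mul_sum]
  congr 1
  refine Finset.sum_congr rfl fun j _ => ?_
  rw [Real.sqrt_mul (Nat.cast_nonneg _)]
  simp only [one_div, mul_inv]
  ring

/-- The data of the group `I`, scaled. -/
lemma grp_data {T : ℕ} (I : Finset ℕ) (m : Fin 2) (ω : Ω) (t : Fin (len S.frac T m)) :
    (S.scF T m ω * S.grpL I m ω + S.grpE I T m ω) t () =
      (1 / Real.sqrt (I.card * len S.frac T m)) *
        ∑ i ∈ I, S.obs T ω i (offset S.frac T m + t) := by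
  simp only [obs_regime, Matrix.add_apply, Matrix.mul_apply, scF, grpL, grpE, Matrix.of_apply,
    Finset.sum_add_distrib, mul_add]
  congr 1
  rw [Finset.sum_comm, Finset.mul_sum]
  refine Finset.sum_congr rfl fun j _ => ?_
  rw [← Finset.sum_mul, Real.sqrt_mul (Nat.cast_nonneg _)]
  simp only [one_div, mul_inv]
  ring

end Model

end Scaled

/-! ### Orders of magnitude in the model -/

section Primitives

variable {Ω : Type*} [MeasurableSpace Ω] {μ : Measure Ω} {r : ℕ}
  {S : Model Ω r} {N T : ℕ → ℕ} {c M : ℝ} {SigF : Matrix (Fin r) (Fin r) ℝ}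
  {SigL : Fin 2 → Matrix (Fin r) (Fin r) ℝ} {tau : ℕ → ℕ → ℝ}

lemma norm_sq_euclidean (x : EuclideanSpace ℝ (Fin r)) : ‖x‖ ^ 2 = ∑ j, x j ^ 2 :=
  EuclideanSpace.real_norm_sq_eq x

/-- Used to bound lower moments by higher ones. -/
lemma le_one_add_pow {x : ℝ} (hx : 0 ≤ x) {n : ℕ} (hn : 1 ≤ n) : x ≤ 1 + x ^ n := by
  rcases le_total x 1 with h | h
  · linarith [pow_nonneg hx n]
  · linarith [le_self_pow₀ h (by omega : n ≠ 0)]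

namespace Model

lemma Errors.M_nonneg (h : S.Errors μ M tau) : 0 ≤ M := (abs_nonneg _).trans (h.gam_diag 0 0)

lemma Errors.meanLE_pow_eight (h : S.Errors μ M tau) (i t : ℕ) :
    MeanLE μ (fun ω => S.e i t ω ^ 8) M := by
  refine MeanLE.mono (h.moment i t) (fun ω => ?_) le_rfl
  rw [Even.pow_abs (by decide)]

/-- The serial covariances `γ_N(s, t)` are square summable in `s`, being summable and bounded. -/
lemma ErrorCorr.sum_gam_sq_le (h : S.ErrorCorr μ M tau) (hM : 0 ≤ M) (h1 : S.frac < 1) (N T : ℕ)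
    (m : Fin 2) (t : ℕ) (ht : t < T) :
    ∑ s : Fin (len S.frac T m), S.gam μ N (offset S.frac T m + s) t ^ 2 ≤ M ^ 2 := by
  have hle : ∀ s, s < T → |S.gam μ N s t| ≤ M := fun s hs =>
    (Finset.single_le_sum (f := fun s => |S.gam μ N s t|) (fun _ _ => abs_nonneg _)
      (Finset.mem_range.2 hs)).trans (h.time N T t ht)
  rw [← sum_regime h1 T m fun s => S.gam μ N s t ^ 2]
  calc ∑ s ∈ regime S.frac T m, S.gam μ N s t ^ 2
      ≤ ∑ s ∈ Finset.range T, S.gam μ N s t ^ 2 :=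
        Finset.sum_le_sum_of_subset_of_nonneg (Finset.filter_subset _ _) fun _ _ _ => sq_nonneg _
    _ ≤ ∑ s ∈ Finset.range T, M * |S.gam μ N s t| := by
        refine Finset.sum_le_sum fun s hs => ?_
        rw [← sq_abs, sq]
        gcongr
        exact hle s (Finset.mem_range.1 hs)
    _ = M * ∑ s ∈ Finset.range T, |S.gam μ N s t| := by rw [Finset.mul_sum]
    _ ≤ M * M := by gcongr; exact h.time N T t ht
    _ = M ^ 2 := (sq M).symm

variable [IsProbabilityMeasure μ]

lemma Errors.meanLE_sq (h : S.Errors μ M tau) (i t : ℕ) :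
    MeanLE μ (fun ω => S.e i t ω ^ 2) (1 + M) := by
  refine ((meanLE_const (μ := μ) 1).add (h.meanLE_pow_eight i t) measurable_const zero_le_one
    h.M_nonneg).mono (fun ω => ?_) le_rfl
  have := le_one_add_pow (sq_nonneg (S.e i t ω)) (show 1 ≤ 4 by norm_num)
  rwa [← pow_mul] at this

lemma Errors.meanLE_pow_four (h : S.Errors μ M tau) (i t : ℕ) :
    MeanLE μ (fun ω => S.e i t ω ^ 4) (1 + M) := by
  refine ((meanLE_const (μ := μ) 1).add (h.meanLE_pow_eight i t) measurable_const zero_le_one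
    h.M_nonneg).mono (fun ω => ?_) le_rfl
  have := le_one_add_pow (show 0 ≤ S.e i t ω ^ 4 by positivity) (show 1 ≤ 2 by norm_num)
  rwa [← pow_mul] at this

lemma Errors.integrable_mul (h : S.Errors μ M tau) (i t j s : ℕ) :
    Integrable (fun ω => S.e i t ω * S.e j s ω) μ := by
  have hsq : ∀ i t, Integrable (fun ω => S.e i t ω ^ 2) μ := fun i t => by
    refine ⟨by fun_prop, ?_⟩
    rw [hasFiniteIntegral_iff_ofReal (Eventually.of_forall fun ω => sq_nonneg _)]
    exact (h.meanLE_sq i t).trans_lt ENNReal.ofReal_lt_top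
  refine ((hsq i t).add (hsq j s)).mono' (by fun_prop) (Eventually.of_forall fun ω => ?_)
  rw [Real.norm_eq_abs, abs_mul, Pi.add_apply]
  nlinarith [sq_nonneg (|S.e i t ω| - |S.e j s ω|), sq_abs (S.e i t ω), sq_abs (S.e j s ω)]

lemma norm_scE_sq (N T : ℕ) (m : Fin 2) (ω : Ω) : ‖S.scE N T m ω‖ ^ 2 =
    ∑ t : Fin (len S.frac T m), ∑ i : Fin N,
      1 / (N * len S.frac T m) * S.e i (offset S.frac T m + t) ω ^ 2 := by
  rw [norm_sq_eq_sum]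
  refine Finset.sum_congr rfl fun t _ => Finset.sum_congr rfl fun i _ => ?_
  rw [scE, Matrix.of_apply, mul_pow, div_pow, one_pow, Real.sq_sqrt (by positivity)]

/-- The scaled errors have bounded norm. -/
lemma Errors.typical_noise (h : S.Errors μ M tau) (m : Fin 2) :
    Typical μ fun l => NormBigO l (fun p : ℕ × Ω => S.scE (N p.1) (T p.1) m p.2) fun _ => 1 := by
  refine typical_normBigO (A := fun n => S.scE (N n) (T n) m) (g := fun _ => 1) (c := 1 + M)
    (by linarith [h.M_nonneg]) (fun n => ?_) (Eventually.of_forall fun _ => one_pos)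
    (Eventually.of_forall fun n => ?_)
  · simp only [norm_scE_sq]; fun_prop
  · simp only [norm_scE_sq]
    have h0 : 0 ≤ 1 + M := by linarith [h.M_nonneg]
    refine (MeanLE.sum Finset.univ (fun t _ => by fun_prop) (fun t _ => ?_) fun t _ =>
      MeanLE.sum Finset.univ (fun i _ => by fun_prop) (fun i _ => ?_) fun i _ =>
        (h.meanLE_sq _ _).const_mul (by positivity)).mono (fun ω => le_rfl) ?_
    · exact Finset.sum_nonneg fun _ _ => by positivity
    · positivity
    · simp only [Finset.sum_const, Finset.card_univ, Fintype.card_fin, nsmul_eq_mul, one_pow,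
        mul_one]
      rw [← mul_assoc, ← mul_assoc, one_div, mul_comm (len S.frac (T n) m : ℝ) (N n)]
      refine mul_le_of_le_one_left h0 ?_
      rw [← div_eq_mul_inv]
      exact div_self_le_one _

/-- The sample covariance of the errors of two periods, across units: its mean is `γ_N(s, t)`, and
its variance is of order `1 / N`. -/
lemma Errors.meanLE_cross (h : S.Errors μ M tau) (N s t : ℕ) :
    MeanLE μ (fun ω => ((1 / (N : ℝ)) * ∑ i : Fin N, S.e i s ω * S.e i t ω) ^ 2)
      (2 / N * (1 + M) + 2 * S.gam μ N s t ^ 2) := by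
  have hM := h.M_nonneg
  have hdec : ∀ ω, (1 / (N : ℝ)) * ∑ i : Fin N, S.e i s ω * S.e i t ω =
      1 / Real.sqrt N * ((1 / Real.sqrt N) * ∑ i ∈ Finset.range N, S.centered μ i s i t ω)
        + S.gam μ N s t := fun ω => by
    have e1 : S.gam μ N s t = (1 / (N : ℝ)) * ∑ i ∈ Finset.range N,
        ∫ ω', S.e i s ω' * S.e i t ω' ∂μ := by
      rw [gam, integral_const_mul, integral_finsetSum _ fun i _ => h.integrable_mul i s i t]
    rw [e1, ← mul_assoc, one_div_mul_one_div, Real.mul_self_sqrt (Nat.cast_nonneg _), ← mul_add,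
      ← Finset.sum_add_distrib, Fin.sum_univ_eq_sum_range fun i => S.e i s ω * S.e i t ω]
    simp [centered]
  have hc : MeanLE μ (fun ω =>
      ((1 / Real.sqrt N) * ∑ i ∈ Finset.range N, S.centered μ i s i t ω) ^ 2) (1 + M) := by
    refine ((meanLE_const (μ := μ) 1).add (h.fourth N t s) measurable_const zero_le_one
      hM).mono (fun ω => ?_) le_rfl
    have := le_one_add_pow (sq_nonneg ((1 / Real.sqrt N) *
      ∑ i ∈ Finset.range N, S.centered μ i s i t ω)) (show 1 ≤ 2 by norm_num)
    rw [← pow_mul] at this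
    rwa [Even.pow_abs (by decide)]
  refine ((hc.const_mul (show (0 : ℝ) ≤ 2 / N by positivity)).add
    (meanLE_const (2 * S.gam μ N s t ^ 2)) ?_ (by positivity) (by positivity)).mono
    (fun ω => ?_) le_rfl
  · simp only [centered]; fun_prop
  · rw [hdec]
    generalize (1 / Real.sqrt N) * ∑ i ∈ Finset.range N, S.centered μ i s i t ω = x
    have e2 : (1 / Real.sqrt N) ^ 2 = 1 / (N : ℝ) := by
      rw [div_pow, one_pow, Real.sq_sqrt (Nat.cast_nonneg _)]
    have e3 : 2 / (N : ℝ) * x ^ 2 = 2 * (1 / Real.sqrt N * x) ^ 2 := by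
      rw [mul_pow, e2]; ring
    rw [e3]
    nlinarith [sq_nonneg (1 / Real.sqrt N * x - S.gam μ N s t)]

lemma norm_scE_gram_sq (N T : ℕ) (m : Fin 2) (ω : Ω) :
    ‖S.scE N T m ω * (S.scE N T m ω)ᵀ‖ ^ 2 =
    ∑ t : Fin (len S.frac T m), ∑ s : Fin (len S.frac T m), (1 / (len S.frac T m : ℝ)) ^ 2 *
      ((1 / (N : ℝ)) * ∑ i : Fin N, S.e i (offset S.frac T m + t) ω *
        S.e i (offset S.frac T m + s) ω) ^ 2 := by
  rw [norm_sq_eq_sum]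
  refine Finset.sum_congr rfl fun t _ => Finset.sum_congr rfl fun s _ => ?_
  rw [← mul_pow, Matrix.mul_apply, ← mul_assoc, one_div_mul_one_div, Finset.mul_sum]
  congr 1
  refine Finset.sum_congr rfl fun i _ => ?_
  simp only [scE, Matrix.transpose_apply, Matrix.of_apply]
  rw [mul_mul_mul_comm, one_div_mul_one_div, Real.mul_self_sqrt (by positivity), mul_comm (N : ℝ)]

/-- `‖E Eᵀ‖² = O(1 / N + 1 / T)`: averaged over all pairs of periods, the squared covariances
`γ_N(s, t) ^ 2` are of order `1 / T`. -/
lemma Errors.typical_noiseGram (h : S.Errors μ M tau) (hc : S.ErrorCorr μ M tau)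
    (hs : SampleSizes S.frac N T c) (m : Fin 2) :
    Typical μ fun l => NormBigO l (fun p : ℕ × Ω => S.scE (N p.1) (T p.1) m p.2 *
      (S.scE (N p.1) (T p.1) m p.2)ᵀ) fun p => sampleRate N T p.1 := by
  have hM := h.M_nonneg
  have hcp := hs.c_pos
  refine typical_normBigO (A := fun n ω => S.scE (N n) (T n) m ω * (S.scE (N n) (T n) m ω)ᵀ)
    (g := sampleRate N T) (c := 2 * (1 + M) + 2 * M ^ 2 * (1 / c)) (by positivity) (fun n => ?_)
    (sampleRate_pos hs.hN) ?_
  · simp only [norm_scE_gram_sq]; fun_prop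
  filter_upwards [hs.one_div_len_le m, hs.len_pos m] with n hn hlen
  simp only [norm_scE_gram_sq]
  set L := len S.frac (T n) m with hL
  have hL0 : (0 : ℝ) < L := by exact_mod_cast hlen
  refine (MeanLE.sum Finset.univ (fun t _ => by fun_prop) (fun t _ => ?_) fun t _ =>
    MeanLE.sum Finset.univ (fun s _ => by fun_prop) (fun s _ => ?_) fun s _ =>
      (h.meanLE_cross _ _ _).const_mul (by positivity)).mono (fun ω => le_rfl) ?_
  · exact Finset.sum_nonneg fun _ _ => by positivity
  · positivity
  · calc ∑ t : Fin L, ∑ s : Fin L, (1 / (L : ℝ)) ^ 2 * (2 / (N n) * (1 + M) +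
          2 * S.gam μ (N n) (offset S.frac (T n) m + t) (offset S.frac (T n) m + s) ^ 2)
        = 2 * (1 + M) * (1 / (N n)) + 2 * (1 / (L : ℝ)) ^ 2 * ∑ s : Fin L, ∑ t : Fin L,
          S.gam μ (N n) (offset S.frac (T n) m + t) (offset S.frac (T n) m + s) ^ 2 := by
          rw [Finset.sum_comm (f := fun s t : Fin L => S.gam μ (N n) (offset S.frac (T n) m + t)
            (offset S.frac (T n) m + s) ^ 2)]
          simp only [mul_add, Finset.sum_add_distrib, ← Finset.mul_sum, Finset.sum_const,
            Finset.card_univ, Fintype.card_fin, nsmul_eq_mul]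
          field_simp
      _ ≤ 2 * (1 + M) * (1 / (N n)) + 2 * (1 / (L : ℝ)) ^ 2 * ∑ s : Fin L, M ^ 2 := by
          gcongr with s
          exact hc.sum_gam_sq_le hM hs.lt_one _ _ _ _ (offset_add_lt hs.lt_one s)
      _ = 2 * (1 + M) * (1 / (N n)) + 2 * M ^ 2 * (1 / (L : ℝ)) := by
          simp only [Finset.sum_const, Finset.card_univ, Fintype.card_fin, nsmul_eq_mul]
          field_simp
      _ ≤ 2 * (1 + M) * sampleRate N T n ^ 2 + 2 * M ^ 2 * (1 / c * sampleRate N T n ^ 2) := by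
          gcongr
          exact one_div_N_le n
      _ = _ := by ring

end Model

end Primitives

/-! ### Orders of magnitude in the two regimes -/

section RegimePrimitives

variable {Ω : Type*} [MeasurableSpace Ω] {μ : Measure Ω} {r : ℕ}
  {S : Model Ω r} {N T : ℕ → ℕ} {c M : ℝ} {SigF : Matrix (Fin r) (Fin r) ℝ}
  {SigL : Fin 2 → Matrix (Fin r) (Fin r) ℝ} {tau : ℕ → ℕ → ℝ}

namespace Model

lemma norm_scE_mul_scL_sq (N T : ℕ) (m : Fin 2) (ω : Ω) :
    ‖S.scE N T m ω * S.scL N m ω‖ ^ 2 =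
    ∑ t : Fin (len S.frac T m), 1 / (N * len S.frac T m) * |‖(1 / Real.sqrt N) •
      ∑ i ∈ Finset.range N, S.e i (offset S.frac T m + t) ω • S.lam m i ω‖| ^ 2 := by
  rw [norm_sq_eq_sum]
  refine Finset.sum_congr rfl fun t _ => ?_
  rw [abs_norm, norm_sq_euclidean, Finset.mul_sum]
  refine Finset.sum_congr rfl fun j _ => ?_
  have e1 : (S.scE N T m ω * S.scL N m ω) t j = 1 / Real.sqrt (N * len S.frac T m) *
      ((1 / Real.sqrt N) • ∑ i ∈ Finset.range N,
        S.e i (offset S.frac T m + t) ω • S.lam m i ω) j := by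
    simp only [Matrix.mul_apply, scE, scL, Matrix.of_apply, PiLp.smul_apply, WithLp.ofLp_sum,
      Finset.sum_apply, WithLp.ofLp_smul, Pi.smul_apply, smul_eq_mul, Finset.mul_sum]
    rw [← Fin.sum_univ_eq_sum_range fun i => 1 / Real.sqrt (N * len S.frac T m) *
      (1 / Real.sqrt N * (S.e i (offset S.frac T m + t) ω * S.lam m i ω j))]
    exact Finset.sum_congr rfl fun i _ => by ring
  rw [e1, mul_pow, div_pow, one_pow, Real.sq_sqrt (by positivity)]

lemma norm_scE_transpose_mul_scF_sq (h1 : S.frac < 1) (N T : ℕ) (m : Fin 2) (ω : Ω) :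
    ‖(S.scE N T m ω)ᵀ * S.scF T m ω‖ ^ 2 =
    ∑ i : Fin N, 1 / (N * len S.frac T m) * ‖(1 / Real.sqrt (len S.frac T m)) •
      ∑ t ∈ regime S.frac T m, S.e i t ω • S.f t ω‖ ^ 2 := by
  rw [norm_sq_eq_sum]
  refine Finset.sum_congr rfl fun i _ => ?_
  rw [norm_sq_euclidean, Finset.mul_sum]
  refine Finset.sum_congr rfl fun j _ => ?_
  have e1 : ((S.scE N T m ω)ᵀ * S.scF T m ω) i j = 1 / Real.sqrt (N * len S.frac T m) *
      ((1 / Real.sqrt (len S.frac T m)) •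
        ∑ t ∈ regime S.frac T m, S.e i t ω • S.f t ω) j := by
    rw [sum_regime h1]
    simp only [Matrix.mul_apply, scE, scF, Matrix.transpose_apply, Matrix.of_apply,
      PiLp.smul_apply, WithLp.ofLp_sum, Finset.sum_apply, WithLp.ofLp_smul, Pi.smul_apply,
      smul_eq_mul, Finset.mul_sum]
    exact Finset.sum_congr rfl fun t _ => by ring
  rw [e1, mul_pow, div_pow, one_pow, Real.sq_sqrt (by positivity)]

lemma measurable_norm_sum_smul {ι : Type*} (s : Finset ι) (a : ℝ) {u : ι → Ω → ℝ}
    {v : ι → Ω → EuclideanSpace ℝ (Fin r)} (hu : ∀ i, Measurable (u i))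
    (hv : ∀ i, Measurable (v i)) : Measurable fun ω => ‖a • ∑ i ∈ s, u i ω • v i ω‖ :=
  ((Finset.measurable_fun_sum s fun i _ => (hu i).smul (hv i)).const_smul a).norm

/-- `‖E Λ‖ = O(N ^ (-1/2))`. -/
lemma PooledMoments.typical_noiseLoading (h : S.PooledMoments μ M) (hM : 0 ≤ M)
    (hs : SampleSizes S.frac N T c) (m : Fin 2) :
    Typical μ fun l => NormBigO l (fun p : ℕ × Ω => S.scE (N p.1) (T p.1) m p.2 *
      S.scL (N p.1) m p.2) fun p => sampleRate N T p.1 := by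
  have hmeas : ∀ N t : ℕ, Measurable fun ω => |‖(1 / Real.sqrt N) •
      ∑ i ∈ Finset.range N, S.e i t ω • S.lam m i ω‖| := fun N t => by
    simp only [abs_norm]
    exact measurable_norm_sum_smul _ _ (fun i => S.measurable_e i t) fun i => S.measurable_lam m i
  refine typical_normBigO (A := fun n ω => S.scE (N n) (T n) m ω * S.scL (N n) m ω)
    (g := sampleRate N T) (c := M) hM (fun n => ?_) (sampleRate_pos hs.hN) ?_
  · simp only [norm_scE_mul_scL_sq]
    exact Finset.measurable_fun_sum _ fun t _ => ((hmeas _ _).pow_const 2).const_mul _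
  filter_upwards [hs.len_pos m] with n hlen
  have hL0 : (0 : ℝ) < len S.frac (T n) m := by exact_mod_cast hlen
  simp only [norm_scE_mul_scL_sq]
  refine (MeanLE.sum Finset.univ (fun t _ => ((hmeas _ _).pow_const 2).const_mul _)
    (fun t _ => ?_) fun t _ => MeanLE.const_mul (h.b m _ _) (by positivity)).mono
    (fun ω => le_rfl) ?_
  · positivity
  · simp only [Finset.sum_const, Finset.card_univ, Fintype.card_fin, nsmul_eq_mul]
    calc _ = M * (1 / N n) := by field_simp
      _ ≤ _ := by gcongr; exact one_div_N_le n

/-- `‖Eᵀ F‖ = O(T ^ (-1/2))`. -/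
lemma PooledMoments.typical_factorNoise [IsProbabilityMeasure μ] (h : S.PooledMoments μ M)
    (hM : 0 ≤ M) (hs : SampleSizes S.frac N T c) (m : Fin 2) :
    Typical μ fun l => NormBigO l (fun p : ℕ × Ω => (S.scE (N p.1) (T p.1) m p.2)ᵀ *
      S.scF (T p.1) m p.2) fun p => sampleRate N T p.1 := by
  have hcp := hs.c_pos
  have hmeas : ∀ T i : ℕ, Measurable fun ω => ‖(1 / Real.sqrt (len S.frac T m)) •
      ∑ t ∈ regime S.frac T m, S.e i t ω • S.f t ω‖ := fun T i =>
    measurable_norm_sum_smul _ _ (fun t => S.measurable_e i t) fun t => S.measurable_f t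
  have hmom : ∀ T i : ℕ, MeanLE μ (fun ω => ‖(1 / Real.sqrt (len S.frac T m)) •
      ∑ t ∈ regime S.frac T m, S.e i t ω • S.f t ω‖ ^ 2) (1 + M) := fun T i => by
    refine ((meanLE_const (μ := μ) 1).add (h.c m T i) measurable_const zero_le_one
      hM).mono (fun ω => ?_) le_rfl
    rw [abs_norm]
    have := le_one_add_pow (sq_nonneg ‖(1 / Real.sqrt (len S.frac T m)) •
      ∑ t ∈ regime S.frac T m, S.e i t ω • S.f t ω‖) (show 1 ≤ 2 by norm_num)
    rwa [← pow_mul] at this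
  refine typical_normBigO (A := fun n ω => (S.scE (N n) (T n) m ω)ᵀ * S.scF (T n) m ω)
    (g := sampleRate N T) (c := (1 + M) * (1 / c)) (by positivity) (fun n => ?_)
    (sampleRate_pos hs.hN) ?_
  · simp only [norm_scE_transpose_mul_scF_sq hs.lt_one]
    exact Finset.measurable_fun_sum _ fun t _ => ((hmeas _ _).pow_const 2).const_mul _
  filter_upwards [hs.one_div_len_le m, hs.hN.eventually_gt_atTop 0] with n hn hNn
  have hN0 : (0 : ℝ) < N n := by exact_mod_cast hNn
  simp only [norm_scE_transpose_mul_scF_sq hs.lt_one]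
  refine (MeanLE.sum Finset.univ (fun t _ => ((hmeas _ _).pow_const 2).const_mul _)
    (fun t _ => ?_) fun t _ => MeanLE.const_mul (hmom _ _) (by positivity)).mono
    (fun ω => le_rfl) ?_
  · positivity
  · simp only [Finset.sum_const, Finset.card_univ, Fintype.card_fin, nsmul_eq_mul]
    calc _ = (1 + M) * (1 / (len S.frac (T n) m : ℝ)) := by
          rw [one_div_mul_eq_div, mul_div_assoc', mul_div_mul_left _ _ hN0.ne']; ring
      _ ≤ (1 + M) * (1 / c * sampleRate N T n ^ 2) := by gcongr
      _ = _ := by ring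

lemma scF_gram (h1 : S.frac < 1) (T : ℕ) (m : Fin 2) (ω : Ω) :
    (S.scF T m ω)ᵀ * S.scF T m ω =
      (1 / (len S.frac T m : ℝ)) • ∑ t ∈ regime S.frac T m, outer (S.f t ω) (S.f t ω) := by
  rw [sum_regime h1 T m fun t => outer (S.f t ω) (S.f t ω)]
  ext i j
  simp only [Matrix.mul_apply, Matrix.transpose_apply, scF, Matrix.of_apply, Matrix.smul_apply,
    Matrix.sum_apply, outer, Matrix.vecMulVec_apply, smul_eq_mul, Finset.mul_sum]
  refine Finset.sum_congr rfl fun t _ => ?_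
  rw [mul_mul_mul_comm, one_div_mul_one_div, Real.mul_self_sqrt (Nat.cast_nonneg _)]

lemma card_regime {frac : ℝ} (h1 : frac < 1) (T : ℕ) (m : Fin 2) :
    (regime frac T m).card = len frac T m := by
  have := sum_regime h1 T m fun _ => (1 : ℕ)
  simpa using this

lemma BreakFraction.typical_factor (h : S.BreakFraction μ SigF N T)
    (hs : SampleSizes S.frac N T c) (m : Fin 2) :
    Typical μ fun l => Tendsto (fun p : ℕ × Ω =>
      ‖(S.scF (T p.1) m p.2)ᵀ * S.scF (T p.1) m p.2 - SigF‖) l (𝓝 0) := by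
  refine ((h.second m).comp hs.hT).typical.mono fun l hl hO => ?_
  have hlim : Tendsto (fun p : ℕ × Ω => 1 / Real.sqrt (T p.1)) l (𝓝 0) :=
    (tendsto_one_div_sqrt hs.hT).comp (tendsto_comap.mono_left hl)
  have h2 := (IsBigO.mul (isBigO_refl (fun p : ℕ × Ω => 1 / Real.sqrt (T p.1)) l) hO)
  refine Tendsto.congr' ?_ (h2.trans_tendsto (by simpa using hlim))
  filter_upwards [hl ((hs.len_pos m).comap Prod.fst),
    hl ((hs.hT.eventually_gt_atTop 0).comap Prod.fst)] with p hlen hTp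
  have hL0 : (0 : ℝ) < len S.frac (T p.1) m := by exact_mod_cast hlen
  have hT0 : (0 : ℝ) < T p.1 := by exact_mod_cast hTp
  have e : (S.scF (T p.1) m p.2)ᵀ * S.scF (T p.1) m p.2 - SigF = (1 / Real.sqrt (T p.1)) •
      ((Real.sqrt (T p.1) / (len S.frac (T p.1) m : ℝ)) • ∑ t ∈ regime S.frac (T p.1) m,
        (outer (S.f t p.2) (S.f t p.2) - SigF)) := by
    have hsq : Real.sqrt (T p.1) ≠ 0 := by positivity
    rw [scF_gram hs.lt_one, smul_smul, Finset.sum_sub_distrib, Finset.sum_const, smul_sub,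
      card_regime hs.lt_one, ← Nat.cast_smul_eq_nsmul ℝ, smul_smul]
    have e1 : 1 / Real.sqrt (T p.1) * (Real.sqrt (T p.1) / (len S.frac (T p.1) m : ℝ))
        = 1 / (len S.frac (T p.1) m : ℝ) := by field_simp
    rw [e1, one_div_mul_cancel hL0.ne', one_smul]
  rw [e, norm_smul (1 / Real.sqrt (T p.1)), Real.norm_of_nonneg (by positivity)]

lemma scL_gram (N : ℕ) (m : Fin 2) (ω : Ω) :
    (S.scL N m ω)ᵀ * S.scL N m ω = S.loadingGram m N ω := by
  ext i j
  rw [loadingGram, ← Fin.sum_univ_eq_sum_range fun i => outer (S.lam m i ω) (S.lam m i ω)]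
  simp only [Matrix.mul_apply, Matrix.transpose_apply, scL, Matrix.of_apply, Matrix.smul_apply,
    Matrix.sum_apply, outer, Matrix.vecMulVec_apply, smul_eq_mul, Finset.mul_sum]
  refine Finset.sum_congr rfl fun t _ => ?_
  rw [mul_mul_mul_comm, one_div_mul_one_div, Real.mul_self_sqrt (Nat.cast_nonneg _)]

lemma Loadings.typical_loading (h : S.Loadings μ M SigL) (hN : Tendsto N atTop atTop) (m : Fin 2) :
    Typical μ fun l => Tendsto (fun p : ℕ × Ω =>
      ‖(S.scL (N p.1) m p.2)ᵀ * S.scL (N p.1) m p.2 - SigL m‖) l (𝓝 0) := by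
  refine ((h.rate m).comp hN).typical.mono fun l hl hO => ?_
  have hlim : Tendsto (fun p : ℕ × Ω => 1 / Real.sqrt (N p.1)) l (𝓝 0) :=
    (tendsto_one_div_sqrt hN).comp (tendsto_comap.mono_left hl)
  have h2 := (IsBigO.mul (isBigO_refl (fun p : ℕ × Ω => 1 / Real.sqrt (N p.1)) l) hO)
  refine Tendsto.congr' ?_ (h2.trans_tendsto (by simpa using hlim))
  filter_upwards [hl ((hN.eventually_gt_atTop 0).comap Prod.fst)] with p hNp
  have hN0 : (0 : ℝ) < N p.1 := by exact_mod_cast hNp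
  rw [scL_gram, ← mul_assoc, one_div_mul_cancel (by positivity), one_mul]

lemma w_apply (i : ℕ) (ω : Ω) (j : Fin r) :
    S.w i ω j = S.lam 1 i ω j - ∑ k, S.Z k j * S.lam 0 i ω k := by
  simp [w, Matrix.mulVec, dotProduct]

lemma scL_shift (N : ℕ) (ω : Ω) :
    (S.scL N 0 ω)ᵀ * (S.scL N 1 ω - S.scL N 0 ω * S.Z) =
      (1 / (N : ℝ)) • ∑ i ∈ Finset.range N, outer (S.lam 0 i ω) (S.w i ω) := by
  ext j k
  rw [← Fin.sum_univ_eq_sum_range fun i => outer (S.lam 0 i ω) (S.w i ω)]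
  simp only [Matrix.mul_apply, Matrix.transpose_apply, Matrix.sub_apply, scL, Matrix.of_apply,
    Matrix.smul_apply, Matrix.sum_apply, outer, Matrix.vecMulVec_apply, smul_eq_mul,
    Finset.mul_sum, w_apply]
  refine Finset.sum_congr rfl fun i _ => ?_
  have e1 : ∑ a, 1 / Real.sqrt N * S.lam 0 i ω a * S.Z a k
      = 1 / Real.sqrt N * ∑ a, S.Z a k * S.lam 0 i ω a := by
    rw [Finset.mul_sum]
    exact Finset.sum_congr rfl fun a _ => by ring
  have e2 : (1 : ℝ) / N = 1 / Real.sqrt N * (1 / Real.sqrt N) := by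
    rw [one_div_mul_one_div, Real.mul_self_sqrt (Nat.cast_nonneg _)]
  rw [e1, e2]
  ring

/-- The loadings before the break are asymptotically orthogonal to the shift; `Λ₁ᵀ W = O_p(1)` even
gives the order `1 / N`, as both factors are scaled by `N ^ (-1/2)`. -/
lemma Loadings.typical_shift (h : S.Loadings μ M SigL) (hs : SampleSizes S.frac N T c) :
    Typical μ fun l => NormBigO l (fun p : ℕ × Ω => (S.scL (N p.1) 0 p.2)ᵀ *
      (S.scL (N p.1) 1 p.2 - S.scL (N p.1) 0 p.2 * S.Z)) fun p => sampleRate N T p.1 := by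
  refine (h.orthogonal.comp hs.hN).typical.mono fun l hl hO => ?_
  have h1 : (fun p : ℕ × Ω => 1 / (N p.1 : ℝ)) =O[l] fun p => sampleRate N T p.1 := by
    refine IsBigO.of_bound 1 ?_
    have hlt := (tendsto_sampleRate hs.hN hs.hT).eventually (gt_mem_nhds one_pos)
    filter_upwards [hl (hlt.comap Prod.fst)] with p hp
    have h0 := sampleRate_nonneg (N := N) (T := T) p.1
    rw [Real.norm_of_nonneg (by positivity), Real.norm_of_nonneg h0, one_mul]
    exact (one_div_N_le p.1).trans (by nlinarith)
  have h2 := IsBigO.mul h1 hO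
  simp only [mul_one] at h2
  refine IsBigO.congr_left h2 fun p => ?_
  beta_reduce
  rw [scL_shift, norm_smul, Real.norm_of_nonneg (by positivity)]

end Model

end RegimePrimitives

/-! ### Orders of magnitude for groups of units -/

section GroupPrimitives

variable {Ω : Type*} [MeasurableSpace Ω] {μ : Measure Ω} {r : ℕ}
  {S : Model Ω r} {N T : ℕ → ℕ} {c M : ℝ} {SigF : Matrix (Fin r) (Fin r) ℝ}
  {SigL : Fin 2 → Matrix (Fin r) (Fin r) ℝ} {tau : ℕ → ℕ → ℝ} {I : ℕ → Finset ℕ} {C : ℝ}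

namespace Model

lemma norm_grpE_sq (I : Finset ℕ) (T : ℕ) (m : Fin 2) (ω : Ω) :
    ‖S.grpE I T m ω‖ ^ 2 = ∑ t : Fin (len S.frac T m), 1 / (len S.frac T m : ℝ) *
      ((1 / Real.sqrt I.card) * ∑ i ∈ I, S.e i (offset S.frac T m + t) ω) ^ 2 := by
  rw [norm_sq_eq_sum]
  refine Finset.sum_congr rfl fun t _ => ?_
  simp only [Finset.univ_unique, Finset.sum_singleton, grpE, Matrix.of_apply, mul_pow, div_pow,
    one_pow, Real.sq_sqrt (show (0 : ℝ) ≤ I.card * len S.frac T m by positivity),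
    Real.sq_sqrt (Nat.cast_nonneg (α := ℝ) I.card)]
  rw [← mul_assoc, one_div_mul_one_div, mul_comm (I.card : ℝ)]

lemma typical_grpE (hs : SampleSizes S.frac N T c) (hC : 0 ≤ C) (m : Fin 2)
    (h : ∀ n t, MeanLE μ (fun ω => ((1 / Real.sqrt (I n).card) * ∑ i ∈ I n, S.e i t ω) ^ 2) C) :
    Typical μ fun l => NormBigO l (fun p : ℕ × Ω => S.grpE (I p.1) (T p.1) m p.2)
      fun _ => 1 := by
  refine typical_normBigO (A := fun n => S.grpE (I n) (T n) m) (g := fun _ => 1) (c := C)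
    hC (fun n => ?_) (Eventually.of_forall fun _ => one_pos) ?_
  · simp only [norm_grpE_sq]; fun_prop
  filter_upwards [hs.len_pos m] with n hlen
  have hL0 : (0 : ℝ) < len S.frac (T n) m := by exact_mod_cast hlen
  simp only [norm_grpE_sq]
  refine (MeanLE.sum Finset.univ (fun t _ => by fun_prop) (fun t _ => ?_) fun t _ =>
    (h n _).const_mul (by positivity)).mono (fun ω => le_rfl) ?_
  · positivity
  · simp only [Finset.sum_const, Finset.card_univ, Fintype.card_fin, nsmul_eq_mul]
    exact le_of_eq (by field_simp)

lemma norm_scF_transpose_mul_grpE_sq (h1 : S.frac < 1) (I : Finset ℕ) (T : ℕ) (m : Fin 2)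
    (ω : Ω) : ‖(S.scF T m ω)ᵀ * S.grpE I T m ω‖ ^ 2 = 1 / (len S.frac T m : ℝ) *
      ‖(1 / Real.sqrt ((I.card : ℝ) * len S.frac T m)) •
        ∑ t ∈ regime S.frac T m, ∑ i ∈ I, S.e i t ω • S.f t ω‖ ^ 2 := by
  rw [norm_sq_eq_sum, norm_sq_euclidean, Finset.mul_sum]
  refine Finset.sum_congr rfl fun j _ => ?_
  have e1 : ((S.scF T m ω)ᵀ * S.grpE I T m ω) j () = 1 / Real.sqrt (len S.frac T m) *
      ((1 / Real.sqrt ((I.card : ℝ) * len S.frac T m)) •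
        ∑ t ∈ regime S.frac T m, ∑ i ∈ I, S.e i t ω • S.f t ω) j := by
    rw [sum_regime h1 T m fun t => ∑ i ∈ I, S.e i t ω • S.f t ω]
    simp only [Matrix.mul_apply, grpE, scF, Matrix.transpose_apply, Matrix.of_apply,
      PiLp.smul_apply, WithLp.ofLp_sum, Finset.sum_apply, WithLp.ofLp_smul, Pi.smul_apply,
      smul_eq_mul, Finset.mul_sum]
    exact Finset.sum_congr rfl fun t _ => Finset.sum_congr rfl fun i _ => by ring
  simp only [Finset.univ_unique, Finset.sum_singleton, PUnit.default_eq_unit]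
  rw [e1, mul_pow, div_pow, one_pow, Real.sq_sqrt (Nat.cast_nonneg _)]

lemma typical_scF_grpE (hs : SampleSizes S.frac N T c) (hC : 0 ≤ C) (m : Fin 2)
    (h : ∀ n, MeanLE μ (fun ω => ‖(1 / Real.sqrt (((I n).card : ℝ) * len S.frac (T n) m)) •
        ∑ t ∈ regime S.frac (T n) m, ∑ i ∈ I n, S.e i t ω • S.f t ω‖ ^ 2) C) :
    Typical μ fun l => NormBigO l (fun p : ℕ × Ω =>
      (S.scF (T p.1) m p.2)ᵀ * S.grpE (I p.1) (T p.1) m p.2) fun p => sampleRate N T p.1 := by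
  have hcp := hs.c_pos
  refine typical_normBigO (A := fun n ω => (S.scF (T n) m ω)ᵀ * S.grpE (I n) (T n) m ω)
    (g := sampleRate N T) (c := C * (1 / c)) (by positivity) (fun n => ?_) (sampleRate_pos hs.hN) ?_
  · simp only [norm_sq_eq_sum, Matrix.mul_apply, Matrix.transpose_apply, scF, grpE,
      Matrix.of_apply]
    fun_prop
  filter_upwards [hs.one_div_len_le m] with n hn
  simp only [norm_scF_transpose_mul_grpE_sq hs.lt_one]
  refine ((h n).const_mul (by positivity)).mono (fun ω => le_rfl) ?_
  calc _ ≤ (1 / c * sampleRate N T n ^ 2) * C := by gcongr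
    _ = _ := by ring

/-! ### Moments of the data -/

lemma Independence.lam_f (h : S.Independence μ) (m : Fin 2) (i t : ℕ) :
    IndepFun (S.lam m i) (S.f t) μ := by
  rw [IndepFun_iff_Indep]
  have h01 := (h m).indep (i := 0) (j := 1) (by decide)
  simp only [Matrix.cons_val_zero, Matrix.cons_val_one] at h01
  exact indep_of_indep_of_le_left (indep_of_indep_of_le_right h01
    (le_iSup (fun t => MeasurableSpace.comap (S.f t) inferInstance) t))
    (le_iSup (fun i => MeasurableSpace.comap (S.lam m i) inferInstance) i)

lemma Independence.f_e (h : S.Independence μ) (i t : ℕ) :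
    IndepFun (S.f t) (S.e i t) μ := by
  rw [IndepFun_iff_Indep]
  have h12 := (h 0).indep (i := 1) (j := 2) (by decide)
  simp only [Matrix.cons_val_one, Matrix.cons_val] at h12
  exact indep_of_indep_of_le_left (indep_of_indep_of_le_right h12
    (le_iSup₂ (f := fun i t => MeasurableSpace.comap (S.e i t) inferInstance) i t))
    (le_iSup (fun t => MeasurableSpace.comap (S.f t) inferInstance) t)

end Model

lemma MeanLE.mul_of_indepFun {β γ : Type*} [MeasurableSpace β] [MeasurableSpace γ] {X : Ω → β}
    {Y : Ω → γ} (hXY : IndepFun X Y μ) (hX : Measurable X) (hY : Measurable Y) {g : β → ℝ}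
    {h : γ → ℝ} (hg : Measurable g) (hh : Measurable h) (hg0 : ∀ x, 0 ≤ g x) {c c' : ℝ}
    (hc : 0 ≤ c) (h1 : MeanLE μ (fun ω => g (X ω)) c) (h2 : MeanLE μ (fun ω => h (Y ω)) c') :
    MeanLE μ (fun ω => g (X ω) * h (Y ω)) (c * c') := by
  have e := lintegral_mul_eq_lintegral_mul_lintegral_of_indepFun
    (hg.comp hX).ennreal_ofReal (hh.comp hY).ennreal_ofReal
    (hXY.comp hg.ennreal_ofReal hh.ennreal_ofReal)
  rw [MeanLE, ENNReal.ofReal_mul hc]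
  simp only [ENNReal.ofReal_mul (hg0 _)]
  exact e.trans_le (mul_le_mul' h1 h2)

namespace Model

variable [IsProbabilityMeasure μ]

lemma meanLE_obs_pow_four (hf : S.Factors μ M SigF) (hl : S.Loadings μ M SigL)
    (he : S.Errors μ M tau) (hi : S.Independence μ) (T : ℕ) (m : Fin 2) (i : ℕ)
    (t : Fin (len S.frac T m)) :
    MeanLE μ (fun ω => S.obs T ω i (offset S.frac T m + t) ^ 4) (8 * (M * M) + 8 * (1 + M)) := by
  have hM := he.M_nonneg
  set s := offset S.frac T m + t with hs
  have h1 : MeanLE μ (fun ω => ‖S.lam m i ω‖ ^ 4 * ‖S.f s ω‖ ^ 4) (M * M) := by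
    refine MeanLE.mul_of_indepFun (hi.lam_f m i s) (S.measurable_lam m i) (S.measurable_f s)
      (g := fun x => ‖x‖ ^ 4) (h := fun x => ‖x‖ ^ 4) (by fun_prop) (by fun_prop)
      (fun x => by positivity) hM ?_ ?_
    · simpa only [MomentLE, MeanLE, abs_norm] using hl.moment m i
    · simpa only [MomentLE, MeanLE, abs_norm] using hf.moment s
  have hm1 : Measurable fun ω => 8 * (‖S.lam m i ω‖ ^ 4 * ‖S.f s ω‖ ^ 4) :=
    (((S.measurable_lam m i).norm.pow_const 4).mul
      ((S.measurable_f s).norm.pow_const 4)).const_mul 8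
  refine ((h1.const_mul (show (0 : ℝ) ≤ 8 by norm_num)).add
    ((he.meanLE_pow_four i s).const_mul (show (0 : ℝ) ≤ 8 by norm_num)) hm1 (by positivity)
    (by positivity)).mono (fun ω => ?_) le_rfl
  rw [obs_regime]
  set a := ∑ j, S.lam m i ω j * S.f s ω j with ha
  have h2 : a ^ 2 ≤ ‖S.lam m i ω‖ ^ 2 * ‖S.f s ω‖ ^ 2 := by
    rw [norm_sq_euclidean, norm_sq_euclidean]
    exact Finset.sum_mul_sq_le_sq_mul_sq _ _ _
  have h3 : a ^ 4 ≤ ‖S.lam m i ω‖ ^ 4 * ‖S.f s ω‖ ^ 4 := by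
    calc a ^ 4 = (a ^ 2) ^ 2 := by ring
      _ ≤ (‖S.lam m i ω‖ ^ 2 * ‖S.f s ω‖ ^ 2) ^ 2 := by gcongr
      _ = _ := by ring
  have h4 : (a + S.e i s ω) ^ 4 ≤ 8 * a ^ 4 + 8 * S.e i s ω ^ 4 := by
    nlinarith [sq_nonneg (a - S.e i s ω), sq_nonneg (a + S.e i s ω),
      sq_nonneg (a ^ 2 - S.e i s ω ^ 2), sq_nonneg ((a - S.e i s ω) ^ 2)]
  linarith

lemma measurable_obs (T : ℕ) (m : Fin 2) (i : ℕ) (t : Fin (len S.frac T m)) :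
    Measurable fun ω => S.obs T ω i (offset S.frac T m + t) := by
  simp only [obs_regime]
  fun_prop

/-- The fourth moment of the data of the units in `I` in regime `m`. -/
noncomputable def fourthMoment (S : Model Ω r) (I : Finset ℕ) (T : ℕ) (m : Fin 2) (ω : Ω) : ℝ :=
  (1 / (len S.frac T m : ℝ)) * ∑ t : Fin (len S.frac T m),
    (1 / (I.card : ℝ)) * ∑ i ∈ I, S.obs T ω i (offset S.frac T m + t) ^ 4

lemma typical_fourthMoment (hf : S.Factors μ M SigF) (hl : S.Loadings μ M SigL)
    (he : S.Errors μ M tau) (hi : S.Independence μ) (T : ℕ → ℕ) (I : ℕ → Finset ℕ) (m : Fin 2) :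
    Typical μ fun l => ∃ K : ℝ, ∀ᶠ p : ℕ × Ω in l, S.fourthMoment (I p.1) (T p.1) m p.2 ≤ K := by
  have hM := he.M_nonneg
  have hmeas := S.measurable_obs
  have key := typical_of_meanLE (μ := μ) (Y := fun n => S.fourthMoment (I n) (T n) m)
    (g := fun _ => 1) (c := 8 * (M * M) + 8 * (1 + M)) (by positivity) (fun n => ?_)
    (Eventually.of_forall fun _ => one_pos) (Eventually.of_forall fun n => ?_)
  · simpa only [mul_one] using key
  · refine Measurable.const_mul (Finset.measurable_fun_sum _ fun t _ => Measurable.const_mul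
      (Finset.measurable_fun_sum _ fun i _ => ?_) _) _
    exact (hmeas (T n) m i t).pow_const 4
  · rw [mul_one]
    have h1 := MeanLE.average (μ := μ) (Finset.univ : Finset (Fin (len S.frac (T n) m)))
      (Y := fun t ω => (1 / ((I n).card : ℝ)) *
        ∑ i ∈ I n, S.obs (T n) ω i (offset S.frac (T n) m + t) ^ 4)
      (c := 8 * (M * M) + 8 * (1 + M)) (fun t _ => Measurable.const_mul
        (Finset.measurable_fun_sum _ fun i _ => (hmeas (T n) m i t).pow_const 4) _)
      (by positivity) fun t _ => MeanLE.average (I n)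
        (fun i _ => (hmeas (T n) m i t).pow_const 4) (by positivity)
        fun i _ => meanLE_obs_pow_four hf hl he hi (T n) m i t
    simp only [Finset.card_univ, Fintype.card_fin] at h1
    exact h1

/-- Third absolute moments of the products of factors and errors of a single unit are bounded. -/
lemma typical_thirdMoment (hf : S.Factors μ M SigF) (he : S.Errors μ M tau)
    (hi : S.Independence μ) (hs : SampleSizes S.frac N T c) (i : ℕ) (m : Fin 2) :
    Typical μ fun l => ∃ K : ℝ, ∀ᶠ p : ℕ × Ω in l, (len S.frac (T p.1) m : ℝ) ^ 2 *
      ∑ t, Real.sqrt (∑ j, S.scF (T p.1) m p.2 t j ^ 2) ^ 3 *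
        |S.grpE {i} (T p.1) m p.2 t ()| ^ 3 ≤ K := by
  have hM := he.M_nonneg
  have hmf : ∀ t, Measurable fun ω => ‖S.f t ω‖ := fun t => (S.measurable_f t).norm
  have h1 : ∀ t, MeanLE μ (fun ω => ‖S.f t ω‖ ^ 3 * |S.e i t ω| ^ 3) (1 + M * (1 + M)) := by
    intro t
    have h2 : MeanLE μ (fun ω => ‖S.f t ω‖ ^ 4 * S.e i t ω ^ 4) (M * (1 + M)) := by
      refine MeanLE.mul_of_indepFun (hi.f_e i t) (S.measurable_f t) (S.measurable_e i t)
        (g := fun x => ‖x‖ ^ 4) (h := fun x => x ^ 4) (by fun_prop) (by fun_prop)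
        (fun x => by positivity) hM ?_ (he.meanLE_pow_four i t)
      simpa only [MomentLE, MeanLE, abs_norm] using hf.moment t
    refine ((meanLE_const (μ := μ) 1).add h2 measurable_const zero_le_one
      (by positivity)).mono (fun ω => ?_) le_rfl
    have e1 : S.e i t ω ^ 4 = |S.e i t ω| ^ 4 := (Even.pow_abs (by decide) _).symm
    rw [e1, ← mul_pow, ← mul_pow]
    have h0 : 0 ≤ ‖S.f t ω‖ * |S.e i t ω| := by positivity
    generalize ‖S.f t ω‖ * |S.e i t ω| = x at h0
    rcases le_total x 1 with hx | hx
    · linarith [pow_le_one₀ (n := 3) h0 hx, pow_nonneg h0 4]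
    · linarith [pow_le_pow_right₀ hx (show 3 ≤ 4 by norm_num)]
  have key := typical_of_meanLE (μ := μ) (Y := fun n ω => (1 / (len S.frac (T n) m : ℝ)) *
    ∑ t : Fin (len S.frac (T n) m), ‖S.f (offset S.frac (T n) m + t) ω‖ ^ 3 *
      |S.e i (offset S.frac (T n) m + t) ω| ^ 3)
    (g := fun _ => 1) (c := 1 + M * (1 + M)) (by positivity) (fun n => by fun_prop)
    (Eventually.of_forall fun _ => one_pos) (Eventually.of_forall fun n => ?_)
  · refine key.mono fun l hl ⟨K, hK⟩ => ⟨K, ?_⟩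
    filter_upwards [hK, hl ((hs.len_pos m).comap Prod.fst)] with p hp hlen
    have hL0 : (0 : ℝ) < len S.frac (T p.1) m := by exact_mod_cast hlen
    rw [mul_one] at hp
    refine le_of_eq_of_le ?_ hp
    rw [Finset.mul_sum, Finset.mul_sum]
    refine Finset.sum_congr rfl fun t _ => ?_
    have e1 : Real.sqrt (∑ j, S.scF (T p.1) m p.2 t j ^ 2) =
        1 / Real.sqrt (len S.frac (T p.1) m) * ‖S.f (offset S.frac (T p.1) m + t) p.2‖ := by
      rw [← Real.sqrt_sq (norm_nonneg (S.f _ p.2)), norm_sq_euclidean, one_div,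
        ← Real.sqrt_inv, ← Real.sqrt_mul (by positivity), Finset.mul_sum]
      congr 1
      refine Finset.sum_congr rfl fun j _ => ?_
      rw [scF, Matrix.of_apply, mul_pow, div_pow, one_pow, Real.sq_sqrt hL0.le, one_div]
    have e2 : |S.grpE {i} (T p.1) m p.2 t ()| =
        1 / Real.sqrt (len S.frac (T p.1) m) * |S.e i (offset S.frac (T p.1) m + t) p.2| := by
      rw [grpE, Matrix.of_apply, abs_mul, abs_of_nonneg (by positivity)]
      simp
    rw [e1, e2, mul_pow, mul_pow]
    have e3 : (1 / Real.sqrt (len S.frac (T p.1) m)) ^ 2 = 1 / (len S.frac (T p.1) m : ℝ) := by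
      rw [div_pow, one_pow, Real.sq_sqrt hL0.le]
    have e4 : (len S.frac (T p.1) m : ℝ) ^ 2 * ((1 / Real.sqrt (len S.frac (T p.1) m)) ^ 3 *
        (1 / Real.sqrt (len S.frac (T p.1) m)) ^ 3) = 1 / (len S.frac (T p.1) m : ℝ) := by
      calc _ = (len S.frac (T p.1) m : ℝ) ^ 2 *
            ((1 / Real.sqrt (len S.frac (T p.1) m)) ^ 2) ^ 3 := by ring
        _ = _ := by rw [e3]; field_simp
    rw [← e4]
    ring
  · rw [mul_one]
    have h2 := MeanLE.average (μ := μ) (Finset.univ : Finset (Fin (len S.frac (T n) m)))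
      (Y := fun t ω => ‖S.f (offset S.frac (T n) m + t) ω‖ ^ 3 *
        |S.e i (offset S.frac (T n) m + t) ω| ^ 3)
      (c := 1 + M * (1 + M)) (fun t _ => by fun_prop) (by positivity) fun t _ => h1 _
    simpa only [Finset.card_univ, Fintype.card_fin] using h2

end Model

end GroupPrimitives

/-! ### The law of large numbers within a regime -/

section Covariance

variable {Ω : Type*} [MeasurableSpace Ω] {μ : Measure Ω} {r : ℕ}
  {S : Model Ω r} {N T : ℕ → ℕ} {c : ℝ} {Phi : ℕ → Matrix (Fin r) (Fin r) ℝ}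
  {PhiW : Matrix (Fin r) (Fin r) ℝ}

lemma typical_norm_sub_of_tendstoInMeasure {Y : ℕ → Ω → Matrix (Fin r) (Fin r) ℝ}
    {A : Matrix (Fin r) (Fin r) ℝ} (h : TendstoInMeasure μ Y atTop fun _ => A) {K : ℕ → ℕ}
    (hK : Tendsto K atTop atTop) :
    Typical μ fun l => Tendsto (fun p : ℕ × Ω => ‖Y (K p.1) p.2 - A‖) l (𝓝 0) := by
  refine typical_tendsto_zero (Y := fun n ω => ‖Y (K n) ω - A‖) fun δ hδ => ?_
  have := (tendstoInMeasure_iff_norm.1 h δ hδ).comp hK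
  simp only [abs_norm]
  exact this

lemma tendsto_breakDate {frac : ℝ} (h0 : 0 < frac) : Tendsto (breakDate frac) atTop atTop :=
  tendsto_nat_floor_atTop.comp (tendsto_natCast_atTop_atTop.const_mul_atTop h0)

lemma sum_regime_one {E : Type*} [AddCommGroup E] {frac : ℝ} (h1 : frac < 1) (T : ℕ)
    (φ : ℕ → E) : ∑ t ∈ regime frac T 1, φ t =
      ∑ t ∈ Finset.range T, φ t - ∑ t ∈ Finset.range (breakDate frac T), φ t := by
  rw [← Finset.sum_Ico_eq_sub φ (breakDate_le h1 T)]
  refine Finset.sum_congr ?_ fun _ _ => rfl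
  ext t
  simp only [regime, one_ne_zero, if_false, Finset.mem_filter, Finset.mem_range, Finset.mem_Ico]
  omega

namespace Model

/-- The Gram matrix of the scaled products of factors and errors of a single unit is their sample
second moment. The factor `√T_m` accounts for both factors and errors being scaled. -/
lemma score_gram (h1 : S.frac < 1) (T : ℕ) (m : Fin 2) (i : ℕ) (ω : Ω) :
    (Matrix.of fun t j => Real.sqrt (len S.frac T m) *
      (S.scF T m ω t j * S.grpE {i} T m ω t ()))ᵀ *
    (Matrix.of fun t j => Real.sqrt (len S.frac T m) *
      (S.scF T m ω t j * S.grpE {i} T m ω t ())) =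
    (1 / (len S.frac T m : ℝ)) • ∑ t ∈ regime S.frac T m,
      (S.e i t ω) ^ 2 • outer (S.f t ω) (S.f t ω) := by
  rw [sum_regime h1 T m fun t => (S.e i t ω) ^ 2 • outer (S.f t ω) (S.f t ω)]
  ext j k
  simp only [Matrix.mul_apply, Matrix.transpose_apply, Matrix.of_apply, Matrix.smul_apply,
    Matrix.sum_apply, outer, Matrix.vecMulVec_apply, smul_eq_mul, Finset.mul_sum, scF, grpE,
    Finset.card_singleton, Nat.cast_one, one_mul, Finset.sum_singleton]
  refine Finset.sum_congr rfl fun t _ => ?_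
  have hL0 : (0 : ℝ) < len S.frac T m := by exact_mod_cast (Nat.zero_le _).trans_lt t.2
  have e : (1 / Real.sqrt (len S.frac T m)) ^ 2 = 1 / (len S.frac T m : ℝ) := by
    rw [div_pow, one_pow, Real.sq_sqrt hL0.le]
  have e2 : Real.sqrt (len S.frac T m) * (1 / Real.sqrt (len S.frac T m)) = 1 :=
    mul_one_div_cancel (by positivity)
  rw [← e]
  generalize S.f (offset S.frac T m + t) ω = f
  linear_combination (S.e i (offset S.frac T m + t) ω) ^ 2 * f j * f k *
    (1 / Real.sqrt (len S.frac T m)) ^ 2 *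
    (Real.sqrt (len S.frac T m) * (1 / Real.sqrt (len S.frac T m)) + 1) * e2

/-- The average over the second regime is a combination, with bounded coefficients, of those over
the full sample and over the periods before the break, both of which converge to `Φ_i`. -/
lemma CLT.typical_covariance [IsProbabilityMeasure μ] (h : S.CLT μ Phi PhiW N T)
    (hs : SampleSizes S.frac N T c) (i : ℕ) :
    Typical μ fun l => Tendsto (fun p : ℕ × Ω =>
      ‖(Matrix.of fun t j => Real.sqrt (len S.frac (T p.1) 1) *
        (S.scF (T p.1) 1 p.2 t j * S.grpE {i} (T p.1) 1 p.2 t ()))ᵀ *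
      (Matrix.of fun t j => Real.sqrt (len S.frac (T p.1) 1) *
        (S.scF (T p.1) 1 p.2 t j * S.grpE {i} (T p.1) 1 p.2 t ())) - Phi i‖) l (𝓝 0) := by
  have hcp := hs.c_pos
  refine ((typical_norm_sub_of_tendstoInMeasure (h.lln i) hs.hT).and
    (typical_norm_sub_of_tendstoInMeasure (h.lln i)
      ((tendsto_breakDate hs.pos).comp hs.hT))).mono fun l hl ⟨h1, h2⟩ => ?_
  have h3 := (h1.add h2).const_mul (1 / c)
  rw [add_zero, mul_zero] at h3
  refine squeeze_zero' (Eventually.of_forall fun p => norm_nonneg _) ?_ h3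
  filter_upwards [hl (hs.len_lower.comap Prod.fst),
    hl ((hs.hT.eventually_gt_atTop 0).comap Prod.fst),
    hl (((tendsto_breakDate hs.pos).comp hs.hT).eventually_gt_atTop 0 |>.comap Prod.fst)]
    with p hlow hTp hB
  have hlen := hlow 1
  have hT0 : (0 : ℝ) < T p.1 := by exact_mod_cast hTp
  have hB0 : (0 : ℝ) < breakDate S.frac (T p.1) := by exact_mod_cast hB
  rw [score_gram hs.lt_one, sum_regime_one hs.lt_one]
  have hBT : (breakDate S.frac (T p.1) : ℝ) ≤ T p.1 := by
    exact_mod_cast breakDate_le hs.lt_one (T p.1)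
  have hL : (len S.frac (T p.1) 1 : ℝ) = T p.1 - breakDate S.frac (T p.1) := by
    simp only [len, one_ne_zero, if_false]
    exact Nat.cast_sub (breakDate_le hs.lt_one _)
  have hL0 : (0 : ℝ) < len S.frac (T p.1) 1 := (mul_pos hcp hT0).trans_le hlen
  simp only [Function.comp_apply]
  set L : ℝ := (len S.frac (T p.1) 1 : ℝ) with hLdef
  set B : ℕ := breakDate S.frac (T p.1) with hBdef
  set A₁ := ∑ t ∈ Finset.range (T p.1), (S.e i t p.2) ^ 2 • outer (S.f t p.2) (S.f t p.2) with hA₁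
  set A₂ := ∑ t ∈ Finset.range B, (S.e i t p.2) ^ 2 • outer (S.f t p.2) (S.f t p.2) with hA₂
  have e : (1 / L) • (A₁ - A₂) - Phi i = ((T p.1 : ℝ) / L) • ((1 / (T p.1 : ℝ)) • A₁ - Phi i) -
      ((B : ℝ) / L) • ((1 / (B : ℝ)) • A₂ - Phi i) := by
    have e1 : (T p.1 : ℝ) / L * (1 / (T p.1 : ℝ)) = 1 / L := by field_simp
    have e2 : (B : ℝ) / L * (1 / (B : ℝ)) = 1 / L := by field_simp
    have e3 : Phi i = ((T p.1 : ℝ) / L) • Phi i - ((B : ℝ) / L) • Phi i := by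
      rw [← sub_smul, ← sub_div, ← hL, div_self hL0.ne', one_smul]
    rw [smul_sub, smul_sub, smul_sub, smul_smul, smul_smul, e1, e2]
    conv_lhs => rw [e3]
    abel
  have hTL : (T p.1 : ℝ) / L ≤ 1 / c := by
    rw [div_le_div_iff₀ hL0 hcp]; linarith
  have hBL : (B : ℝ) / L ≤ 1 / c := (by gcongr : (B : ℝ) / L ≤ T p.1 / L).trans hTL
  rw [e]
  refine (norm_sub_le _ _).trans ?_
  rw [norm_smul, norm_smul, Real.norm_of_nonneg (by positivity),
    Real.norm_of_nonneg (by positivity), mul_add]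
  gcongr

end Model

end Covariance

/-! ### Estimators in scaled form -/

section Estimators

variable {Ω : Type*} [MeasurableSpace Ω] {r : ℕ} {S : Model Ω r} {N T : ℕ} {ω : Ω}
  (F : (m : Fin 2) → Matrix (Fin (len S.frac T m)) (Fin r) ℝ)

/-- The estimated factors, scaled to orthonormal columns. -/
noncomputable def scG {L : ℕ} (F : Matrix (Fin L) (Fin r) ℝ) : Matrix (Fin L) (Fin r) ℝ :=
  (1 / Real.sqrt L) • F

/-- The estimated loadings of a group of units, as the regression of its data on the estimated
factors. -/
lemma scG_transpose_mul_grp (I : Finset ℕ) (m : Fin 2) (j : Fin r) :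
    ((scG (F m))ᵀ * (S.scF T m ω * S.grpL I m ω + S.grpE I T m ω)) j () =
      (1 / Real.sqrt I.card) * ∑ i ∈ I, lamTilde (S.obs T ω) S.frac T F m i j := by
  rw [Matrix.mul_apply]
  simp only [Model.grp_data, Matrix.transpose_apply, scG,
    Matrix.smul_apply, smul_eq_mul, lamTilde, Pi.smul_apply, Finset.sum_apply, Finset.mul_sum]
  rw [Finset.sum_comm]
  refine Finset.sum_congr rfl fun i _ => Finset.sum_congr rfl fun t _ => ?_
  have hL0 : (0 : ℝ) ≤ len S.frac T m := Nat.cast_nonneg _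
  have e : (1 : ℝ) / len S.frac T m =
      1 / Real.sqrt (len S.frac T m) * (1 / Real.sqrt (len S.frac T m)) := by
    rw [one_div_mul_one_div, Real.mul_self_sqrt hL0]
  rw [e, Real.sqrt_mul (Nat.cast_nonneg _)]
  simp only [one_div, mul_inv]
  ring

lemma LamTilde_eq_smul (hN : 0 < N) (m : Fin 2) :
    LamTilde (S.obs T ω) S.frac N T F m = Real.sqrt N •
      ((S.scF T m ω * (S.scL N m ω)ᵀ + S.scE N T m ω)ᵀ * scG (F m)) := by
  rw [← Model.smul_dataMatrix]
  ext i j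
  have hN0 : (0 : ℝ) < N := by exact_mod_cast hN
  simp only [LamTilde, lamTilde, Matrix.of_apply, Matrix.smul_apply, Matrix.mul_apply,
    Matrix.transpose_apply, dataMatrix, scG, smul_eq_mul, Pi.smul_apply, Finset.sum_apply,
    Finset.mul_sum]
  refine Finset.sum_congr rfl fun t _ => ?_
  have hL0 : (0 : ℝ) ≤ len S.frac T m := Nat.cast_nonneg _
  have e : (1 : ℝ) / len S.frac T m =
      1 / Real.sqrt (len S.frac T m) * (1 / Real.sqrt (len S.frac T m)) := by
    rw [one_div_mul_one_div, Real.mul_self_sqrt hL0]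
  have e2 : Real.sqrt N * (Real.sqrt N)⁻¹ = 1 := mul_inv_cancel₀ (by positivity)
  rw [e, Real.sqrt_mul (Nat.cast_nonneg _)]
  simp only [one_div, mul_inv]
  linear_combination -((Real.sqrt (len S.frac T m))⁻¹ * (Real.sqrt (len S.frac T m))⁻¹ *
    S.obs T ω i (offset S.frac T m + t) * F m t j) * e2

lemma regCoef_smul {n : Type*} [Fintype n] {s : ℝ} (hs : s ≠ 0) (A₁ A₂ : Matrix n (Fin r) ℝ)
    (hu : IsUnit (A₁ᵀ * A₁).det) : regCoef (s • A₁) (s • A₂) = regCoef A₁ A₂ := by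
  have h0 : s * s ≠ 0 := mul_ne_zero hs hs
  have hinv : ((s * s) • (A₁ᵀ * A₁))⁻¹ = (s * s)⁻¹ • (A₁ᵀ * A₁)⁻¹ := by
    refine Matrix.inv_eq_left_inv ?_
    rw [Matrix.smul_mul, Matrix.mul_smul, smul_smul, inv_mul_cancel₀ h0, one_smul,
      Matrix.nonsing_inv_mul _ hu]
  simp only [regCoef, Matrix.transpose_smul, Matrix.smul_mul, Matrix.mul_smul, smul_smul]
  rw [hinv, Matrix.smul_mul, smul_smul, mul_inv_cancel₀ h0, one_smul]

lemma ZTilde_eq_regCoef (hN : 0 < N)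
    (hu : IsUnit (pcGram (S.scF T 0 ω * (S.scL N 0 ω)ᵀ + S.scE N T 0 ω) (scG (F 0))).det) :
    ZTilde (S.obs T ω) S.frac N T F = regCoef
      ((S.scF T 0 ω * (S.scL N 0 ω)ᵀ + S.scE N T 0 ω)ᵀ * scG (F 0))
      ((S.scF T 1 ω * (S.scL N 1 ω)ᵀ + S.scE N T 1 ω)ᵀ * scG (F 1)) := by
  have hN0 : (0 : ℝ) < N := by exact_mod_cast hN
  rw [← regCoef_smul (s := Real.sqrt N) (by positivity), ← LamTilde_eq_smul F hN,
    ← LamTilde_eq_smul F hN]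
  · rfl
  · rw [pcGram] at hu
    rw [Matrix.transpose_mul, Matrix.transpose_transpose]
    simpa only [Matrix.mul_assoc] using hu

/-- The estimated shift of a group, in the form to which `shift_lower_bound` applies. -/
lemma sum_wTilde (I : Finset ℕ) (j : Fin r) :
    ((scG (F 1))ᵀ * (S.scF T 1 ω * S.grpL I 1 ω + S.grpE I T 1 ω) -
      (ZTilde (S.obs T ω) S.frac N T F)ᵀ *
        ((scG (F 0))ᵀ * (S.scF T 0 ω * S.grpL I 0 ω + S.grpE I T 0 ω))) j () =
      (1 / Real.sqrt I.card) * ∑ i ∈ I, wTilde (S.obs T ω) S.frac N T F i j := by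
  rw [Matrix.sub_apply, scG_transpose_mul_grp, Matrix.mul_apply]
  simp only [scG_transpose_mul_grp, wTilde, Pi.sub_apply, Finset.sum_sub_distrib, mul_sub,
    Matrix.mulVec, dotProduct]
  congr 1
  rw [Finset.sum_comm, Finset.mul_sum]
  refine Finset.sum_congr rfl fun k _ => ?_
  rw [← Finset.mul_sum]
  ring

lemma sum_wTilde_dotProduct (I : Finset ℕ) (hI : I.Nonempty) :
    (∑ i ∈ I, wTilde (S.obs T ω) S.frac N T F i) ⬝ᵥ (∑ i ∈ I, wTilde (S.obs T ω) S.frac N T F i) =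
      I.card * ‖(scG (F 1))ᵀ * (S.scF T 1 ω * S.grpL I 1 ω + S.grpE I T 1 ω) -
      (ZTilde (S.obs T ω) S.frac N T F)ᵀ *
        ((scG (F 0))ᵀ * (S.scF T 0 ω * S.grpL I 0 ω + S.grpE I T 0 ω))‖ ^ 2 := by
  have hk : (0 : ℝ) < I.card := by exact_mod_cast hI.card_pos
  rw [norm_sq_eq_sum, dotProduct, Finset.mul_sum]
  refine Finset.sum_congr rfl fun j _ => ?_
  simp only [Finset.univ_unique, Finset.sum_singleton, PUnit.default_eq_unit]
  rw [sum_wTilde, mul_pow, div_pow, one_pow, Real.sq_sqrt hk.le, Finset.sum_apply]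
  field_simp

/-- The rotated shift `w` summed over a group. -/
lemma grpL_shift (I : Finset ℕ) (hI : I.Nonempty) :
    ‖S.grpL I 1 ω - S.Zᵀ * S.grpL I 0 ω‖ ^ 2 =
      (1 / (I.card : ℝ)) * ‖∑ i ∈ I, S.w i ω‖ ^ 2 := by
  have hk : (0 : ℝ) < I.card := by exact_mod_cast hI.card_pos
  rw [norm_sq_eq_sum, norm_sq_euclidean, Finset.mul_sum]
  refine Finset.sum_congr rfl fun j _ => ?_
  simp only [Finset.univ_unique, Finset.sum_singleton, PUnit.default_eq_unit]
  have e : (S.grpL I 1 ω - S.Zᵀ * S.grpL I 0 ω) j () =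
      (1 / Real.sqrt I.card) * (∑ i ∈ I, S.w i ω) j := by
    simp only [Matrix.sub_apply, Matrix.mul_apply, Model.grpL, Matrix.of_apply,
      Matrix.transpose_apply, WithLp.ofLp_sum, Finset.sum_apply, Model.w_apply,
      Finset.sum_sub_distrib, mul_sub]
    congr 1
    rw [Finset.sum_comm, Finset.mul_sum]
    refine Finset.sum_congr rfl fun k _ => ?_
    rw [← Finset.mul_sum]
    ring
  rw [e, mul_pow, div_pow, one_pow, Real.sq_sqrt hk.le]

/-- The residuals `ẽ` are the least squares residuals of the data on the estimated factors. -/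
lemma scaled_eTilde (i : ℕ) (m : Fin 2) (t : Fin (len S.frac T m)) :
    ((S.scF T m ω * S.grpL {i} m ω + S.grpE {i} T m ω) - scG (F m) * ((scG (F m))ᵀ *
      (S.scF T m ω * S.grpL {i} m ω + S.grpE {i} T m ω))) t () =
      (1 / Real.sqrt (len S.frac T m)) * eTilde (S.obs T ω) S.frac T F m i t := by
  rw [Matrix.sub_apply, Model.grp_data, Matrix.mul_apply]
  simp only [scG_transpose_mul_grp, eTilde, mul_sub, Finset.card_singleton, Nat.cast_one,
    Finset.sum_singleton, one_mul, Real.sqrt_one, div_one]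
  congr 1
  simp only [scG, Matrix.smul_apply, smul_eq_mul, dotProduct, Finset.mul_sum]
  exact Finset.sum_congr rfl fun j _ => by ring

variable {b : ℕ → ℝ}

lemma OmegaInd_posSemidef (h0 : 0 < S.frac) (h1 : S.frac < 1) (hb : ∀ n, 1 ≤ n → 0 < b n)
    (hlen : ∀ m, 0 < len S.frac T m) (i : ℕ) :
    (OmegaInd (S.obs T ω) S.frac N T F b i).PosSemidef :=
  ((hac_posSemidef (hb _ (hlen 0)) _).smul (by positivity)).add
    ((hac_posSemidef (hb _ (hlen 1)) _).smul (one_div_nonneg.2 (by linarith)))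

/-- The variance estimate of a unit is nonsingular if the products of estimated factors and
residuals span after the break. -/
lemma OmegaInd_posDef (h0 : 0 < S.frac) (h1 : S.frac < 1) (hb : ∀ n, 1 ≤ n → 0 < b n)
    (hlen : ∀ m, 0 < len S.frac T m) (i : ℕ)
    (hspan : ∀ x : Matrix (Fin r) Unit ℝ, (∀ t, (scG (F 1) * x) t () *
      ((S.scF T 1 ω * S.grpL {i} 1 ω + S.grpE {i} T 1 ω) - scG (F 1) * ((scG (F 1))ᵀ *
      (S.scF T 1 ω * S.grpL {i} 1 ω + S.grpE {i} T 1 ω))) t () = 0) → x = 0) :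
    (OmegaInd (S.obs T ω) S.frac N T F b i).PosDef := by
  refine Matrix.PosDef.posSemidef_add
    ((hac_posSemidef (hb _ (hlen 0)) _).smul (by positivity))
    (Matrix.PosDef.smul (hac_posDef (hb _ (hlen 1)) _ fun x hx => ?_)
      (one_div_pos.2 (by linarith)))
  have h := hspan (Matrix.replicateCol Unit x) fun t => ?_
  · exact funext fun j => by simpa using congrFun (congrFun h j) ()
  · rw [scaled_eTilde, mul_replicateCol]
    have := hx t
    rw [dotProduct_smul, smul_eq_mul, dotProduct_comm] at this
    simp only [Matrix.replicateCol_apply, scG, Matrix.smul_mulVec, Pi.smul_apply, smul_eq_mul]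
    rw [mul_mul_mul_comm, show (F 1 *ᵥ x) t = F 1 t ⬝ᵥ x from rfl, mul_comm (F 1 t ⬝ᵥ x), this,
      mul_zero]

lemma sum_OmegaInd_posDef (h0 : 0 < S.frac) (h1 : S.frac < 1) (hb : ∀ n, 1 ≤ n → 0 < b n)
    (hlen : ∀ m, 0 < len S.frac T m) {I : Finset ℕ} {i : ℕ} (hi : i ∈ I)
    (hpd : (OmegaInd (S.obs T ω) S.frac N T F b i).PosDef) :
    (∑ i ∈ I, OmegaInd (S.obs T ω) S.frac N T F b i).PosDef := by
  rw [← Finset.add_sum_erase _ _ hi]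
  exact hpd.add_posSemidef (Matrix.posSemidef_sum _ fun j _ =>
    OmegaInd_posSemidef F h0 h1 hb hlen j)

/-- The mean fourth power of the estimated factors. -/
noncomputable def factorFourth {L : ℕ} (F : Matrix (Fin L) (Fin r) ℝ) : ℝ :=
  (1 / (L : ℝ)) * ∑ t, (F t ⬝ᵥ F t) ^ 2

lemma mean_factor_sq {L : ℕ} {F : Matrix (Fin L) (Fin r) ℝ} (horth : (scG F)ᵀ * scG F = 1) :
    (1 / (L : ℝ)) * ∑ t, F t ⬝ᵥ F t = r := by
  have h := norm_sq_eq_trace (scG F)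
  rw [horth, Matrix.trace_one, Fintype.card_fin, norm_sq_eq_sum] at h
  rw [← h, Finset.mul_sum]
  refine Finset.sum_congr rfl fun t _ => ?_
  simp only [scG, Matrix.smul_apply, smul_eq_mul, dotProduct, Finset.mul_sum, mul_pow, div_pow,
    one_pow, Real.sq_sqrt (Nat.cast_nonneg (α := ℝ) L), ← sq]

/-- Bound on the HAC estimator of a single unit. The matrix `A` is `Z̃ᵀ` in the first regime and the
identity in the second. -/
lemma trace_hac_residual_le (hb : ∀ n, 1 ≤ n → 0 < b n) (m : Fin 2)
    (hlen : 0 < len S.frac T m) (horth : (scG (F m))ᵀ * scG (F m) = 1) (i : ℕ)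
    (A : Matrix (Fin r) (Fin r) ℝ) {z : ℝ} (hz : 0 ≤ z)
    (hA : ∀ x : Fin r → ℝ, (A *ᵥ x) ⬝ᵥ (A *ᵥ x) ≤ z * (x ⬝ᵥ x)) :
    (hac (b (len S.frac T m)) fun t =>
      eTilde (S.obs T ω) S.frac T F m i t • (A *ᵥ F m t)).trace ≤
    (1 + 2 * b (len S.frac T m)) * (z * (factorFourth (F m) + 4 * S.fourthMoment {i} T m ω *
      (1 + r ^ 2 * factorFourth (F m)))) := by
  have hb0 := hb _ hlen
  refine (trace_hac_le hb0 _).trans (mul_le_mul_of_nonneg_left ?_ (by positivity))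
  have h1 := mean_residual_factor_sq_le (fun t => S.obs T ω i (offset S.frac T m + t)) (F m)
    (mean_factor_sq horth) (lamTilde (S.obs T ω) S.frac T F m i) rfl
  have h2 : S.fourthMoment {i} T m ω = (1 / (len S.frac T m : ℝ)) *
      ∑ t : Fin (len S.frac T m), S.obs T ω i (offset S.frac T m + t) ^ 4 := by
    simp [Model.fourthMoment]
  rw [h2, factorFourth]
  refine le_trans ?_ (mul_le_mul_of_nonneg_left h1 hz)
  rw [mul_left_comm]
  gcongr
  rw [Finset.mul_sum]
  refine Finset.sum_le_sum fun t _ => ?_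
  rw [smul_dotProduct, dotProduct_smul, smul_eq_mul, smul_eq_mul, ← mul_assoc, ← sq]
  calc _ ≤ eTilde (S.obs T ω) S.frac T F m i t ^ 2 * (z * (F m t ⬝ᵥ F m t)) := by
        gcongr; exact hA _
    _ = _ := by rw [eTilde]; ring

lemma sum_fourthMoment_singleton (I : Finset ℕ) (hI : I.Nonempty) (m : Fin 2) :
    ∑ i ∈ I, S.fourthMoment {i} T m ω = I.card * S.fourthMoment I T m ω := by
  have hk : (0 : ℝ) < I.card := by exact_mod_cast hI.card_pos
  simp only [Model.fourthMoment, Finset.card_singleton, Nat.cast_one, Finset.sum_singleton,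
    div_one, one_mul, ← Finset.mul_sum]
  rw [Finset.sum_comm]
  field_simp

lemma mulVec_dotProduct_le (A : Matrix (Fin r) (Fin r) ℝ) (x : Fin r → ℝ) :
    (A *ᵥ x) ⬝ᵥ (A *ᵥ x) ≤ ‖A‖ ^ 2 * (x ⬝ᵥ x) := by
  rw [← norm_replicateCol_sq, ← norm_replicateCol_sq, ← mul_replicateCol, ← mul_pow]
  gcongr
  exact Matrix.frobenius_norm_mul _ _

/-- Bound on the sum over a group of the traces of the variance estimates, if the bandwidths are at
most `B` and the other quantities at most `K`. -/
lemma trace_sum_OmegaInd_le (h0 : 0 < S.frac) (h1 : S.frac < 1) (hb : ∀ n, 1 ≤ n → 0 < b n)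
    (hlen : ∀ m, 0 < len S.frac T m) (horth : ∀ m, (scG (F m))ᵀ * scG (F m) = 1)
    {I : Finset ℕ} (hI : I.Nonempty) {B K : ℝ} (hB : ∀ m, b (len S.frac T m) ≤ B)
    (hZ : ‖ZTilde (S.obs T ω) S.frac N T F‖ ≤ K) (hφ : ∀ m, factorFourth (F m) ≤ K)
    (hq : ∀ m, S.fourthMoment I T m ω ≤ K) (hK : 0 ≤ K) :
    (∑ i ∈ I, OmegaInd (S.obs T ω) S.frac N T F b i).trace ≤
      I.card * ((1 + 2 * B) * ((1 / S.frac * K ^ 2 + 1 / (1 - S.frac)) *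
        (K + 4 * K * (1 + r ^ 2 * K)))) := by
  have h1' : 0 < 1 - S.frac := by linarith
  have hk : (0 : ℝ) ≤ I.card := Nat.cast_nonneg _
  have hφ0 : ∀ m, 0 ≤ factorFourth (F m) := fun m => by rw [factorFourth]; positivity
  have hq0 : ∀ m, 0 ≤ S.fourthMoment I T m ω := fun m => by rw [Model.fourthMoment]; positivity
  have hsum : ∀ (m : Fin 2) (A : Matrix (Fin r) (Fin r) ℝ) (z : ℝ), 0 ≤ z →
      (∀ x : Fin r → ℝ, (A *ᵥ x) ⬝ᵥ (A *ᵥ x) ≤ z * (x ⬝ᵥ x)) →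
      ∑ i ∈ I, (hac (b (len S.frac T m)) fun t =>
        eTilde (S.obs T ω) S.frac T F m i t • (A *ᵥ F m t)).trace ≤
      I.card * ((1 + 2 * B) * (z * (K + 4 * K * (1 + r ^ 2 * K)))) := by
    intro m A z hz hA
    have hb0 := hb _ (hlen m)
    have hφm := hφ0 m
    have hqm := hq0 m
    calc _ ≤ ∑ i ∈ I, (1 + 2 * b (len S.frac T m)) * (z * (factorFourth (F m) +
          4 * S.fourthMoment {i} T m ω * (1 + r ^ 2 * factorFourth (F m)))) :=
          Finset.sum_le_sum fun i _ =>
            trace_hac_residual_le F hb m (hlen m) (horth m) i A hz hA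
      _ = I.card * ((1 + 2 * b (len S.frac T m)) * (z * (factorFourth (F m) +
          4 * S.fourthMoment I T m ω * (1 + r ^ 2 * factorFourth (F m))))) := by
          have e := sum_fourthMoment_singleton (S := S) (T := T) (ω := ω) I hI m
          rw [← Finset.mul_sum, ← Finset.mul_sum, Finset.sum_add_distrib, ← Finset.sum_mul,
            ← Finset.mul_sum, e, Finset.sum_const, nsmul_eq_mul]
          ring
      _ ≤ _ := by
          have := hφ m
          have := hq m
          have := hB m
          have hB0 : 0 ≤ B := hb0.le.trans (hB m)
          gcongr
  have hΘ1 := hsum 0 (ZTilde (S.obs T ω) S.frac N T F)ᵀ (K ^ 2) (by positivity) fun x => by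
    refine (mulVec_dotProduct_le _ x).trans ?_
    rw [Matrix.frobenius_norm_transpose]
    have := dotProduct_self_nonneg' x
    gcongr
  have hΘ2 := hsum 1 1 1 zero_le_one fun x => by rw [Matrix.one_mulVec, one_mul]
  simp only [Matrix.one_mulVec] at hΘ2
  rw [Matrix.trace_sum]
  simp only [OmegaInd, Matrix.trace_add, Matrix.trace_smul, smul_eq_mul, Finset.sum_add_distrib,
    ← Finset.mul_sum]
  calc _ ≤ 1 / S.frac * (I.card * ((1 + 2 * B) * (K ^ 2 * (K + 4 * K * (1 + r ^ 2 * K))))) +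
        1 / (1 - S.frac) * (I.card * ((1 + 2 * B) * (1 * (K + 4 * K * (1 + r ^ 2 * K))))) :=
        add_le_add (mul_le_mul_of_nonneg_left hΘ1 (by positivity))
          (mul_le_mul_of_nonneg_left hΘ2 (by positivity))
    _ = _ := by ring

end Estimators

/-! ### The regimes of a typical sample -/

section Regimes

variable {Ω : Type*} [MeasurableSpace Ω] {μ : Measure Ω} [IsProbabilityMeasure μ] {r : ℕ}
  {S : Model Ω r} {N T : ℕ → ℕ} {c M : ℝ} {tau : ℕ → ℕ → ℝ}
  {SigF : Matrix (Fin r) (Fin r) ℝ} {SigL : Fin 2 → Matrix (Fin r) (Fin r) ℝ}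
  {Ft : (N T : ℕ) → Ω → (m : Fin 2) → Matrix (Fin (len S.frac T m)) (Fin r) ℝ}

/-- Both regimes, in scaled form, are factor regimes along the filter `l`. -/
def AreFactorRegimes (S : Model Ω r) (N T : ℕ → ℕ)
    (Ft : (N T : ℕ) → Ω → (m : Fin 2) → Matrix (Fin (len S.frac T m)) (Fin r) ℝ)
    (SigF : Matrix (Fin r) (Fin r) ℝ) (SigL : Fin 2 → Matrix (Fin r) (Fin r) ℝ)
    (l : Filter (ℕ × Ω)) : Prop :=
  ∀ m, IsFactorRegime l (fun p : ℕ × Ω => sampleRate N T p.1) (fun p => S.scF (T p.1) m p.2)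
    (fun p => S.scL (N p.1) m p.2) (fun p => S.scE (N p.1) (T p.1) m p.2)
    (fun p => scG (Ft (N p.1) (T p.1) p.2 m)) SigF (SigL m)

/-- The assumptions make both regimes factor regimes on typical samples. -/
lemma typical_areFactorRegimes (hs : SampleSizes S.frac N T c)
    (hFt : ∀ N T ω m, r ≤ len S.frac T m →
      IsPrincipalComponents (dataMatrix (S.obs T ω) S.frac N T m) (Ft N T ω m))
    (hf : S.Factors μ M SigF) (hl : S.Loadings μ M SigL) (he : S.Errors μ M tau)
    (hcorr : S.ErrorCorr μ M tau) (hbreak : S.BreakFraction μ SigF N T)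
    (hp : S.PooledMoments μ M) : Typical μ (AreFactorRegimes S N T Ft SigF SigL) := by
  have hM := he.M_nonneg
  have key : ∀ m, Typical μ fun l => IsFactorRegime l (fun p : ℕ × Ω => sampleRate N T p.1)
      (fun p => S.scF (T p.1) m p.2) (fun p => S.scL (N p.1) m p.2)
      (fun p => S.scE (N p.1) (T p.1) m p.2)
      (fun p => scG (Ft (N p.1) (T p.1) p.2 m)) SigF (SigL m) := by
    intro m
    refine ((hbreak.typical_factor hs m).and <| (hl.typical_loading hs.hN m).and <|
      (he.typical_noise (N := N) (T := T) m).and <| (he.typical_noiseGram hcorr hs m).and <|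
      (hp.typical_noiseLoading hM hs m).and (hp.typical_factorNoise hM hs m)).mono
      fun l hle ⟨h1, h2, h3, h4, h5, h6⟩ => ?_
    have hlen : Tendsto (fun n => (len S.frac (T n) m : ℝ)) atTop atTop :=
      tendsto_atTop_mono' _ (hs.len_lower.mono fun n h => h m)
        ((tendsto_natCast_atTop_atTop.comp hs.hT).const_mul_atTop hs.c_pos)
    refine ⟨(tendsto_sampleRate hs.hN hs.hT).comp (tendsto_comap.mono_left hle),
      hf.posDef.isUnit, (hl.posDef m).isUnit, h1, h2, h3, h4, h5, h6, ?_⟩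
    filter_upwards [hle ((hs.len_pos m).comap Prod.fst),
      hle ((hs.hN.eventually_gt_atTop 0).comap Prod.fst),
      hle ((hlen.eventually_ge_atTop (r : ℝ)).comap Prod.fst)] with p hL hN hr
    rw [← Model.smul_dataMatrix]
    exact (hFt _ _ _ _ (by exact_mod_cast hr)).isUnitPC hL hN
  exact ((key 0).and (key 1)).mono fun l _ h => Fin.forall_fin_two.2 h

/-- A single random variable is bounded on typical samples. -/
lemma typical_bound_of_measurable {Y : Ω → ℝ} (hY : Measurable Y) :
    Typical μ fun l => ∃ C : ℝ, ∀ᶠ p : ℕ × Ω in l, Y p.2 ≤ C := by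
  refine typical_of_bound (Y := fun _ => Y) fun ε hε => ?_
  have h : Tendsto (fun n : ℕ => μ {ω | (n : ℝ) < Y ω}) atTop
      (𝓝 (μ (⋂ n : ℕ, {ω | (n : ℝ) < Y ω}))) :=
    tendsto_measure_iInter_atTop
      (fun n => (measurableSet_lt measurable_const hY).nullMeasurableSet)
      (fun m n hmn ω hω => lt_of_le_of_lt (Nat.cast_le.2 hmn) (show (n : ℝ) < Y ω from hω))
      ⟨0, measure_ne_top _ _⟩
  have h0 : (⋂ n : ℕ, {ω | (n : ℝ) < Y ω}) = ∅ := by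
    refine Set.eq_empty_of_forall_notMem fun ω hω => ?_
    obtain ⟨n, hn⟩ := exists_nat_ge (Y ω)
    exact absurd (Set.mem_iInter.1 hω n) (not_lt.2 hn)
  rw [h0, measure_empty] at h
  obtain ⟨n, hn⟩ := (h.eventually (ge_mem_nhds (by simpa using hε :
    (0 : ENNReal) < ENNReal.ofReal ε))).exists
  exact ⟨n, Eventually.of_forall fun _ => hn⟩

end Regimes

/-! ### Groups of units -/

section Groups

variable {Ω : Type*} [MeasurableSpace Ω] {μ : Measure Ω} {r : ℕ}
  {S : Model Ω r} {N T : ℕ → ℕ} {c C M : ℝ} {tau : ℕ → ℕ → ℝ}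

/-- Groups `I n` of units, containing the unit `i₀`, whose loadings, errors and scores average out
at the rate `|I| ^ (-1/2)`. A single unit and the whole cross section are such groups. -/
structure IsBalancedGroup (μ : Measure Ω) (S : Model Ω r) (T : ℕ → ℕ) (I : ℕ → Finset ℕ) (i₀ : ℕ)
    (C : ℝ) : Prop where
  nonneg : 0 ≤ C
  mem : ∀ᶠ n in atTop, i₀ ∈ I n
  loading : ∀ m, Typical μ fun l => NormBigO l (fun p : ℕ × Ω => S.grpL (I p.1) m p.2) fun _ => 1
  error : ∀ n t, MeanLE μ
    (fun ω => ((1 / Real.sqrt (I n).card) * ∑ i ∈ I n, S.e i t ω) ^ 2) C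
  score : ∀ m n, MeanLE μ (fun ω => ‖(1 / Real.sqrt (((I n).card : ℝ) * len S.frac (T n) m)) •
    ∑ t ∈ regime S.frac (T n) m, ∑ i ∈ I n, S.e i t ω • S.f t ω‖ ^ 2) C

lemma IsBalancedGroup.typical {I : ℕ → Finset ℕ} {i₀ : ℕ} (h : IsBalancedGroup μ S T I i₀ C)
    (hs : SampleSizes S.frac N T c) (m : Fin 2) : Typical μ fun l =>
      NormBigO l (fun p : ℕ × Ω => S.grpL (I p.1) m p.2) (fun _ => 1) ∧
      NormBigO l (fun p : ℕ × Ω => S.grpE (I p.1) (T p.1) m p.2) (fun _ => 1) ∧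
      NormBigO l (fun p : ℕ × Ω => (S.scF (T p.1) m p.2)ᵀ * S.grpE (I p.1) (T p.1) m p.2)
        (fun p => sampleRate N T p.1) :=
  (h.loading m).and <| (Model.typical_grpE hs h.nonneg m h.error).and
    (Model.typical_scF_grpE hs h.nonneg m (h.score m))

lemma norm_grpL (I : Finset ℕ) (m : Fin 2) (ω : Ω) :
    ‖S.grpL I m ω‖ = ‖(1 / Real.sqrt I.card) • ∑ i ∈ I, S.lam m i ω‖ := by
  refine (sq_eq_sq₀ (norm_nonneg _) (norm_nonneg _)).1 ?_
  rw [norm_sq_eq_sum, norm_sq_euclidean]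
  refine Finset.sum_congr rfl fun j _ => ?_
  simp [Model.grpL]

/-- A single unit. -/
lemma isBalancedGroup_singleton [IsProbabilityMeasure μ] (he : S.Errors μ M tau)
    (hp : S.PooledMoments μ M) (i : ℕ) :
    IsBalancedGroup μ S T (fun _ => {i}) i (1 + M) where
  nonneg := by linarith [he.M_nonneg]
  mem := Eventually.of_forall fun _ => Finset.mem_singleton_self i
  loading m := by
    refine (typical_bound_of_measurable (μ := μ) (S.measurable_lam m i).norm).mono
      fun l _ ⟨K, hK⟩ => IsBigO.of_bound K ?_
    filter_upwards [hK] with p hp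
    rw [norm_norm, norm_one, mul_one, norm_grpL]
    simpa using hp
  error n t := by simpa using he.meanLE_sq i t
  score m n := by
    have h4 : MeanLE μ (fun ω => ‖(1 / Real.sqrt (len S.frac (T n) m)) •
        ∑ t ∈ regime S.frac (T n) m, S.e i t ω • S.f t ω‖ ^ 4) M := by
      simpa only [MomentLE, MeanLE, abs_norm] using hp.c m (T n) i
    refine ((meanLE_const (μ := μ) 1).add h4 measurable_const zero_le_one he.M_nonneg).mono
      (fun ω => ?_) le_rfl
    simp only [Finset.card_singleton, Nat.cast_one, one_mul, Finset.sum_singleton]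
    have := le_one_add_pow (sq_nonneg ‖(1 / Real.sqrt (len S.frac (T n) m)) •
        ∑ t ∈ regime S.frac (T n) m, S.e i t ω • S.f t ω‖) (show 1 ≤ 2 by norm_num)
    rwa [← pow_mul] at this

/-- The cross section. -/
lemma isBalancedGroup_range (hM : 0 ≤ M) (hN : Tendsto N atTop atTop)
    (hpe : S.PooledErrors μ M) (hp : S.PooledMoments μ M) (hl : S.LoadingSums μ M) :
    IsBalancedGroup μ S T (fun n => Finset.range (N n)) 0 M where
  nonneg := hM
  mem := (hN.eventually_gt_atTop 0).mono fun n hn => Finset.mem_range.2 hn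
  loading m := by
    refine ((hl.a m).comp hN).typical.mono fun l _ h => ?_
    simpa only [NormBigO, norm_grpL, Finset.card_range] using h
  error n t := by
    simpa only [MomentLE, MeanLE, Finset.card_range, sq_abs] using hpe (N n) t
  score m n := by
    simpa only [MomentLE, MeanLE, Finset.card_range, abs_norm] using hp.d m (N n) (T n)

end Groups

/-! ### The Wald statistic of a group -/

section Wald

variable {Ω : Type*} [MeasurableSpace Ω] {μ : Measure Ω} [IsProbabilityMeasure μ] {r : ℕ}
  {S : Model Ω r} {N T : ℕ → ℕ} {c C M : ℝ} {tau : ℕ → ℕ → ℝ}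
  {SigF : Matrix (Fin r) (Fin r) ℝ} {SigL : Fin 2 → Matrix (Fin r) (Fin r) ℝ}
  {Phi : ℕ → Matrix (Fin r) (Fin r) ℝ} {PhiW : Matrix (Fin r) (Fin r) ℝ}
  {Ft : (N T : ℕ) → Ω → (m : Fin 2) → Matrix (Fin (len S.frac T m)) (Fin r) ℝ}
  {b : ℕ → ℝ} {I : ℕ → Finset ℕ} {i₀ : ℕ} {l : Filter (ℕ × Ω)}

/-- The statistic `T (∑ w̃_i)ᵀ (∑ Ω̃_{W,i})⁻¹ (∑ w̃_i)` of a group of units. -/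
noncomputable def groupStat {r : ℕ} (x : ℕ → ℕ → ℝ) (frac : ℝ) (N T : ℕ)
    (F : (m : Fin 2) → Matrix (Fin (len frac T m)) (Fin r) ℝ) (b : ℕ → ℝ) (I : Finset ℕ) : ℝ :=
  T * ((∑ i ∈ I, wTilde x frac N T F i) ⬝ᵥ
    ((∑ i ∈ I, OmegaInd x frac N T F b i)⁻¹ *ᵥ ∑ i ∈ I, wTilde x frac N T F i))

lemma statInd_eq_groupStat {r : ℕ} (x : ℕ → ℕ → ℝ) (frac : ℝ) (N T : ℕ)
    (F : (m : Fin 2) → Matrix (Fin (len frac T m)) (Fin r) ℝ) (b : ℕ → ℝ) (i : ℕ) :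
    statInd x frac N T F b i = groupStat x frac N T F b {i} := by
  simp only [statInd, groupStat, Finset.sum_singleton]

/-- The joint statistic is that of the cross section: the factors `1 / N` of the means cancel. -/
lemma statJoint_eq_groupStat {r : ℕ} (x : ℕ → ℕ → ℝ) (frac : ℝ) {N : ℕ} (hN : 0 < N) (T : ℕ)
    (F : (m : Fin 2) → Matrix (Fin (len frac T m)) (Fin r) ℝ) (b : ℕ → ℝ)
    (h : (∑ i ∈ Finset.range N, OmegaInd x frac N T F b i).PosDef) :
    statJoint x frac N T F b = groupStat x frac N T F b (Finset.range N) := by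
  have hN0 : (N : ℝ) ≠ 0 := by exact_mod_cast hN.ne'
  have hinv : (OmegaJoint x frac N T F b)⁻¹ =
      (N : ℝ) • (∑ i ∈ Finset.range N, OmegaInd x frac N T F b i)⁻¹ := by
    refine Matrix.inv_eq_left_inv ?_
    rw [OmegaJoint, Matrix.smul_mul, Matrix.mul_smul, smul_smul, mul_one_div_cancel hN0, one_smul,
      Matrix.nonsing_inv_mul _ ((Matrix.isUnit_iff_isUnit_det _).1 h.isUnit)]
  rw [statJoint, groupStat, hinv, wBar, Matrix.mulVec_smul, Matrix.smul_mulVec, smul_dotProduct,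
    dotProduct_smul, dotProduct_smul]
  simp only [smul_eq_mul]
  field_simp

/-- The variance estimate of a unit is nonsingular, as the second regime already contributes a
positive definite matrix. -/
lemma AreFactorRegimes.posDef (hs : SampleSizes S.frac N T c) (hb : ∀ n, 1 ≤ n → 0 < b n)
    (h : AreFactorRegimes S N T Ft SigF SigL l) (hl : l ≤ comap Prod.fst atTop) {i : ℕ}
    (hβ : NormBigO l (fun p : ℕ × Ω => S.grpL {i} 1 p.2) fun _ => 1)
    (hε : NormBigO l (fun p : ℕ × Ω => S.grpE {i} (T p.1) 1 p.2) fun _ => 1)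
    (hFε : NormBigO l (fun p : ℕ × Ω => (S.scF (T p.1) 1 p.2)ᵀ * S.grpE {i} (T p.1) 1 p.2)
      fun p => sampleRate N T p.1)
    {Φ : Matrix (Fin r) (Fin r) ℝ} (hΦ : IsUnit Φ)
    (hcov : Tendsto (fun p : ℕ × Ω =>
      ‖(Matrix.of fun t j => Real.sqrt (len S.frac (T p.1) 1) *
        (S.scF (T p.1) 1 p.2 t j * S.grpE {i} (T p.1) 1 p.2 t ()))ᵀ *
      (Matrix.of fun t j => Real.sqrt (len S.frac (T p.1) 1) *
        (S.scF (T p.1) 1 p.2 t j * S.grpE {i} (T p.1) 1 p.2 t ())) - Φ‖) l (𝓝 0))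
    {K : ℝ} (hK : ∀ᶠ p : ℕ × Ω in l, (len S.frac (T p.1) 1 : ℝ) ^ 2 *
      ∑ t, Real.sqrt (∑ j, S.scF (T p.1) 1 p.2 t j ^ 2) ^ 3 *
        |S.grpE {i} (T p.1) 1 p.2 t ()| ^ 3 ≤ K) :
    ∀ᶠ p : ℕ × Ω in l, (OmegaInd (S.obs (T p.1) p.2) S.frac (N p.1) (T p.1)
      (Ft (N p.1) (T p.1) p.2) b i).PosDef := by
  have hlen : ∀ m, ∀ᶠ p : ℕ × Ω in l, 0 < len S.frac (T p.1) m := fun m =>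
    hl ((hs.len_pos m).comap Prod.fst)
  filter_upwards [(h 1).residual_span hβ hε hFε (hlen 1) hΦ hcov hK, hlen 0, hlen 1]
    with p hp h0 h1
  exact OmegaInd_posDef _ hs.pos hs.lt_one hb (Fin.forall_fin_two.2 ⟨h0, h1⟩) i hp

lemma Model.Bandwidth.len_le (hb : S.Bandwidth b N T) : ∃ K : ℝ, 0 < K ∧ ∀ (T : ℕ) (m : Fin 2),
    1 ≤ T → b (len S.frac T m) ≤ K * (T : ℝ) ^ (1 / 3 : ℝ) := by
  obtain ⟨K, hK, h⟩ := hb.upper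
  refine ⟨K, hK, fun T m hT => ?_⟩
  fin_cases m
  · exact (h T hT).2.1.le
  · exact (h T hT).2.2.le

/-- The variance estimates of a group are of the order of the bandwidth. -/
lemma AreFactorRegimes.trace_le (hs : SampleSizes S.frac N T c) (hb : S.Bandwidth b N T)
    (h : AreFactorRegimes S N T Ft SigF SigL l) (hl : l ≤ comap Prod.fst atTop)
    (hW : NormBigO l (fun p : ℕ × Ω => (S.scL (N p.1) 0 p.2)ᵀ *
      (S.scL (N p.1) 1 p.2 - S.scL (N p.1) 0 p.2 * S.Z)) fun p => sampleRate N T p.1)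
    (hI : ∀ᶠ n in atTop, (I n).Nonempty)
    (hq : ∀ m, ∃ K : ℝ, ∀ᶠ p : ℕ × Ω in l, S.fourthMoment (I p.1) (T p.1) m p.2 ≤ K)
    (hQ : ∀ m, ∃ K : ℝ, ∀ᶠ p : ℕ × Ω in l,
      S.fourthMoment (Finset.range (N p.1)) (T p.1) m p.2 ≤ K) :
    ∃ K : ℝ, 0 < K ∧ ∀ᶠ p : ℕ × Ω in l, (∑ i ∈ I p.1, OmegaInd (S.obs (T p.1) p.2) S.frac (N p.1)
      (T p.1) (Ft (N p.1) (T p.1) p.2) b i).trace ≤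
        (I p.1).card * (K * (T p.1 : ℝ) ^ (1 / 3 : ℝ)) := by
  obtain ⟨KB, hKB, hB⟩ := hb.len_le
  obtain ⟨KZ, hKZ, hZ⟩ := (bdd_regCoef (h 0) (h 1) S.Z hW).exists_bound
  -- the estimated factors have bounded fourth moments
  have hφ : ∀ m, ∃ K : ℝ, 0 ≤ K ∧ ∀ᶠ p : ℕ × Ω in l,
      factorFourth (Ft (N p.1) (T p.1) p.2 m) ≤ K := fun m => by
    obtain ⟨K₁, hK₁, h₁⟩ := ((h m).bddX.transpose.bdd_mul (h m).bddG).exists_bound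
    obtain ⟨K₂, hK₂, h₂⟩ := (h m).pcGram_inv.2.exists_bound
    obtain ⟨K₃, h₃⟩ := hQ m
    refine ⟨(K₁ * K₂) ^ 4 * |K₃|, by positivity, ?_⟩
    filter_upwards [h₁, h₂, h₃, (h m).pc, (h m).pcGram_inv.1,
      hl ((hs.len_pos m).comap Prod.fst),
      hl ((hs.hN.eventually_gt_atTop 0).comap Prod.fst)] with p e₁ e₂ e₃ hpc hu hL hN
    simp only [regData] at e₁ e₂ hu
    rw [← Model.smul_dataMatrix] at e₁ e₂ hpc hu
    refine (mean_factor_fourth_le hL hN hpc hu).trans ?_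
    have e4 : (1 / (len S.frac (T p.1) m : ℝ)) * ∑ t : Fin (len S.frac (T p.1) m),
        (1 / (N p.1 : ℝ)) * ∑ i : Fin (N p.1), dataMatrix (S.obs (T p.1) p.2) S.frac (N p.1)
          (T p.1) m t i ^ 4 = S.fourthMoment (Finset.range (N p.1)) (T p.1) m p.2 := by
      simp only [Model.fourthMoment, Finset.card_range, dataMatrix, Matrix.of_apply,
        Finset.sum_range]
    rw [e4]
    have e5 : 0 ≤ S.fourthMoment (Finset.range (N p.1)) (T p.1) m p.2 := by
      rw [Model.fourthMoment]; positivity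
    have e6 := e₃.trans (le_abs_self K₃)
    exact mul_le_mul (by gcongr; exacts [e₁, e₂]) e6 e5 (by positivity)
  choose Kφ hKφ hφ using hφ
  choose Kq hq using hq
  set K := KZ + (Kφ 0 + Kφ 1) + (|Kq 0| + |Kq 1|) with hK
  have hK0 : 0 < K := by have := hKφ 0; have := hKφ 1; positivity
  have hKφ' : ∀ m, Kφ m ≤ K := by
    have := hKφ 0; have := hKφ 1; have := abs_nonneg (Kq 0); have := abs_nonneg (Kq 1)
    refine Fin.forall_fin_two.2 ⟨?_, ?_⟩ <;> linarith
  have hKq' : ∀ m, Kq m ≤ K := by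
    have := hKφ 0; have := hKφ 1
    have := le_abs_self (Kq 0); have := le_abs_self (Kq 1)
    have := abs_nonneg (Kq 0); have := abs_nonneg (Kq 1)
    refine Fin.forall_fin_two.2 ⟨?_, ?_⟩ <;> linarith
  have hKZ' : KZ ≤ K := by
    have := hKφ 0; have := hKφ 1; have := abs_nonneg (Kq 0); have := abs_nonneg (Kq 1)
    linarith
  have h1f : 0 < 1 - S.frac := by linarith [hs.lt_one]
  have h0f := hs.pos
  set D := (1 / S.frac * K ^ 2 + 1 / (1 - S.frac)) * (K + 4 * K * (1 + r ^ 2 * K)) with hD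
  have hD0 : 0 < D := by positivity
  refine ⟨(1 + 2 * KB) * D, by positivity, ?_⟩
  filter_upwards [hZ, hφ 0, hφ 1, hq 0, hq 1, (h 0).pc, (h 1).pc, (h 0).pcGram_inv.1,
    hl ((hs.len_pos 0).comap Prod.fst), hl ((hs.len_pos 1).comap Prod.fst),
    hl ((hs.hN.eventually_gt_atTop 0).comap Prod.fst),
    hl ((hs.hT.eventually_ge_atTop 1).comap Prod.fst), hl (hI.comap Prod.fst)]
    with p hZ hφ0 hφ1 hq0 hq1 hpc0 hpc1 hu hl0 hl1 hN hT hI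
  have hlen : ∀ m, 0 < len S.frac (T p.1) m := Fin.forall_fin_two.2 ⟨hl0, hl1⟩
  have hT1 : (1 : ℝ) ≤ (T p.1 : ℝ) ^ (1 / 3 : ℝ) :=
    Real.one_le_rpow (by exact_mod_cast hT) (by norm_num)
  have hZ' : ‖ZTilde (S.obs (T p.1) p.2) S.frac (N p.1) (T p.1) (Ft (N p.1) (T p.1) p.2)‖ ≤ K := by
    rw [ZTilde_eq_regCoef _ hN hu]
    exact hZ.trans hKZ'
  refine (trace_sum_OmegaInd_le (Ft (N p.1) (T p.1) p.2) hs.pos hs.lt_one hb.pos hlen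
    (Fin.forall_fin_two.2 ⟨hpc0.orth, hpc1.orth⟩) hI (fun m => hB (T p.1) m hT) hZ'
    (Fin.forall_fin_two.2 ⟨hφ0.trans (hKφ' 0), hφ1.trans (hKφ' 1)⟩)
    (Fin.forall_fin_two.2 ⟨hq0.trans (hKq' 0), hq1.trans (hKq' 1)⟩) hK0.le).trans ?_
  refine mul_le_mul_of_nonneg_left ?_ (Nat.cast_nonneg _)
  rw [← hD, mul_right_comm]
  refine mul_le_mul_of_nonneg_right ?_ hD0.le
  linarith

/-- On typical samples the shift of a group is bounded by `d + O(N ^ (-1/2) + T ^ (-1/2))`, where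
`d ^ 2` is bounded by `T ^ (-2/3)` times the statistic. -/
lemma typical_shift_le_groupStat (hs : SampleSizes S.frac N T c)
    (hFt : ∀ N T ω m, r ≤ len S.frac T m →
      IsPrincipalComponents (dataMatrix (S.obs T ω) S.frac N T m) (Ft N T ω m))
    (hf : S.Factors μ M SigF) (hload : S.Loadings μ M SigL) (he : S.Errors μ M tau)
    (hindep : S.Independence μ) (hcorr : S.ErrorCorr μ M tau)
    (hbreak : S.BreakFraction μ SigF N T) (hb : S.Bandwidth b N T)
    (hp : S.PooledMoments μ M) (hclt : S.CLT μ Phi PhiW N T)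
    (hI : IsBalancedGroup μ S T I i₀ C) :
    Typical μ fun l => ∃ K : ℝ, 0 < K ∧ ∀ᶠ p : ℕ × Ω in l,
      (∑ i ∈ I p.1, OmegaInd (S.obs (T p.1) p.2) S.frac (N p.1) (T p.1)
        (Ft (N p.1) (T p.1) p.2) b i).PosDef ∧
      ∃ d : ℝ, 0 ≤ d ∧ ‖(1 / Real.sqrt (I p.1).card) • ∑ i ∈ I p.1, S.w i p.2‖ ≤
          K * (d + K * sampleRate N T p.1) ∧
        d ^ 2 * (T p.1 : ℝ) ^ (2 / 3 : ℝ) ≤ K * groupStat (S.obs (T p.1) p.2) S.frac (N p.1)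
          (T p.1) (Ft (N p.1) (T p.1) p.2) b (I p.1) := by
  -- a single unit of the group suffices for the variance estimate to be nonsingular
  have hU := isBalancedGroup_singleton (T := T) he hp i₀
  have hfour : ∀ J : ℕ → Finset ℕ, Typical μ fun l => ∀ m, ∃ K : ℝ, ∀ᶠ p : ℕ × Ω in l,
      S.fourthMoment (J p.1) (T p.1) m p.2 ≤ K := fun J =>
    ((Model.typical_fourthMoment hf hload he hindep T J 0).and
      (Model.typical_fourthMoment hf hload he hindep T J 1)).mono fun l _ h =>
      Fin.forall_fin_two.2 h
  refine ((typical_areFactorRegimes hs hFt hf hload he hcorr hbreak hp).and <|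
    (hload.typical_shift hs).and <| (hU.typical hs 1).and <| (hI.typical hs 0).and <|
    (hI.typical hs 1).and <| (hfour I).and <|
    (hfour fun n => Finset.range (N n)).and <| (hclt.typical_covariance hs i₀).and
    (Model.typical_thirdMoment hf he hindep hs i₀ 1)).mono
    fun l hl ⟨hreg, hW, ⟨hβ, hε, hFε⟩, ⟨hβ', hε₀, hFε₀⟩, ⟨_, hε₁, hFε₁⟩, hq, hQ, hcov,
      ⟨K₃, hK₃⟩⟩ => ?_
  obtain ⟨K₁, hK₁, hshift⟩ := shift_lower_bound (hreg 0) (hreg 1) S.Z hW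
    (β₂ := fun p : ℕ × Ω => S.grpL (I p.1) 1 p.2) hβ' hε₀ hε₁ hFε₀ hFε₁
  obtain ⟨K₂, hK₂, htr⟩ := hreg.trace_le hs hb hl hW
    (hI.mem.mono fun n hn => ⟨i₀, hn⟩) hq hQ
  have hpd := hreg.posDef hs hb.pos hl hβ hε hFε (hclt.posDef i₀).isUnit hcov hK₃
  refine ⟨K₁ + K₂, by positivity, ?_⟩
  filter_upwards [hshift, htr, hpd, (hreg 0).pcGram_inv.1, hl (hI.mem.comap Prod.fst),
    hl ((hs.len_pos 0).comap Prod.fst), hl ((hs.len_pos 1).comap Prod.fst),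
    hl ((hs.hN.eventually_gt_atTop 0).comap Prod.fst),
    hl ((hs.hT.eventually_gt_atTop 0).comap Prod.fst)]
    with p hshift htr hpd hu hi hl0 hl1 hN hT
  have hIne : (I p.1).Nonempty := ⟨i₀, hi⟩
  have hk : (0 : ℝ) < (I p.1).card := by exact_mod_cast hIne.card_pos
  have hT0 : (0 : ℝ) < T p.1 := by exact_mod_cast hT
  have hPD := sum_OmegaInd_posDef (Ft (N p.1) (T p.1) p.2) hs.pos hs.lt_one hb.pos
    (Fin.forall_fin_two.2 ⟨hl0, hl1⟩) hi hpd
  refine ⟨hPD, ‖(scG (Ft (N p.1) (T p.1) p.2 1))ᵀ *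
      (S.scF (T p.1) 1 p.2 * S.grpL (I p.1) 1 p.2 + S.grpE (I p.1) (T p.1) 1 p.2) -
      (ZTilde (S.obs (T p.1) p.2) S.frac (N p.1) (T p.1) (Ft (N p.1) (T p.1) p.2))ᵀ *
        ((scG (Ft (N p.1) (T p.1) p.2 0))ᵀ *
        (S.scF (T p.1) 0 p.2 * S.grpL (I p.1) 0 p.2 + S.grpE (I p.1) (T p.1) 0 p.2))‖,
    norm_nonneg _, ?_, ?_⟩
  · have e : ‖(1 / Real.sqrt (I p.1).card) • ∑ i ∈ I p.1, S.w i p.2‖ =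
        ‖S.grpL (I p.1) 1 p.2 - S.Zᵀ * S.grpL (I p.1) 0 p.2‖ := by
      refine (sq_eq_sq₀ (norm_nonneg _) (norm_nonneg _)).1 ?_
      rw [grpL_shift _ hIne, norm_smul, mul_pow, Real.norm_of_nonneg (by positivity), div_pow,
        one_pow, Real.sq_sqrt hk.le]
    simp only [regData] at hshift
    rw [e, ZTilde_eq_regCoef _ hN hu]
    refine hshift.trans ?_
    rw [abs_of_nonneg (sampleRate_nonneg _)]
    have := sampleRate_nonneg (N := N) (T := T) p.1
    gcongr <;> linarith
  · set D := ‖(scG (Ft (N p.1) (T p.1) p.2 1))ᵀ *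
      (S.scF (T p.1) 1 p.2 * S.grpL (I p.1) 1 p.2 + S.grpE (I p.1) (T p.1) 1 p.2) -
      (ZTilde (S.obs (T p.1) p.2) S.frac (N p.1) (T p.1) (Ft (N p.1) (T p.1) p.2))ᵀ *
        ((scG (Ft (N p.1) (T p.1) p.2 0))ᵀ *
        (S.scF (T p.1) 0 p.2 * S.grpL (I p.1) 0 p.2 + S.grpE (I p.1) (T p.1) 0 p.2))‖ with hD
    have h1 := dotProduct_self_le_trace_mul hPD (∑ i ∈ I p.1, wTilde (S.obs (T p.1) p.2) S.frac
      (N p.1) (T p.1) (Ft (N p.1) (T p.1) p.2) i)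
    rw [sum_wTilde_dotProduct _ _ hIne, ← hD] at h1
    rw [groupStat]
    set q := (∑ i ∈ I p.1, wTilde (S.obs (T p.1) p.2) S.frac (N p.1) (T p.1)
        (Ft (N p.1) (T p.1) p.2) i) ⬝ᵥ
      ((∑ i ∈ I p.1, OmegaInd (S.obs (T p.1) p.2) S.frac (N p.1) (T p.1)
        (Ft (N p.1) (T p.1) p.2) b i)⁻¹ *ᵥ ∑ i ∈ I p.1, wTilde (S.obs (T p.1) p.2) S.frac (N p.1)
        (T p.1) (Ft (N p.1) (T p.1) p.2) i) with hq
    have hq0 : 0 ≤ q := by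
      simpa using hPD.inv.posSemidef.dotProduct_mulVec_nonneg (∑ i ∈ I p.1,
        wTilde (S.obs (T p.1) p.2) S.frac (N p.1) (T p.1) (Ft (N p.1) (T p.1) p.2) i)
    have h2 : D ^ 2 ≤ K₂ * (T p.1 : ℝ) ^ (1 / 3 : ℝ) * q := by
      refine le_of_mul_le_mul_left ?_ hk
      rw [← mul_assoc]
      exact h1.trans (mul_le_mul_of_nonneg_right htr hq0)
    have h3 : (T p.1 : ℝ) ^ (1 / 3 : ℝ) * (T p.1 : ℝ) ^ (2 / 3 : ℝ) = T p.1 := by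
      rw [← Real.rpow_add hT0]; norm_num
    calc D ^ 2 * (T p.1 : ℝ) ^ (2 / 3 : ℝ)
        ≤ K₂ * (T p.1 : ℝ) ^ (1 / 3 : ℝ) * q * (T p.1 : ℝ) ^ (2 / 3 : ℝ) := by gcongr
      _ = K₂ * (T p.1 * q) := by linear_combination K₂ * q * h3
      _ ≤ _ := by gcongr; linarith

/-- The statistic of a group diverges where the shift of the group is at least of the order `1 / s`,
with `s` small compared to `T ^ (1/3)` and to `(N ^ (-1/2) + T ^ (-1/2))⁻¹`. -/
lemma tendsto_of_shift_bound {β : Type*} {l : Filter (ℕ × β)} {s : ℕ → ℝ} {w q : ℕ × β → ℝ}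
    {K η : ℝ}
    (hl : l ≤ comap Prod.fst atTop) (hsp : ∀ᶠ n in atTop, 0 < s n)
    (hrate : Tendsto (fun n => sampleRate N T n * s n) atTop (𝓝 0))
    (hgrow : Tendsto (fun n => (T n : ℝ) ^ (2 / 3 : ℝ) / s n ^ 2) atTop atTop)
    (hK : 0 < K) (hη : 0 < η) (hw : ∀ᶠ p in l, η / s p.1 ≤ w p)
    (h : ∀ᶠ p in l, ∃ d : ℝ, 0 ≤ d ∧ w p ≤ K * (d + K * sampleRate N T p.1) ∧
      d ^ 2 * (T p.1 : ℝ) ^ (2 / 3 : ℝ) ≤ K * q p) : Tendsto q l atTop := by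
  have hgrow' := (hgrow.const_mul_atTop (show 0 < (η / (2 * K)) ^ 2 / K by positivity)).comp
    ((tendsto_comap (f := Prod.fst) (β := ℕ)).mono_left hl)
  refine tendsto_atTop_mono' l ?_ hgrow'
  have hsmall := hrate.eventually (gt_mem_nhds (show (0 : ℝ) < η / (2 * K ^ 2) by positivity))
  filter_upwards [hw, h, hl (hsp.comap Prod.fst), hl (hsmall.comap Prod.fst)]
    with p hw ⟨d, hd, h1, h2⟩ hs hr
  have h3 : η / (2 * K) ≤ d * s p.1 := by
    have e1 : η ≤ K * (d + K * sampleRate N T p.1) * s p.1 := (div_le_iff₀ hs).1 (hw.trans h1)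
    rw [lt_div_iff₀ (by positivity)] at hr
    rw [div_le_iff₀ (by positivity)]
    linarith
  have h4 : (η / (2 * K)) ^ 2 ≤ d ^ 2 * s p.1 ^ 2 := by
    rw [← mul_pow]; gcongr
  have hT0 : (0 : ℝ) ≤ (T p.1 : ℝ) ^ (2 / 3 : ℝ) := by positivity
  simp only [Function.comp_apply]
  rw [div_mul_div_comm, div_le_iff₀ (by positivity)]
  calc (η / (2 * K)) ^ 2 * (T p.1 : ℝ) ^ (2 / 3 : ℝ)
      ≤ d ^ 2 * s p.1 ^ 2 * (T p.1 : ℝ) ^ (2 / 3 : ℝ) := by gcongr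
    _ = d ^ 2 * (T p.1 : ℝ) ^ (2 / 3 : ℝ) * s p.1 ^ 2 := by ring
    _ ≤ K * q p * s p.1 ^ 2 := by gcongr
    _ = _ := by ring

lemma Model.measurable_w (S : Model Ω r) (i : ℕ) : Measurable (S.w i) := by
  have h : Measurable fun ω => (S.w i ω).ofLp := by
    refine measurable_pi_iff.2 fun j => ?_
    simp only [Model.w_apply]
    fun_prop
  exact (WithLp.measurable_toLp 2 _).comp h

/-- For `α ≤ 1/2`, `T ^ (α/2)` is at most `T ^ (1/4)`, hence small compared to `√T` and, as
`T ^ (1/4) ≤ √(T ^ (2/3))`, to `√N`. -/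
lemma tendsto_sampleRate_mul_rpow {alpha : ℝ}
    (hT : Tendsto T atTop atTop) (ha : alpha ≤ 1 / 2)
    (h : Tendsto (fun n => (T n : ℝ) ^ (2 / 3 : ℝ) / N n) atTop (𝓝 0)) :
    Tendsto (fun n => sampleRate N T n * (T n : ℝ) ^ (alpha / 2)) atTop (𝓝 0) := by
  have hTr : Tendsto (fun n => (T n : ℝ)) atTop atTop := tendsto_natCast_atTop_atTop.comp hT
  have h1 : Tendsto (fun n => Real.sqrt ((T n : ℝ) ^ (2 / 3 : ℝ) / N n)) atTop (𝓝 0) := by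
    have := (Real.continuous_sqrt.tendsto 0).comp h
    rwa [Real.sqrt_zero] at this
  have h2 : Tendsto (fun n => (T n : ℝ) ^ (-(1 / 4 : ℝ))) atTop (𝓝 0) :=
    (tendsto_rpow_neg_atTop (by norm_num)).comp hTr
  have h3 := h1.add h2
  rw [add_zero] at h3
  refine squeeze_zero' ?_ ?_ h3
  · exact Eventually.of_forall fun n => mul_nonneg (sampleRate_nonneg n) (by positivity)
  filter_upwards [hT.eventually_ge_atTop 1] with n hTn
  have hT1 : (1 : ℝ) ≤ T n := by exact_mod_cast hTn
  have hT0 : (0 : ℝ) < T n := by linarith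
  rw [sampleRate, add_mul]
  have e1 : (T n : ℝ) ^ (alpha / 2) ≤ (T n : ℝ) ^ (1 / 4 : ℝ) :=
    Real.rpow_le_rpow_of_exponent_le hT1 (by linarith)
  have e2 : (T n : ℝ) ^ (1 / 4 : ℝ) ≤ Real.sqrt ((T n : ℝ) ^ (2 / 3 : ℝ)) := by
    rw [Real.sqrt_eq_rpow, ← Real.rpow_mul hT0.le]
    exact Real.rpow_le_rpow_of_exponent_le hT1 (by norm_num)
  have e3 : 1 / Real.sqrt (T n) * (T n : ℝ) ^ (1 / 4 : ℝ) = (T n : ℝ) ^ (-(1 / 4 : ℝ)) := by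
    rw [Real.sqrt_eq_rpow, one_div, ← Real.rpow_neg hT0.le, ← Real.rpow_add hT0]
    norm_num
  refine add_le_add ?_ ?_
  · rw [Real.sqrt_div' _ (Nat.cast_nonneg _), div_mul_eq_mul_div, one_mul]
    gcongr
    exact e1.trans e2
  · rw [← e3]
    gcongr

lemma tendsto_rpow_div_rpow_sq {alpha : ℝ} (hT : Tendsto T atTop atTop) (ha : alpha ≤ 1 / 2) :
    Tendsto (fun n => (T n : ℝ) ^ (2 / 3 : ℝ) / ((T n : ℝ) ^ (alpha / 2)) ^ 2) atTop atTop := by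
  have hTr : Tendsto (fun n => (T n : ℝ)) atTop atTop := tendsto_natCast_atTop_atTop.comp hT
  refine ((tendsto_rpow_atTop (show 0 < 2 / 3 - alpha by linarith)).comp hTr).congr' ?_
  filter_upwards [hT.eventually_gt_atTop 0] with n hTn
  have hT0 : (0 : ℝ) < T n := by exact_mod_cast hTn
  rw [Function.comp_apply, Real.rpow_sub hT0, ← Real.rpow_natCast, ← Real.rpow_mul hT0.le]
  norm_num

lemma typical_eventually_of_tendsto_one {R : ℕ → Ω → Prop}
    (hR : ∀ n, MeasurableSet {ω | R n ω}) (h : Tendsto (fun n => μ {ω | R n ω}) atTop (𝓝 1)) :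
    Typical μ fun l => ∀ᶠ p in l, R p.1 p.2 := by
  refine typical_eventually ?_
  have h1 : Tendsto (fun n => 1 - μ {ω | R n ω}) atTop (𝓝 (1 - 1)) :=
    ENNReal.Tendsto.sub tendsto_const_nhds h (Or.inl ENNReal.one_ne_top)
  rw [tsub_self] at h1
  exact h1.congr fun n => (prob_compl_eq_one_sub (hR n)).symm

/-- The statistic of a unit diverges where the unit has a break. -/
lemma diverges_statInd (hs : SampleSizes S.frac N T c)
    (hFt : ∀ N T ω m, r ≤ len S.frac T m →
      IsPrincipalComponents (dataMatrix (S.obs T ω) S.frac N T m) (Ft N T ω m))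
    (hf : S.Factors μ M SigF) (hload : S.Loadings μ M SigL) (he : S.Errors μ M tau)
    (hindep : S.Independence μ) (hcorr : S.ErrorCorr μ M tau)
    (hbreak : S.BreakFraction μ SigF N T) (hb : S.Bandwidth b N T)
    (hp : S.PooledMoments μ M) (hclt : S.CLT μ Phi PhiW N T) (i : ℕ) :
    DivergesInProbOn μ {ω | S.w i ω ≠ 0} fun n ω =>
      statInd (S.obs (T n) ω) S.frac (N n) (T n) (Ft (N n) (T n) ω) b i := by
  -- where `w i` does not vanish, it is bounded away from zero on typical samples
  have hη := typical_bound_of_measurable (μ := μ) (S.measurable_w i).norm.inv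
  refine ((typical_shift_le_groupStat hs hFt hf hload he hindep hcorr hbreak hb hp hclt
    (isBalancedGroup_singleton he hp i)).and hη).diverges fun l hl ⟨⟨K, hK, h⟩, ⟨C, hC⟩⟩ => ?_
  have hl' : l ≤ comap Prod.fst atTop := hl.trans inf_le_left
  have hne : ∀ᶠ p : ℕ × Ω in l, S.w i p.2 ≠ 0 := hl (mem_inf_of_right (mem_principal_self _))
  simp only [statInd_eq_groupStat]
  refine tendsto_of_shift_bound (s := fun _ => 1) (η := 1 / (|C| + 1))
    (w := fun p => ‖S.w i p.2‖) hl' (Eventually.of_forall fun _ => one_pos)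
    (by simpa only [mul_one] using tendsto_sampleRate hs.hN hs.hT) ?_ hK (by positivity) ?_ ?_
  · simp only [one_pow, div_one]
    exact (tendsto_rpow_atTop (show (0 : ℝ) < 2 / 3 by norm_num)).comp
      (tendsto_natCast_atTop_atTop.comp hs.hT)
  · filter_upwards [hC, hne] with p hp hw
    have hw0 : 0 < ‖S.w i p.2‖ := norm_pos_iff.2 hw
    rw [div_one, one_div, inv_le_comm₀ (by positivity) hw0]
    linarith [le_abs_self C, show ‖S.w i p.2‖⁻¹ ≤ C from hp]
  · filter_upwards [h] with p hp
    have := hp.2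
    simp only [Finset.card_singleton, Nat.cast_one, Real.sqrt_one, div_one, one_smul,
      Finset.sum_singleton] at this
    exact this

/-- The joint statistic diverges if the average shift is of order `T ^ (-α/2) N ^ (-1/2)`. -/
lemma diverges_statJoint (hs : SampleSizes S.frac N T c)
    (hFt : ∀ N T ω m, r ≤ len S.frac T m →
      IsPrincipalComponents (dataMatrix (S.obs T ω) S.frac N T m) (Ft N T ω m))
    (hf : S.Factors μ M SigF) (hload : S.Loadings μ M SigL) (he : S.Errors μ M tau)
    (hindep : S.Independence μ) (hcorr : S.ErrorCorr μ M tau)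
    (hbreak : S.BreakFraction μ SigF N T) (hb : S.Bandwidth b N T)
    (hpe : S.PooledErrors μ M) (hp : S.PooledMoments μ M) (hclt : S.CLT μ Phi PhiW N T)
    (hsums : S.LoadingSums μ M) {alpha : ℝ} (hshift : S.ShiftSums μ alpha N T) :
    DivergesInProbOn μ Set.univ fun n ω =>
      statJoint (S.obs (T n) ω) S.frac (N n) (T n) (Ft (N n) (T n) ω) b := by
  obtain ⟨-, ha, C, hC, hlim⟩ := hshift
  have hη : Typical μ fun l => ∀ᶠ p in l, C < ‖(((T p.1 : ℝ) ^ (alpha / 2)) /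
      Real.sqrt (N p.1)) • ∑ i ∈ Finset.range (N p.1), S.w i p.2‖ := by
    refine typical_eventually_of_tendsto_one (R := fun n ω => C < ‖(((T n : ℝ) ^ (alpha / 2)) /
      Real.sqrt (N n)) • ∑ i ∈ Finset.range (N n), S.w i ω‖) (fun n => ?_) hlim
    have hw : Measurable fun ω => ∑ i ∈ Finset.range (N n), S.w i ω :=
      Finset.measurable_fun_sum _ fun i _ => S.measurable_w i
    have hw' := (hw.const_smul (((T n : ℝ) ^ (alpha / 2)) / Real.sqrt (N n))).norm
    exact measurableSet_lt measurable_const hw'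
  refine ((typical_shift_le_groupStat hs hFt hf hload he hindep hcorr hbreak hb hp hclt
    (isBalancedGroup_range he.M_nonneg hs.hN hpe hp hsums)).and hη).diverges
    fun l hl ⟨⟨K, hK, h⟩, hC'⟩ => ?_
  have hl' : l ≤ comap Prod.fst atTop := hl.trans inf_le_left
  have key : Tendsto (fun p : ℕ × Ω => groupStat (S.obs (T p.1) p.2) S.frac (N p.1) (T p.1)
      (Ft (N p.1) (T p.1) p.2) b (Finset.range (N p.1))) l atTop := by
    refine tendsto_of_shift_bound (s := fun n => (T n : ℝ) ^ (alpha / 2)) (η := C)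
      (w := fun p => ‖(1 / Real.sqrt (Finset.range (N p.1)).card) •
        ∑ i ∈ Finset.range (N p.1), S.w i p.2‖) hl' ?_
      (tendsto_sampleRate_mul_rpow hs.hT ha hb.rate) (tendsto_rpow_div_rpow_sq hs.hT ha)
      hK hC ?_ (h.mono fun p hp => hp.2)
    · filter_upwards [hs.hT.eventually_gt_atTop 0] with n hn
      have : (0 : ℝ) < T n := by exact_mod_cast hn
      positivity
    · filter_upwards [hC', hl' ((hs.hT.eventually_gt_atTop 0).comap Prod.fst)] with p hp hTp
      have hT0 : (0 : ℝ) < T p.1 := by exact_mod_cast hTp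
      rw [div_le_iff₀ (by positivity), Finset.card_range]
      refine hp.le.trans_eq ?_
      rw [div_eq_mul_one_div, mul_smul, norm_smul, Real.norm_of_nonneg (by positivity), mul_comm]
  refine key.congr' ?_
  filter_upwards [h, hl' ((hs.hN.eventually_gt_atTop 0).comap Prod.fst)] with p hp hNp
  exact (statJoint_eq_groupStat _ _ hNp _ _ _ hp.1).symm

end Wald

end FactorBreak

theorem mainTheorem5 {Ω : Type*} [MeasurableSpace Ω] (μ : Measure Ω) [IsProbabilityMeasure μ]
    {r : ℕ} (S : FactorBreak.Model Ω r)
    -- principal components estimates of the factors in the two regimes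
    (Ft : (N T : ℕ) → Ω → (m : Fin 2) → Matrix (Fin (FactorBreak.len S.frac T m)) (Fin r) ℝ)
    (hFt : ∀ N T ω m, r ≤ FactorBreak.len S.frac T m →
      FactorBreak.IsPrincipalComponents
        (FactorBreak.dataMatrix (S.obs T ω) S.frac N T m) (Ft N T ω m))
    -- bandwidths, and sample sizes tending jointly to infinity
    (b : ℕ → ℝ) (N T : ℕ → ℕ) (hN : Tendsto N atTop atTop) (hT : Tendsto T atTop atTop)
    (M : ℝ) (SigF : Matrix (Fin r) (Fin r) ℝ) (SigL : Fin 2 → Matrix (Fin r) (Fin r) ℝ)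
    (tau : ℕ → ℕ → ℝ) (Phi : ℕ → Matrix (Fin r) (Fin r) ℝ) (PhiW : Matrix (Fin r) (Fin r) ℝ)
    (hfactors : S.Factors μ M SigF) (hloadings : S.Loadings μ M SigL)
    (herrors : S.Errors μ M tau) (hindep : S.Independence μ)
    (hcorr : S.ErrorCorr μ M tau) (hmoments : S.Moments μ M)
    (heigen : FactorBreak.Model.DistinctEigenvalues SigF SigL)
    (hbreak : S.BreakFraction μ SigF N T) (hband : S.Bandwidth b N T)
    (hpooled : S.PooledErrors μ M) (hpmoments : S.PooledMoments μ M)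
    (hclt : S.CLT μ Phi PhiW N T)
    (hrate : Tendsto (fun n => Real.sqrt (T n) / N n) atTop (𝓝 0))
    -- the alternative `W ≠ 0`
    (halt : ∃ i, ¬ ∀ᵐ ω ∂μ, S.w i ω = 0) :
    (∀ i : ℕ, FactorBreak.DivergesInProbOn μ {ω | S.w i ω ≠ 0}
      (fun n ω => FactorBreak.statInd (S.obs (T n) ω) S.frac (N n) (T n)
        (Ft (N n) (T n) ω) b i)) ∧
    (S.LoadingSums μ M → ∀ alpha : ℝ, S.ShiftSums μ alpha N T →
      Tendsto (fun n => Real.sqrt (N n) / (T n : ℝ) ^ (1 - alpha / 2)) atTop (𝓝 0) →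
      FactorBreak.DivergesInProbOn μ Set.univ
        (fun n ω => FactorBreak.statJoint (S.obs (T n) ω) S.frac (N n) (T n)
          (Ft (N n) (T n) ω) b)) := by
  obtain ⟨c, hc, hlen⟩ := FactorBreak.exists_len_lower hbreak.pos hbreak.lt_one
  have hs : FactorBreak.SampleSizes S.frac N T c :=
    ⟨hN, hT, hbreak.pos, hbreak.lt_one, hc, hT.eventually hlen⟩
  exact ⟨FactorBreak.diverges_statInd hs hFt hfactors hloadings herrors hindep hcorr hbreak hband
      hpmoments hclt,
    fun hsums _ hshift _ => FactorBreak.diverges_statJoint hs hFt hfactors hloadings herrors hindep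
      hcorr hbreak hband hpooled hpmoments hclt hsums hshift⟩
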